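/- Let $A$ be a unital $C^*$-algebra, let $E$ be a right Hilbert $A$-module with $A$-valued inner product $\langle\cdot|\cdot\rangle$ (linear in the second variable), and let $\varphi:A\to B(E)$ be a unital $*$-homomorphism into the $C^*$-algebra of adjointable operators on $E$; so $(A,E,\varphi)$ is a unital $C^*$-correspondence. Let $K(E)\subseteq B(E)$ be the closed linear span of the operators $|e\rangle\langle f|:x\mapsto e\langle f|x\rangle$. Let $\mathcal T_E$ be the $C^*$-algebra of operators on the Fock space $A\oplus E\oplus E^{\otimes 2}\oplus\cdots$ generated by $A$ (acting on the left) and the creation operators $x\mapsto e\otimes x$, $e\in E$, and let $\psi_1:K(E)\to\mathcal T_E$ be the homomorphism $|e\rangle\langle f|\mapsto ef^*$. Put $$J_E=\{a\in A \mid \varphi(a)\in K(E)\text{ and } ab=ba=0 \text{ for all } b\in\ker\varphi\}.$$ The Cuntz–Pimsner algebra $\mathcal O_E$ is the quotient of $\mathcal T_E$ by the closed two-sided ideal generated by the elements $a-\psi_1(\varphi(a))$, $a\in J_E$. The gauge action of the circle $\mathbb S^1$ on $B=\mathcal O_E$ fixes $A$ and scales $e\in E$ by $z\in\mathbb S^1$.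 The gauge action is free, i.e. the functions $z\mapsto a\,(z\cdot b)$, $a,b\in B$, span a norm-dense subspace of $C(\mathbb S^1,B)=B\otimes C(\mathbb S^1)$, if and only if the following three conditions hold: * (faithful) $\varphi$ is injective; * (finitely generated) $E$ is finitely generated as a right $A$-module; * (artinian) the descending chain of ideals $I_0=A$, $I_{n+1}=\overline{\mathrm{span}}\{\langle e|\varphi(x)f\rangle \mid e,f\in E,\ x\in I_n\}$ eventually stabilizes. The same three conditions are also equivalent to the gauge action being saturated, i.e. to the linear span of $B_\tau^*B_\tau$ being dense in the fixed-point algebra $B^{\mathbb S^1}$ for every character $\tau$ of $\mathbb S^1$, where $B_\tau=\{b\in B\mid z\cdot b=\tau(z)b \text{ for all } z\in\mathbb S^1\}$. -/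

import Mathlib

noncomputable section

namespace CuntzPimsner

open scoped InnerProductSpace
open MulOpposite

set_option linter.unusedSectionVars false


/-! ### Right Hilbert modules and adjointable operators

A right Hilbert `A`-module is a complete Mathlib `CStarModule` over `Aᵐᵒᵖ`; the right action of `a`
on `x` is `op a • x`, and the `A`-valued inner product, linear in the second variable, is
`braket A x y`. -/

instance instStarOrderedRingOp {A : Type*} [CStarAlgebra A] [PartialOrder A]
    [StarOrderedRing A] : StarOrderedRing Aᵐᵒᵖ :=
  StarOrderedRing.of_nonneg_iff' (fun {x y} h z => add_le_add_right (α := A) h (unop z))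
    fun x => by
      constructor
      · intro h
        obtain ⟨s, hs⟩ := CStarAlgebra.nonneg_iff_eq_star_mul_self.1 (show 0 ≤ unop x from h)
        exact ⟨op (star s), unop_injective (by simp [hs])⟩
      · rintro ⟨s, rfl⟩
        exact mul_star_self_nonneg (unop s)

section Hilbert

variable {A E : Type*} [CStarAlgebra A] [PartialOrder A] [StarOrderedRing A]
  [NormedAddCommGroup E] [NormedSpace ℂ E] [SMul Aᵐᵒᵖ E] [CStarModule Aᵐᵒᵖ E]

/-- The `A`-valued inner product `⟨x|y⟩` of a right Hilbert `A`-module. -/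
def braket (A : Type*) {E : Type*} [Inner Aᵐᵒᵖ E] (x y : E) : A := unop (inner Aᵐᵒᵖ x y)

theorem ext_inner {x y : E} (h : ∀ z : E, inner Aᵐᵒᵖ z x = inner Aᵐᵒᵖ z y) : x = y := by
  have : inner Aᵐᵒᵖ (x - y) (x - y) = 0 := by
    rw [CStarModule.inner_sub_right, h, sub_self]
  exact sub_eq_zero.1 (CStarModule.inner_self.1 this)

variable (A E) in
/-- The adjointable operators, as a subalgebra of the bounded operators. -/
def adjointableSubalgebra : Subalgebra ℂ (E →L[ℂ] E) where
  carrier := {T | ∃ S : E →L[ℂ] E, ∀ x y, inner Aᵐᵒᵖ (T x) y = inner Aᵐᵒᵖ x (S y)}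
  mul_mem' := by
    rintro T T' ⟨S, h⟩ ⟨S', h'⟩
    exact ⟨S' * S, fun x y => by simp [h, h']⟩
  add_mem' := by
    rintro T T' ⟨S, h⟩ ⟨S', h'⟩
    exact ⟨S + S', fun x y => by simp [h, h']⟩
  algebraMap_mem' c := ⟨algebraMap ℂ _ (star c), fun x y => by
    simp [Algebra.algebraMap_eq_smul_one]⟩

variable (A E) in
/-- The C⋆-algebra `B(E)` of adjointable operators on the right Hilbert `A`-module `E`, with the
operator norm. -/
def Adjointable : Type _ := adjointableSubalgebra A E

instance instNormedRingAdjointable : NormedRing (Adjointable A E) :=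
  inferInstanceAs (NormedRing (adjointableSubalgebra A E))

instance instNormedAlgebraAdjointable : NormedAlgebra ℂ (Adjointable A E) :=
  inferInstanceAs (NormedAlgebra ℂ (adjointableSubalgebra A E))

namespace Adjointable

/-- The bounded operator underlying an adjointable operator. -/
def toCLM : Adjointable A E →ₐ[ℂ] (E →L[ℂ] E) := (adjointableSubalgebra A E).val

instance instCoeFun : CoeFun (Adjointable A E) (fun _ => E → E) := ⟨fun T => toCLM T⟩

/-- An adjointable operator from an operator and its adjoint. -/
def mk (T S : E →L[ℂ] E) (h : ∀ x y, inner Aᵐᵒᵖ (T x) y = inner Aᵐᵒᵖ x (S y)) :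
    Adjointable A E := ⟨T, S, h⟩

theorem mk_apply (T S : E →L[ℂ] E) (h : ∀ x y, inner Aᵐᵒᵖ (T x) y = inner Aᵐᵒᵖ x (S y)) (x : E) :
    mk (A := A) T S h x = T x := rfl

theorem norm_toCLM (T : Adjointable A E) : ‖toCLM T‖ = ‖T‖ := rfl

theorem ext {S T : Adjointable A E} (h : ∀ x, S x = T x) : S = T :=
  Subtype.ext (ContinuousLinearMap.ext h)

/-- The adjoint of an adjointable operator. -/
instance instStar : Star (Adjointable A E) where
  star T := ⟨T.2.choose, T.1, fun x y => by
    rw [← CStarModule.star_inner, ← T.2.choose_spec, CStarModule.star_inner]⟩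

theorem inner_left (T : Adjointable A E) (x y : E) :
    inner Aᵐᵒᵖ (T x) y = inner Aᵐᵒᵖ x (star T y) :=
  T.2.choose_spec x y

theorem star_eq_of {T S : Adjointable A E}
    (h : ∀ x y, inner Aᵐᵒᵖ (T x) y = inner Aᵐᵒᵖ x (S y)) : star T = S :=
  ext fun y => ext_inner (A := A) fun x => by rw [← inner_left, h]

instance instStarRing : StarRing (Adjointable A E) where
  star_involutive T := star_eq_of fun x y => by
    rw [← CStarModule.star_inner, ← inner_left, CStarModule.star_inner]
  star_mul S T := star_eq_of fun x y => by
    simp [inner_left]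
  star_add S T := star_eq_of fun x y => by
    simp [inner_left]

instance instStarModule : StarModule ℂ (Adjointable A E) where
  star_smul c T := star_eq_of fun x y => by
    simp [inner_left]

instance instCStarRing : CStarRing (Adjointable A E) where
  norm_mul_self_le T := by
    have key : ∀ x, ‖T x‖ ≤ √‖star T * T‖ * ‖x‖ := fun x => by
      have h1 : ‖T x‖ ^ 2 ≤ ‖star T * T‖ * ‖x‖ ^ 2 := by
        calc ‖T x‖ ^ 2 = ‖inner Aᵐᵒᵖ (T x) (T x)‖ := CStarModule.norm_sq_eq Aᵐᵒᵖ
          _ = ‖inner Aᵐᵒᵖ x ((star T * T) x)‖ := by rw [inner_left]; simp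
          _ ≤ ‖x‖ * ‖(star T * T) x‖ := CStarModule.norm_inner_le E
          _ ≤ ‖x‖ * (‖star T * T‖ * ‖x‖) := by
            gcongr; exact (toCLM (star T * T)).le_opNorm x
          _ = _ := by ring
      calc ‖T x‖ = √(‖T x‖ ^ 2) := (Real.sqrt_sq (norm_nonneg _)).symm
        _ ≤ √(‖star T * T‖ * ‖x‖ ^ 2) := Real.sqrt_le_sqrt h1
        _ = _ := by rw [Real.sqrt_mul' _ (sq_nonneg _), Real.sqrt_sq (norm_nonneg _)]
    have h2 : ‖T‖ ≤ √‖star T * T‖ := (toCLM T).opNorm_le_bound (Real.sqrt_nonneg _) key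
    calc ‖T‖ * ‖T‖ ≤ √‖star T * T‖ * √‖star T * T‖ := by gcongr
      _ = _ := Real.mul_self_sqrt (norm_nonneg _)

instance instCompleteSpace [CompleteSpace E] : CompleteSpace (Adjointable A E) := by
  have hc : IsClosed (adjointableSubalgebra A E : Set (E →L[ℂ] E)) := by
    refine isClosed_of_closure_subset fun T hT => ?_
    obtain ⟨t, ht, htT⟩ := mem_closure_iff_seq_limit.1 hT
    let u : ℕ → Adjointable A E := fun n => ⟨t n, ht n⟩
    have hs : CauchySeq fun n => toCLM (star (u n)) := by
      rw [Metric.cauchySeq_iff']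
      intro ε hε
      obtain ⟨N, hN⟩ := Metric.cauchySeq_iff'.1 htT.cauchySeq ε hε
      refine ⟨N, fun n hn => ?_⟩
      have h1 : ‖star (u n - u N)‖ = ‖u n - u N‖ := norm_star _
      have h2 : ‖u n - u N‖ = dist (t n) (t N) := (dist_eq_norm _ _).symm
      rw [dist_eq_norm, ← map_sub, ← star_sub, norm_toCLM, h1, h2]
      exact hN n hn
    obtain ⟨S, hS⟩ := cauchySeq_tendsto_of_complete hs
    refine ⟨S, fun x y => ?_⟩
    have e1 : Filter.Tendsto (fun n => t n x) Filter.atTop (nhds (T x)) :=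
      ((ContinuousLinearMap.apply ℂ E x).continuous.tendsto T).comp htT
    have e2 : Filter.Tendsto (fun n => star (u n) y) Filter.atTop (nhds (S y)) :=
      ((ContinuousLinearMap.apply ℂ E y).continuous.tendsto S).comp hS
    have c1 := (CStarModule.continuous_inner (A := Aᵐᵒᵖ) (E := E)).tendsto (T x, y) |>.comp
      (e1.prodMk_nhds (tendsto_const_nhds (x := y)))
    have c2 := (CStarModule.continuous_inner (A := Aᵐᵒᵖ) (E := E)).tendsto (x, S y) |>.comp
      ((tendsto_const_nhds (x := x)).prodMk_nhds e2)
    exact tendsto_nhds_unique c1 (c2.congr fun n => (inner_left (u n) x y).symm)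
  exact hc.completeSpace_coe

instance instCStarAlgebra [CompleteSpace E] : CStarAlgebra (Adjointable A E) where

end Adjointable

theorem op_smul_norm_le (a : Aᵐᵒᵖ) (x : E) : ‖a • x‖ ≤ ‖a‖ * ‖x‖ := by
  refine le_of_sq_le_sq ?_ (by positivity)
  rw [CStarModule.norm_sq_eq Aᵐᵒᵖ, CStarModule.inner_op_smul_left,
    CStarModule.inner_op_smul_right, mul_pow, CStarModule.norm_sq_eq Aᵐᵒᵖ (x := x)]
  calc ‖a * inner Aᵐᵒᵖ x x * star a‖ ≤ ‖a‖ * ‖inner Aᵐᵒᵖ x x‖ * ‖star a‖ :=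
        (norm_mul_le _ _).trans (by gcongr; exact norm_mul_le _ _)
    _ = _ := by rw [norm_star]; ring

variable (A) in
/-- The bounded operator `x ↦ e ⟨f|x⟩`. -/
def rankOneCLM (e f : E) : E →L[ℂ] E :=
  LinearMap.mkContinuous
    { toFun := fun x => op (braket A f x) • e
      map_add' := fun x y => ext_inner (A := A) fun z => by simp [braket, add_mul]
      map_smul' := fun c x => ext_inner (A := A) fun z => by simp [braket] }
    (‖f‖ * ‖e‖) fun x => (op_smul_norm_le (op (braket A f x)) e).trans (by
      calc ‖inner Aᵐᵒᵖ f x‖ * ‖e‖ ≤ ‖f‖ * ‖x‖ * ‖e‖ := by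
            gcongr; exact CStarModule.norm_inner_le E
        _ = _ := by ring)

variable (A) in
/-- The rank-one operator `|e⟩⟨f| : x ↦ e ⟨f|x⟩`, whose adjoint is `|f⟩⟨e|`. -/
def rankOne (e f : E) : Adjointable A E :=
  Adjointable.mk (rankOneCLM A e f) (rankOneCLM A f e) fun x y => by simp [rankOneCLM, braket]

theorem star_rankOne (e f : E) : star (rankOne A e f) = rankOne A f e :=
  Adjointable.star_eq_of fun x y => by simp [rankOne, rankOneCLM, Adjointable.mk_apply, braket]

variable (A E) in
/-- The ideal `K(E)` of compact operators: the closed linear span of the rank-one operators. -/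
def compactOperators : Submodule ℂ (Adjointable A E) :=
  (Submodule.span ℂ {T | ∃ e f : E, T = rankOne A e f}).topologicalClosure

end Hilbert

/-! ### The Fock space -/

section Fock

variable {A E : Type*} [CStarAlgebra A] [PartialOrder A] [StarOrderedRing A]
  [NormedAddCommGroup E] [NormedSpace ℂ E] [SMul Aᵐᵒᵖ E] [CStarModule Aᵐᵒᵖ E]

theorem braket_add_right (x y z : E) : braket A x (y + z) = braket A x y + braket A x z := by
  simp [braket]

theorem braket_add_left (x y z : E) : braket A (x + y) z = braket A x z + braket A y z := by
  simp [braket]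

theorem braket_smul_right (c : ℂ) (x y : E) : braket A x (c • y) = c • braket A x y := by
  simp [braket]

theorem braket_zero_right (x : E) : braket A x (0 : E) = 0 := by simp [braket]

theorem braket_zero_left (x : E) : braket A (0 : E) x = 0 := by simp [braket]

theorem braket_op_smul_right (x y : E) (a : A) : braket A x (op a • y) = braket A x y * a := by
  simp [braket]

theorem star_braket (x y : E) : star (braket A x y) = braket A y x := by
  rw [braket, ← unop_star, CStarModule.star_inner, braket]

theorem braket_apply_left (T : Adjointable A E) (x y : E) :
    braket A (T x) y = braket A x (star T y) := by
  simp [braket, Adjointable.inner_left]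

theorem braket_self_nonneg (x : E) : 0 ≤ braket A x x :=
  CStarModule.inner_self_nonneg (A := Aᵐᵒᵖ) (x := x)

theorem exists_negPart_factor {M : Type*} [CStarAlgebra M] [PartialOrder M] [StarOrderedRing M]
    (G : M) (hG : IsSelfAdjoint G) : ∃ T S : M, T = star S * S ∧
      star T * G * T = -(star (S * T) * (S * T)) ∧ (T = 0 → ∃ C : M, G = star C * C) := by
  have hT : 0 ≤ G⁻ := CFC.negPart_nonneg G
  have hTs : star G⁻ = G⁻ := hT.isSelfAdjoint
  obtain ⟨S, hS⟩ := CStarAlgebra.nonneg_iff_eq_star_mul_self.1 hT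
  refine ⟨G⁻, S, hS, ?_, fun h0 => ?_⟩
  · have h2 : G * G⁻ = - (G⁻ * G⁻) := by
      nth_rw 1 [← CFC.posPart_sub_negPart G hG]
      rw [sub_mul, CFC.posPart_mul_negPart, zero_sub]
    rw [mul_assoc, h2, star_mul, hTs, mul_assoc, ← mul_assoc (star S), ← hS, mul_neg]
  · apply CStarAlgebra.nonneg_iff_eq_star_mul_self.1
    rw [← CFC.posPart_sub_negPart G hG, h0, sub_zero]
    exact CFC.posPart_nonneg G

/-- The Gram matrix of finitely many vectors is positive, so it has the form `C⋆ C`. -/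
theorem exists_gram {ι : Type*} [Fintype ι] (e : ι → E) :
    ∃ C : ι → ι → A, ∀ i j, braket A (e i) (e j) = ∑ l, star (C l i) * C l j := by
  classical
  let G : CStarMatrix ι ι A := fun i j => braket A (e i) (e j)
  have hG : IsSelfAdjoint G := by
    ext i j
    rw [CStarMatrix.star_apply]
    exact star_braket _ _
  have hsum : ∀ T : ι → A, 0 ≤ ∑ i, ∑ j, star (T i) * braket A (e i) (e j) * T j := by
    intro T
    have h : ∑ i, ∑ j, star (T i) * braket A (e i) (e j) * T j =
        braket A (∑ i, op (T i) • e i) (∑ j, op (T j) • e j) := by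
      rw [Finset.sum_comm]
      simp [braket, Finset.unop_sum, Finset.sum_mul]
    rw [h]
    exact braket_self_nonneg _
  obtain ⟨T, S, hS, h1, hC⟩ := exists_negPart_factor G hG
  have h3 : S * T = 0 := by
    ext i j
    have h4 : (star T * G * T) j j = ∑ i, ∑ l, star (T i j) * braket A (e i) (e l) * T l j := by
      simp only [CStarMatrix.mul_apply, CStarMatrix.star_apply, Finset.sum_mul]
      exact Finset.sum_comm
    have h5 : (star (S * T) * (S * T)) j j = ∑ i, star ((S * T) i j) * (S * T) i j := by
      simp only [CStarMatrix.mul_apply (M := star (S * T)), CStarMatrix.star_apply]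
    have h6 : ∑ i, star ((S * T) i j) * (S * T) i j = 0 := by
      refine le_antisymm ?_ (Finset.sum_nonneg fun i _ => star_mul_self_nonneg _)
      have h7 := hsum fun i => T i j
      rw [← h4, h1] at h7
      rw [← h5]
      exact neg_nonneg.1 h7
    have h8 := (Finset.sum_eq_zero_iff_of_nonneg fun i _ => star_mul_self_nonneg _).1 h6 i
      (Finset.mem_univ i)
    exact CStarRing.star_mul_self_eq_zero_iff _ |>.1 h8
  have h7 : T = 0 := by
    have hTs : star T = T := by rw [hS]; simp
    have h9 : star T * T = 0 := by
      rw [hTs]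
      nth_rw 1 [hS]
      rw [mul_assoc, h3, mul_zero]
    exact CStarRing.star_mul_self_eq_zero_iff _ |>.1 h9
  obtain ⟨C, hC⟩ := hC h7
  refine ⟨fun l i => C l i, fun i j => ?_⟩
  have := congrArg (fun M : CStarMatrix ι ι A => M i j) hC
  simpa only [CStarMatrix.mul_apply, CStarMatrix.star_apply] using this

/-- An elementary tensor `e₁ ⊗ ⋯ ⊗ eₙ ⊗ a` in `E ⊗ ⋯ ⊗ E ⊗ A = E^{⊗ n}`, recorded by its entries. For
`n = 0` this is the element `a` of `A`. -/
abbrev Word (A E : Type*) : Type _ := List E × A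

variable (φ : A →⋆ₐ[ℂ] Adjointable A E)

/-- The left action of `A` on elementary tensors: `φ` on the first leg, and left multiplication
on `A` for tensors of length `0`. -/
def Word.act (c : A) : Word A E → Word A E
  | ([], a) => ([], c * a)
  | (e :: u, a) => (φ c e :: u, a)

/-- The `A`-valued inner product of elementary tensors:
`⟨a|b⟩ = a⋆ b` on `A`, `⟨e ⊗ x|f ⊗ y⟩ = ⟨x|φ(⟨e|f⟩) y⟩`, and `0` for different lengths. -/
def Word.kernel : List E → A → Word A E → A
  | [], a, ([], b) => star a * b
  | [], _, (_ :: _, _) => 0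
  | _ :: _, _, ([], _) => 0
  | e :: u, a, (f :: v, b) => Word.kernel u a (Word.act φ (braket A e f) (v, b))

@[simp] theorem act_nil (c a : A) : Word.act φ c ([], a) = ([], c * a) := rfl

@[simp] theorem act_cons (c a : A) (e : E) (u : List E) :
    Word.act φ c (e :: u, a) = (φ c e :: u, a) := rfl

@[simp] theorem kernel_nil_nil (a b : A) : Word.kernel φ [] a ([], b) = star a * b := rfl

@[simp] theorem kernel_nil_cons (a b : A) (e : E) (u : List E) :
    Word.kernel φ [] a (e :: u, b) = 0 := rfl

@[simp] theorem kernel_cons_nil (a b : A) (e : E) (u : List E) :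
    Word.kernel φ (e :: u) a ([], b) = 0 := rfl

@[simp] theorem kernel_cons_cons (a b : A) (e f : E) (u v : List E) :
    Word.kernel φ (e :: u) a (f :: v, b) =
      Word.kernel φ u a (Word.act φ (braket A e f) (v, b)) := rfl

theorem kernel_act_add (u : List E) (a : A) (c d : A) (q : Word A E) :
    Word.kernel φ u a (Word.act φ (c + d) q) =
      Word.kernel φ u a (Word.act φ c q) + Word.kernel φ u a (Word.act φ d q) := by
  induction u generalizing c d q with
  | nil => rcases q with ⟨_ | ⟨f, v⟩, b⟩ <;> simp [add_mul, mul_add]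
  | cons e u ih =>
    rcases q with ⟨_ | ⟨f, v⟩, b⟩
    · simp 
    · simp [braket_add_right, ih]

theorem kernel_act_smul (u : List E) (a : A) (z : ℂ) (c : A) (q : Word A E) :
    Word.kernel φ u a (Word.act φ (z • c) q) = z • Word.kernel φ u a (Word.act φ c q) := by
  induction u generalizing c q with
  | nil => rcases q with ⟨_ | ⟨f, v⟩, b⟩ <;> simp 
  | cons e u ih =>
    rcases q with ⟨_ | ⟨f, v⟩, b⟩
    · simp 
    · simp [braket_smul_right, ih]

theorem kernel_act_zero (u : List E) (a : A) (q : Word A E) :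
    Word.kernel φ u a (Word.act φ 0 q) = 0 := by
  simpa using kernel_act_smul φ u a 0 0 q

theorem kernel_act_sum {ι : Type*} (s : Finset ι) (c : ι → A) (u : List E) (a : A) (q : Word A E) :
    Word.kernel φ u a (Word.act φ (∑ i ∈ s, c i) q) =
      ∑ i ∈ s, Word.kernel φ u a (Word.act φ (c i) q) := by
  classical
  induction s using Finset.induction_on with
  | empty => simp [kernel_act_zero]
  | insert i s hi ih => simp [Finset.sum_insert hi, kernel_act_add, ih]

theorem act_mul (c d : A) (q : Word A E) :
    Word.act φ (c * d) q = Word.act φ c (Word.act φ d q) := by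
  rcases q with ⟨_ | ⟨f, v⟩, b⟩ <;> simp [mul_assoc]

theorem kernel_act_left (c : A) (p q : Word A E) :
    Word.kernel φ (Word.act φ c p).1 (Word.act φ c p).2 q =
      Word.kernel φ p.1 p.2 (Word.act φ (star c) q) := by
  rcases p with ⟨_ | ⟨e, u⟩, a⟩ <;> rcases q with ⟨_ | ⟨f, v⟩, b⟩ <;>
    simp [mul_assoc, braket_apply_left, map_star]

theorem star_kernel (p q : Word A E) :
    star (Word.kernel φ p.1 p.2 q) = Word.kernel φ q.1 q.2 p := by
  obtain ⟨u, a⟩ := p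
  induction u generalizing q with
  | nil => rcases q with ⟨_ | ⟨f, v⟩, b⟩ <;> simp
  | cons e u ih =>
    rcases q with ⟨_ | ⟨f, v⟩, b⟩
    · simp
    · simp only [kernel_cons_cons]
      rw [ih, kernel_act_left, star_braket]

theorem kernel_mul_right (u : List E) (a : A) (q : Word A E) (b : A) :
    Word.kernel φ u a (q.1, q.2 * b) = Word.kernel φ u a q * b := by
  induction u generalizing q with
  | nil => rcases q with ⟨_ | ⟨f, v⟩, c⟩ <;> simp [mul_assoc]
  | cons e u ih =>
    rcases q with ⟨_ | ⟨f, v⟩, c⟩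
    · simp
    · simp only [kernel_cons_cons, ← ih]
      rcases v with _ | ⟨g, v⟩ <;> simp [mul_assoc]

theorem kernel_mul_left (p q : Word A E) (b : A) :
    Word.kernel φ p.1 (p.2 * b) q = star b * Word.kernel φ p.1 p.2 q := by
  have h := star_kernel φ (p.1, p.2 * b) q
  rw [kernel_mul_right, ← star_inj, star_star] at h
  rw [h, star_mul, star_kernel]

theorem kernel_sum_nonneg {ι : Type*} [Fintype ι] (p : ι → Word A E) :
    0 ≤ ∑ i, ∑ j, Word.kernel φ (p i).1 (p i).2 (p j) := by
  obtain ⟨N, hN⟩ : ∃ N : ℕ, ∀ i, (p i).1.length ≤ N :=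
    ⟨∑ i, (p i).1.length, fun i =>
      Finset.single_le_sum (f := fun i => (p i).1.length) (fun _ _ => Nat.zero_le _)
        (Finset.mem_univ i)⟩
  induction N generalizing p with
  | zero =>
    have : ∑ i, ∑ j, Word.kernel φ (p i).1 (p i).2 (p j) =
        star (∑ i, (p i).2) * ∑ j, (p j).2 := by
      rw [star_sum, Finset.sum_mul_sum]
      refine Finset.sum_congr rfl fun i _ => Finset.sum_congr rfl fun j _ => ?_
      have hi := hN i
      have hj := hN j
      rcases hpi : p i with ⟨_ | ⟨e, u⟩, a⟩ <;> rcases hpj : p j with ⟨_ | ⟨f, v⟩, b⟩ <;>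
        simp_all
    rw [this]
    exact star_mul_self_nonneg _
  | succ N ih =>
    let h : Word A E → E := fun q => q.1.headD 0
    let v : Word A E → A := fun q => match q with
      | ([], a) => a
      | (_ :: _, _) => 0
    let t : Word A E → Word A E := fun q => (q.1.tail, q.2)
    have key : ∀ x y : Word A E, Word.kernel φ x.1 x.2 y =
        star (v x) * v y +
          Word.kernel φ (t x).1 (t x).2 (Word.act φ (braket A (h x) (h y)) (t y)) := by
      rintro ⟨_ | ⟨e, u⟩, a⟩ ⟨_ | ⟨f, w⟩, b⟩ <;>
        simp [-act_nil, -act_cons, h, v, t, braket_zero_left, braket_zero_right, kernel_act_zero]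
    obtain ⟨C, hC⟩ := exists_gram (A := A) fun i => h (p i)
    have e1 : ∑ i, ∑ j, Word.kernel φ (p i).1 (p i).2 (p j) =
        star (∑ i, v (p i)) * ∑ j, v (p j) +
        ∑ l, ∑ i, ∑ j, Word.kernel φ (Word.act φ (C l i) (t (p i))).1
          (Word.act φ (C l i) (t (p i))).2 (Word.act φ (C l j) (t (p j))) := by
      have e2 : ∀ i j, Word.kernel φ (p i).1 (p i).2 (p j) = star (v (p i)) * v (p j) +
          ∑ l, Word.kernel φ (Word.act φ (C l i) (t (p i))).1
            (Word.act φ (C l i) (t (p i))).2 (Word.act φ (C l j) (t (p j))) := fun i j => by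
        rw [key, hC, kernel_act_sum]
        simp only [act_mul, kernel_act_left]
      simp only [e2, Finset.sum_add_distrib]
      rw [star_sum, Finset.sum_mul_sum]
      congr 1
      exact (Finset.sum_congr rfl fun i _ => Finset.sum_comm).trans Finset.sum_comm
    rw [e1]
    refine add_nonneg (star_mul_self_nonneg _) (Finset.sum_nonneg fun l _ => ?_)
    refine ih (fun i => Word.act φ (C l i) (t (p i))) fun i => ?_
    have hi := hN i
    rcases hpi : p i with ⟨_ | ⟨e, u⟩, a⟩
    · simp [t]
    · have : u.length ≤ N := by simpa [hpi] using hi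
      rcases u with _ | ⟨g, u⟩
      · simp [t]
      · simpa [t] using this

/-- The `A`-valued semi-inner product of formal linear combinations of elementary tensors. -/
def wordForm (x y : Word A E →₀ ℂ) : A :=
  x.sum fun p c => y.sum fun q d => (star c * d) • Word.kernel φ p.1 p.2 q

theorem wordForm_add_right (x y z : Word A E →₀ ℂ) :
    wordForm φ x (y + z) = wordForm φ x y + wordForm φ x z := by
  simp only [wordForm, Finsupp.sum, ← Finset.sum_add_distrib]
  refine Finset.sum_congr rfl fun p _ => ?_
  exact Finsupp.sum_add_index' (f := y) (g := z)
    (h := fun q d => (star (x p) * d) • Word.kernel φ p.1 p.2 q)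
    (by simp) (by simp [mul_add, add_smul])

theorem wordForm_smul_right (x y : Word A E →₀ ℂ) (c : ℂ) :
    wordForm φ x (c • y) = c • wordForm φ x y := by
  simp only [wordForm, Finsupp.sum, Finset.smul_sum]
  refine Finset.sum_congr rfl fun p _ => ?_
  refine (Finsupp.sum_smul_index' (g := y) (b := c)
    (h := fun q d => (star (x p) * d) • Word.kernel φ p.1 p.2 q) (by simp)).trans ?_
  exact Finset.sum_congr rfl fun q _ => by
    beta_reduce
    rw [smul_smul, smul_eq_mul, mul_left_comm]

theorem star_wordForm (x y : Word A E →₀ ℂ) : star (wordForm φ x y) = wordForm φ y x := by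
  simp only [wordForm, Finsupp.sum, star_sum]
  rw [Finset.sum_comm]
  refine Finset.sum_congr rfl fun q _ => Finset.sum_congr rfl fun p _ => ?_
  rw [star_smul, star_kernel, star_mul, star_star]

theorem wordForm_single (p q : Word A E) :
    wordForm φ (Finsupp.single p 1) (Finsupp.single q 1) = Word.kernel φ p.1 p.2 q := by
  simp [wordForm]

theorem wordForm_nonneg (x : Word A E →₀ ℂ) : 0 ≤ wordForm φ x x := by
  have h := kernel_sum_nonneg φ fun p : x.support => (p.1.1, p.1.2 * (x p.1 • (1 : A)))
  have e : wordForm φ x x = ∑ p : x.support, ∑ q : x.support,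
      Word.kernel φ p.1.1 (p.1.2 * (x p.1 • (1 : A))) (q.1.1, q.1.2 * (x q.1 • (1 : A))) := by
    simp only [wordForm, Finsupp.sum]
    rw [← Finset.sum_coe_sort]
    refine Finset.sum_congr rfl fun p _ => ?_
    rw [← Finset.sum_coe_sort]
    refine Finset.sum_congr rfl fun q _ => ?_
    rw [kernel_mul_right, kernel_mul_left]
    simp [smul_smul, mul_comm]
  rw [e]
  exact h

/-- The span of the elementary tensors of all lengths, before dividing out null vectors and
completing. The linearity relations between elementary tensors hold modulo null vectors. -/
def PreFock (_ : A →⋆ₐ[ℂ] Adjointable A E) : Type _ := Word A E →₀ ℂ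

namespace PreFock

instance instAddCommGroup : AddCommGroup (PreFock φ) :=
  inferInstanceAs (AddCommGroup (Word A E →₀ ℂ))

instance instModule : Module ℂ (PreFock φ) := inferInstanceAs (Module ℂ (Word A E →₀ ℂ))

variable {φ}

/-- An elementary tensor as an element of the pre-Fock space. -/
def tensor (p : Word A E) : PreFock φ := Finsupp.single p (1 : ℂ)

/-- The linear extension of a map given on elementary tensors. -/
def lift {M : Type*} [AddCommMonoid M] [Module ℂ M] (g : Word A E → M) : PreFock φ →ₗ[ℂ] M :=
  Finsupp.linearCombination ℂ g

@[simp] theorem lift_tensor {M : Type*} [AddCommMonoid M] [Module ℂ M] (g : Word A E → M)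
    (p : Word A E) : lift (φ := φ) g (tensor p) = g p :=
  (Finsupp.linearCombination_single ℂ 1 p).trans (one_smul ℂ _)

theorem induction {P : PreFock φ → Prop} (x : PreFock φ) (h1 : ∀ p, P (tensor p))
    (h2 : ∀ x y, P x → P y → P (x + y)) (h3 : ∀ (c : ℂ) x, P x → P (c • x)) : P x := by
  refine Finsupp.induction_linear (motive := P) x ?_ h2 fun p c => ?_
  · have := h3 0 _ (h1 ([], 0))
    rw [zero_smul] at this
    exact this
  · have : (Finsupp.single p c : Word A E →₀ ℂ) = c • Finsupp.single p 1 := by simp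
    rw [this]
    exact h3 c _ (h1 p)

/-- The `A`-valued semi-inner product on the pre-Fock space. -/
def form (x y : PreFock φ) : A := wordForm φ x y

theorem form_add_right (x y z : PreFock φ) : form x (y + z) = form x y + form x z :=
  wordForm_add_right φ x y z

theorem form_smul_right (x y : PreFock φ) (c : ℂ) : form x (c • y) = c • form x y :=
  wordForm_smul_right φ x y c

theorem star_form (x y : PreFock φ) : star (form x y) = form y x := star_wordForm φ x y

theorem form_add_left (x y z : PreFock φ) : form (x + y) z = form x z + form y z := by
  rw [← star_form, form_add_right, star_add, star_form, star_form]

theorem form_smul_left (x y : PreFock φ) (c : ℂ) : form (c • x) y = star c • form x y := by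
  rw [← star_form, form_smul_right, star_smul, star_form]

theorem form_tensor (p q : Word A E) :
    form (φ := φ) (tensor p) (tensor q) = Word.kernel φ p.1 p.2 q := wordForm_single φ p q

theorem form_nonneg (x : PreFock φ) : 0 ≤ form x x := wordForm_nonneg φ x

theorem form_sub_self (x y : PreFock φ) :
    form (x - y) (x - y) = form x x - form x y - form y x + form y y := by
  have : x - y = x + (-1 : ℂ) • y := by rw [neg_one_smul, sub_eq_add_neg]
  rw [this, form_add_left, form_add_right, form_add_right, form_smul_left, form_smul_left,
    form_smul_right, form_smul_right]
  simp
  abel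

/-- Two linear operators that are formally adjoint on elementary tensors are formally adjoint. -/
theorem form_adjoint {S T : PreFock φ →ₗ[ℂ] PreFock φ}
    (h : ∀ p q, form (T (tensor p)) (tensor q) = form (tensor p) (S (tensor q)))
    (x y : PreFock φ) : form (T x) y = form x (S y) := by
  refine induction (P := fun x => form (T x) y = form x (S y)) x (fun p =>
    induction (P := fun y => form (T (tensor p)) y = form (tensor p) (S y)) y (h p) ?_ ?_) ?_ ?_
  · intro y z hy hz; rw [map_add, form_add_right, form_add_right, hy, hz]
  · intro c y hy; rw [map_smul, form_smul_right, form_smul_right, hy]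
  · intro x z hx hz; rw [map_add, form_add_left, form_add_left, hx, hz]
  · intro c x hx; rw [map_smul, form_smul_left, form_smul_left, hx]

/-- The right action of `A`, on the last leg `A` of elementary tensors. -/
def right (a : A) : PreFock φ →ₗ[ℂ] PreFock φ := lift fun p => tensor (p.1, p.2 * a)

theorem form_right (x y : PreFock φ) (a : A) : form x (right a y) = form x y * a := by
  refine induction (P := fun x => form x (right a y) = form x y * a) x (fun p =>
    induction (P := fun y => form (tensor p) (right a y) = form (tensor p) y * a) y
      (fun q => ?_) ?_ ?_) ?_ ?_
  · rw [right, lift_tensor, form_tensor, form_tensor, kernel_mul_right]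
  · intro y z hy hz; rw [map_add, form_add_right, form_add_right, hy, hz, add_mul]
  · intro c y hy; rw [map_smul, form_smul_right, form_smul_right, hy, smul_mul_assoc]
  · intro x z hx hz; rw [form_add_left, form_add_left, hx, hz, add_mul]
  · intro c x hx; rw [form_smul_left, form_smul_left, hx, smul_mul_assoc]

theorem form_right_left (x y : PreFock φ) (a : A) : form (right a x) y = star a * form x y := by
  rw [← star_form, form_right, star_mul, star_form]

/-- The Cauchy–Schwarz inequality. -/
theorem norm_form_sq_le (x y : PreFock φ) : ‖form x y‖ ^ 2 ≤ ‖form x x‖ * ‖form y y‖ := by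
  set b := form x y with hb
  have key : ∀ t : ℝ, ‖form x x‖ < t → ‖b‖ ^ 2 ≤ t * ‖form y y‖ := by
    intro t ht
    have ht0 : 0 < t := (norm_nonneg _).trans_lt ht
    have h1 : 0 ≤ form (right b x - (t : ℂ) • y) (right b x - (t : ℂ) • y) := form_nonneg _
    rw [form_sub_self, form_right, form_right_left, form_smul_right, form_smul_right,
      form_smul_left, form_smul_left, form_right, form_right_left, ← hb,
      ← star_form x y, ← hb] at h1
    have h2 : star b * form x x * b ≤ t • (star b * b) :=
      (CStarAlgebra.star_left_conjugate_le_norm_smul (a := b) (b := form x x)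
        (IsSelfAdjoint.of_nonneg (form_nonneg x))).trans
        (smul_le_smul_of_nonneg_right ht.le (star_mul_self_nonneg b))
    have h3 : t • (star b * b) ≤ (t * t) • form y y := by
      have h5 := h1.trans (add_le_add_left (sub_le_sub_right (sub_le_sub_right h2 _) _) _)
      simp only [Complex.star_def, Complex.conj_ofReal, Complex.coe_smul, sub_self, zero_sub,
        smul_smul] at h5
      rwa [neg_add_eq_sub, sub_nonneg] at h5
    have h4 : ‖t • (star b * b)‖ ≤ ‖(t * t) • form y y‖ :=
      CStarAlgebra.norm_le_norm_of_nonneg_of_le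
        (smul_nonneg ht0.le (star_mul_self_nonneg b)) h3
    rw [norm_smul, norm_smul, CStarRing.norm_star_mul_self, Real.norm_of_nonneg ht0.le,
      Real.norm_of_nonneg (by positivity), mul_assoc] at h4
    rw [sq]
    exact le_of_mul_le_mul_left h4 ht0
  have hlim : Filter.Tendsto (fun t : ℝ => t * ‖form y y‖) (nhdsWithin ‖form x x‖ (Set.Ioi ‖form x x‖))
      (nhds (‖form x x‖ * ‖form y y‖)) :=
    ((continuous_id.mul continuous_const).tendsto _).mono_left nhdsWithin_le_nhds
  exact ge_of_tendsto hlim (Filter.eventually_of_mem self_mem_nhdsWithin key)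

instance instNorm : Norm (PreFock φ) := ⟨fun x => √‖form x x‖⟩

theorem norm_sq_eq (x : PreFock φ) : ‖x‖ ^ 2 = ‖form x x‖ := Real.sq_sqrt (norm_nonneg _)

theorem norm_form_le (x y : PreFock φ) : ‖form x y‖ ≤ ‖x‖ * ‖y‖ := by
  refine le_of_sq_le_sq ?_ (mul_nonneg (Real.sqrt_nonneg _) (Real.sqrt_nonneg _))
  rw [mul_pow, norm_sq_eq, norm_sq_eq]
  exact norm_form_sq_le x y

instance instSeminormedAddCommGroup : SeminormedAddCommGroup (PreFock φ) :=
  SeminormedAddCommGroup.ofCore (𝕜 := ℂ)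
    { norm_nonneg := fun x => Real.sqrt_nonneg _
      norm_smul := fun c x => by
        change √‖form (c • x) (c • x)‖ = ‖c‖ * √‖form x x‖
        rw [form_smul_left, form_smul_right, smul_smul, norm_smul, Real.sqrt_mul (norm_nonneg _)]
        simp
      norm_triangle := fun x y => by
        refine le_of_sq_le_sq ?_ (add_nonneg (Real.sqrt_nonneg _) (Real.sqrt_nonneg _))
        have hx := norm_sq_eq x
        have hy := norm_sq_eq y
        have hxy := norm_form_le x y
        have hyx := norm_form_le y x
        rw [norm_sq_eq, form_add_left, form_add_right, form_add_right]
        have h1 := norm_add_le (form x x + form x y) (form y x + form y y)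
        have h2 := norm_add_le (form x x) (form x y)
        have h3 := norm_add_le (form y x) (form y y)
        nlinarith }

instance instNormedSpace : NormedSpace ℂ (PreFock φ) where
  norm_smul_le c x := by
    change √‖form (c • x) (c • x)‖ ≤ ‖c‖ * √‖form x x‖
    rw [form_smul_left, form_smul_right, smul_smul, norm_smul, Real.sqrt_mul (norm_nonneg _)]
    simp

instance instInner : Inner Aᵐᵒᵖ (PreFock φ) := ⟨fun x y => op (form x y)⟩

theorem inner_eq (x y : PreFock φ) : inner Aᵐᵒᵖ x y = op (form x y) := rfl

/-- The semi-inner product as a biadditive map. -/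
def innerHom : PreFock φ →+ PreFock φ →+ Aᵐᵒᵖ :=
  AddMonoidHom.mk' (fun x => AddMonoidHom.mk' (fun y => inner Aᵐᵒᵖ x y)
    fun y z => by simp [inner_eq, form_add_right])
    fun x y => by ext z; simp [inner_eq, form_add_left]

theorem continuous_inner :
    Continuous fun p : PreFock φ × PreFock φ => inner Aᵐᵒᵖ p.1 p.2 := by
  let L : PreFock φ →L⋆[ℂ] PreFock φ →L[ℂ] A :=
    LinearMap.mkContinuous₂ (LinearMap.mk₂'ₛₗ (starRingEnd ℂ) (RingHom.id ℂ) form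
      form_add_left (fun c x y => form_smul_left x y c) form_add_right
      (fun c x y => form_smul_right x y c)) 1
      fun x y => by simpa using norm_form_le x y
  have h : Continuous fun p : PreFock φ × PreFock φ => L p.1 p.2 := by fun_prop
  exact continuous_op.comp h

/-- A bounded operator on the pre-Fock space. -/
def bounded (T : PreFock φ →ₗ[ℂ] PreFock φ) (h : ∃ C : ℝ, ∀ x, ‖T x‖ ≤ C * ‖x‖) :
    PreFock φ →L[ℂ] PreFock φ := T.mkContinuousOfExistsBound h

theorem bounded_of_form_le {T : PreFock φ →ₗ[ℂ] PreFock φ} {C : ℝ} (hC : 0 ≤ C)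
    (h : ∀ x, form (T x) (T x) ≤ C • form x x) : ∃ C : ℝ, ∀ x, ‖T x‖ ≤ C * ‖x‖ := by
  refine ⟨√C, fun x => ?_⟩
  have h1 := CStarAlgebra.norm_le_norm_of_nonneg_of_le (form_nonneg (T x)) (h x)
  rw [norm_smul, Real.norm_of_nonneg hC] at h1
  change √‖form (T x) (T x)‖ ≤ √C * √‖form x x‖
  rw [← Real.sqrt_mul hC]
  exact Real.sqrt_le_sqrt h1

theorem bounded_adjoint {S T : PreFock φ →ₗ[ℂ] PreFock φ}
    (hST : ∀ x y, form (T x) y = form x (S y)) (h : ∃ C : ℝ, ∀ x, ‖T x‖ ≤ C * ‖x‖) :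
    ∃ C : ℝ, ∀ x, ‖S x‖ ≤ C * ‖x‖ := by
  obtain ⟨C, hC⟩ := h
  refine ⟨C, fun x => ?_⟩
  have h1 : ‖S x‖ * ‖S x‖ ≤ C * ‖x‖ * ‖S x‖ := by
    calc ‖S x‖ * ‖S x‖ = ‖form (T (S x)) x‖ := by rw [← sq, norm_sq_eq, hST]
      _ ≤ ‖T (S x)‖ * ‖x‖ := norm_form_le _ _
      _ ≤ (C * ‖S x‖) * ‖x‖ := by gcongr; exact hC _
      _ = _ := by ring
  rcases (norm_nonneg (S x)).eq_or_lt' with h0 | h0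
  · have h2 := hC x
    rw [h0]
    exact (norm_nonneg _).trans h2
  · exact le_of_mul_le_mul_right h1 h0

end PreFock

/-- The Fock space `A ⊕ E ⊕ E^{⊗2} ⊕ ⋯` of the correspondence, a right Hilbert `A`-module: the
(Hausdorff) completion of the span of all elementary tensors. -/
abbrev Fock : Type _ := UniformSpace.Completion (PreFock φ)

namespace Fock

open UniformSpace

variable {φ}

theorem inner_coe (x y : PreFock φ) :
    inner Aᵐᵒᵖ (x : Fock φ) (y : Fock φ) = op (PreFock.form x y) :=
  (Completion.isDenseInducing_coe.prodMap Completion.isDenseInducing_coe).extend_eq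
    PreFock.continuous_inner (x, y)

theorem continuous_inner : Continuous fun p : Fock φ × Fock φ => inner Aᵐᵒᵖ p.1 p.2 :=
  IsDenseInducing.extend_Z_bilin (φ := PreFock.innerHom (φ := φ))
    (Completion.isDenseInducing_toCompl (PreFock φ))
    (Completion.isDenseInducing_toCompl (PreFock φ)) PreFock.continuous_inner

theorem braket_coe (x y : PreFock φ) :
    braket A (x : Fock φ) (y : Fock φ) = PreFock.form x y := by
  rw [braket, inner_coe, unop_op]

theorem continuous_braket {α : Type*} [TopologicalSpace α] {f g : α → Fock φ}
    (hf : Continuous f) (hg : Continuous g) : Continuous fun x => braket A (f x) (g x) :=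
  continuous_unop.comp (continuous_inner.comp (hf.prodMk hg))

theorem right_bounded (a : A) : ∃ C : ℝ, ∀ x : PreFock φ, ‖PreFock.right a x‖ ≤ C * ‖x‖ := by
  refine ⟨‖a‖, fun x => le_of_sq_le_sq ?_ (by positivity)⟩
  rw [mul_pow, PreFock.norm_sq_eq, PreFock.norm_sq_eq, PreFock.form_right,
    PreFock.form_right_left]
  calc ‖star a * PreFock.form x x * a‖ ≤ ‖star a‖ * ‖PreFock.form x x‖ * ‖a‖ :=
        (norm_mul_le _ _).trans (by gcongr; exact norm_mul_le _ _)
    _ = _ := by rw [norm_star]; ring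

/-- The right action of `A` on the Fock space. -/
instance instSMulOp : SMul Aᵐᵒᵖ (Fock φ) where
  smul a x := (PreFock.bounded (PreFock.right (unop a)) (right_bounded (unop a))).completion x

theorem smul_coe (a : Aᵐᵒᵖ) (x : PreFock φ) :
    a • (x : Fock φ) = ((PreFock.right (unop a) x : PreFock φ) : Fock φ) :=
  ContinuousLinearMap.completion_apply_coe _ _

theorem continuous_op_smul (a : Aᵐᵒᵖ) : Continuous fun x : Fock φ => a • x :=
  (PreFock.bounded (PreFock.right (unop a)) (right_bounded (unop a))).completion.continuous

theorem inner_add_right (x y z : Fock φ) :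
    braket A x (y + z) = braket A x y + braket A x z := by
  refine Completion.induction_on₃ x y z (isClosed_eq
    (continuous_braket (by fun_prop) (by fun_prop))
    ((continuous_braket (by fun_prop) (by fun_prop)).add
      (continuous_braket (by fun_prop) (by fun_prop)))) fun x y z => ?_
  rw [← Completion.coe_add, braket_coe, braket_coe, braket_coe, PreFock.form_add_right]

theorem inner_self_nonneg (x : Fock φ) : 0 ≤ braket A x x := by
  refine Completion.induction_on x (CStarAlgebra.isClosed_nonneg.preimage
    (continuous_braket (φ := φ) continuous_id continuous_id)) fun x => ?_
  rw [braket_coe]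
  exact PreFock.form_nonneg x

theorem inner_op_smul_right (a : Aᵐᵒᵖ) (x y : Fock φ) :
    braket A x (a • y) = braket A x y * unop a := by
  refine Completion.induction_on₂ x y (isClosed_eq
    (continuous_braket (by fun_prop) ((continuous_op_smul a).comp continuous_snd))
    ((continuous_braket (by fun_prop) (by fun_prop)).mul continuous_const)) fun x y => ?_
  rw [smul_coe, braket_coe, braket_coe, PreFock.form_right]

theorem inner_smul_right_complex (c : ℂ) (x y : Fock φ) :
    braket A x (c • y) = c • braket A x y := by
  refine Completion.induction_on₂ x y (isClosed_eq
    (continuous_braket (by fun_prop) (continuous_snd.const_smul c))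
    ((continuous_braket (by fun_prop) (by fun_prop)).const_smul c)) fun x y => ?_
  rw [← Completion.coe_smul, braket_coe, braket_coe, PreFock.form_smul_right]

theorem star_inner (x y : Fock φ) : star (braket A x y) = braket A y x := by
  refine Completion.induction_on₂ x y (isClosed_eq
    (continuous_star.comp (continuous_braket (by fun_prop) (by fun_prop)))
    (continuous_braket (by fun_prop) (by fun_prop))) fun x y => ?_
  rw [braket_coe, braket_coe, PreFock.star_form]

theorem norm_eq (x : Fock φ) : ‖x‖ = √‖braket A x x‖ := by
  refine Completion.induction_on x (isClosed_eq continuous_norm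
    (continuous_norm.comp (continuous_braket (φ := φ) continuous_id continuous_id)).sqrt)
    fun x => ?_
  rw [braket_coe, Completion.norm_coe]
  rfl

instance instCStarModule : CStarModule Aᵐᵒᵖ (Fock φ) where
  inner_add_right {x y z} := unop_injective (inner_add_right x y z)
  inner_self_nonneg {x} := inner_self_nonneg x
  inner_self {x} := by
    rw [← norm_eq_zero (a := x), norm_eq, Real.sqrt_eq_zero (norm_nonneg _), norm_eq_zero]
    exact (unop_eq_zero_iff _).symm
  inner_op_smul_right {a x y} := unop_injective (inner_op_smul_right a x y)
  inner_smul_right_complex {c x y} := unop_injective (inner_smul_right_complex c x y)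
  star_inner x y := unop_injective (star_inner x y)
  norm_eq_sqrt_norm_inner_self x := norm_eq x

/-- The adjointable operator on the Fock space given by a bounded operator `T` on elementary
tensors with formal adjoint `S`. -/
def operator (T S : PreFock φ →ₗ[ℂ] PreFock φ)
    (hST : ∀ x y, PreFock.form (T x) y = PreFock.form x (S y))
    (hT : ∃ C : ℝ, ∀ x, ‖T x‖ ≤ C * ‖x‖) : Adjointable A (Fock φ) :=
  Adjointable.mk (PreFock.bounded T hT).completion
    (PreFock.bounded S (PreFock.bounded_adjoint hST hT)).completion fun x y => by
      refine Completion.induction_on₂ x y (isClosed_eq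
        (continuous_inner.comp ((ContinuousLinearMap.continuous _).prodMap continuous_id))
        (continuous_inner.comp (continuous_id.prodMap (ContinuousLinearMap.continuous _))))
        fun x y => ?_
      rw [ContinuousLinearMap.completion_apply_coe, ContinuousLinearMap.completion_apply_coe,
        inner_coe, inner_coe]
      exact congrArg op (hST x y)

theorem operator_coe (T S : PreFock φ →ₗ[ℂ] PreFock φ)
    (hST : ∀ x y, PreFock.form (T x) y = PreFock.form x (S y))
    (hT : ∃ C : ℝ, ∀ x, ‖T x‖ ≤ C * ‖x‖) (x : PreFock φ) :
    operator T S hST hT (x : Fock φ) = ((T x : PreFock φ) : Fock φ) :=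
  ContinuousLinearMap.completion_apply_coe _ _

end Fock

namespace Fock

open UniformSpace PreFock

variable {φ}

theorem operator_ext {S T : Adjointable A (Fock φ)}
    (h : ∀ p, S ((tensor p : PreFock φ) : Fock φ) = T ((tensor p : PreFock φ) : Fock φ)) :
    S = T := by
  refine Adjointable.ext fun x => ?_
  refine Completion.induction_on x (isClosed_eq (ContinuousLinearMap.continuous _)
    (ContinuousLinearMap.continuous _)) fun x => ?_
  refine PreFock.induction (P := fun x => S (x : Fock φ) = T (x : Fock φ)) x h ?_ ?_
  · intro x y hx hy
    rw [Completion.coe_add, map_add, map_add, hx, hy]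
  · intro c x hx
    rw [Completion.coe_smul, map_smul, map_smul, hx]

/-- The left action of `A` on elementary tensors. -/
def preLeft (a : A) : PreFock φ →ₗ[ℂ] PreFock φ := lift fun p => tensor (Word.act φ a p)

theorem form_preLeft (a : A) (x y : PreFock φ) :
    form (preLeft a x) y = form x (preLeft (star a) y) :=
  form_adjoint (fun p q => by
    rw [preLeft, preLeft, lift_tensor, lift_tensor, form_tensor, form_tensor, kernel_act_left]) x y

theorem form_preLeft_add (a b : A) (x y : PreFock φ) :
    form x (preLeft (a + b) y) = form x (preLeft a y) + form x (preLeft b y) := by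
  refine PreFock.induction (P := fun x => form x (preLeft (a + b) y) =
    form x (preLeft a y) + form x (preLeft b y)) x (fun p => PreFock.induction
    (P := fun y => form (tensor p) (preLeft (a + b) y) =
      form (tensor p) (preLeft a y) + form (tensor p) (preLeft b y)) y (fun q => ?_) ?_ ?_) ?_ ?_
  · simp only [preLeft, lift_tensor, form_tensor, kernel_act_add]
  · intro y z hy hz; simp only [map_add, form_add_right, hy, hz]; abel
  · intro c y hy; simp only [map_smul, form_smul_right, hy, smul_add]
  · intro x z hx hz; simp only [form_add_left, hx, hz]; abel
  · intro c x hx; simp only [form_smul_left, hx, smul_add]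

theorem preLeft_mul (a b : A) (x : PreFock φ) : preLeft (a * b) x = preLeft a (preLeft b x) := by
  refine PreFock.induction (P := fun x => preLeft (a * b) x = preLeft a (preLeft b x)) x
    (fun p => ?_) ?_ ?_
  · simp only [preLeft, lift_tensor, act_mul]
  · intro x y hx hy; simp only [map_add, hx, hy]
  · intro c x hx; simp only [map_smul, hx]

theorem form_preLeft_algebraMap (r : ℝ) (x y : PreFock φ) :
    form x (preLeft (algebraMap ℝ A r) y) = r • form x y := by
  refine PreFock.induction (P := fun x => form x (preLeft (algebraMap ℝ A r) y) =
    r • form x y) x (fun p => PreFock.induction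
    (P := fun y => form (tensor p) (preLeft (algebraMap ℝ A r) y) =
      r • form (tensor p) y) y (fun q => ?_) ?_ ?_) ?_ ?_
  · have h1 : Word.act φ 1 q = q := by rcases q with ⟨_ | ⟨f, v⟩, b⟩ <;> simp
    have h2 : algebraMap ℝ A r = (r : ℂ) • (1 : A) := by
      rw [Complex.coe_smul, Algebra.algebraMap_eq_smul_one]
    rw [preLeft, lift_tensor, form_tensor, form_tensor, h2, kernel_act_smul, h1, Complex.coe_smul]
  · intro y z hy hz; simp only [map_add, form_add_right, hy, hz, smul_add]
  · intro c y hy; simp only [map_smul, form_smul_right, hy]; rw [smul_comm]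
  · intro x z hx hz; simp only [form_add_left, hx, hz, smul_add]
  · intro c x hx; simp only [form_smul_left, hx]; rw [smul_comm]

theorem form_preLeft_le {h : A} (hh : 0 ≤ h) (x : PreFock φ) :
    form x (preLeft h x) ≤ ‖h‖ • form x x := by
  have h1 : 0 ≤ algebraMap ℝ A ‖h‖ - h :=
    sub_nonneg.2 (IsSelfAdjoint.le_algebraMap_norm_self (IsSelfAdjoint.of_nonneg hh))
  obtain ⟨b, hb⟩ := CStarAlgebra.nonneg_iff_eq_star_mul_self.1 h1
  have h2 : form x (preLeft (algebraMap ℝ A ‖h‖) x) =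
      form (preLeft b x) (preLeft b x) + form x (preLeft h x) := by
    rw [form_preLeft, ← preLeft_mul, ← hb, ← form_preLeft_add, sub_add_cancel]
  rw [← form_preLeft_algebraMap, h2]
  exact le_add_of_nonneg_left (form_nonneg _)

variable (φ) in
/-- The left action of `a ∈ A` on the Fock space. -/
def left (a : A) : Adjointable A (Fock φ) :=
  operator (preLeft a) (preLeft (star a)) (form_preLeft a)
    (bounded_of_form_le (C := ‖star a * a‖) (norm_nonneg _) fun x => by
      rw [form_preLeft, ← preLeft_mul]
      exact form_preLeft_le (star_mul_self_nonneg a) x)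

/-- The creation operator `x ↦ e ⊗ x` on elementary tensors. -/
def preCreate (e : E) : PreFock φ →ₗ[ℂ] PreFock φ := lift fun p => tensor (e :: p.1, p.2)

/-- The annihilation operator on elementary tensors: `f ⊗ x ↦ φ(⟨e|f⟩) x`, and `a ↦ 0`
for `a ∈ A`. -/
def preAnnihilate (e : E) : PreFock φ →ₗ[ℂ] PreFock φ :=
  lift fun p => match p with
    | ([], _) => 0
    | (f :: u, a) => tensor (Word.act φ (braket A e f) (u, a))

theorem form_preCreate (e : E) (x y : PreFock φ) :
    form (preCreate e x) y = form x (preAnnihilate e y) :=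
  form_adjoint (fun p q => by
    rcases q with ⟨_ | ⟨f, v⟩, b⟩
    · have h0 : form (tensor p) (0 : PreFock φ) = 0 := by
        simpa using form_smul_right (tensor p) (0 : PreFock φ) 0
      simp only [preCreate, preAnnihilate, lift_tensor, form_tensor, h0, kernel_cons_nil]
    · simp only [preCreate, preAnnihilate, lift_tensor, form_tensor, kernel_cons_cons]) x y

theorem form_preCreate_self (e : E) (x y : PreFock φ) :
    form (preCreate e x) (preCreate e y) = form x (preLeft (braket A e e) y) := by
  rw [form_preCreate]
  congr 1
  refine PreFock.induction (P := fun y => preAnnihilate e (preCreate e y) =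
    preLeft (braket A e e) y) y (fun p => ?_) ?_ ?_
  · simp only [preCreate, preAnnihilate, preLeft, lift_tensor]
  · intro x y hx hy; simp only [map_add, hx, hy]
  · intro c x hx; simp only [map_smul, hx]

variable (φ) in
/-- The creation operator `T_e : x ↦ e ⊗ x` on the Fock space; its adjoint is the annihilation
operator. -/
def create (e : E) : Adjointable A (Fock φ) :=
  operator (preCreate e) (preAnnihilate e) (form_preCreate e)
    (bounded_of_form_le (C := ‖braket A e e‖) (norm_nonneg _) fun x => by
      rw [form_preCreate_self]
      exact form_preLeft_le (braket_self_nonneg e) x)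

theorem length_act (c : A) (p : Word A E) : (Word.act φ c p).1.length = p.1.length := by
  rcases p with ⟨_ | ⟨f, v⟩, b⟩ <;> simp

theorem kernel_eq_zero (u : List E) (a : A) (q : Word A E) (h : u.length ≠ q.1.length) :
    Word.kernel φ u a q = 0 := by
  induction u generalizing q with
  | nil => rcases q with ⟨_ | ⟨f, v⟩, b⟩ <;> simp at h ⊢
  | cons e u ih =>
    rcases q with ⟨_ | ⟨f, v⟩, b⟩
    · simp
    · rw [kernel_cons_cons]
      exact ih _ (by rw [length_act]; simpa using h)

/-- Multiplication by `zⁿ` on elementary tensors of length `n`. -/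
def preScale (z : Circle) : PreFock φ →ₗ[ℂ] PreFock φ :=
  lift fun p => ((z : ℂ) ^ p.1.length) • tensor p

theorem form_preScale (z : Circle) (x y : PreFock φ) :
    form (preScale z x) y = form x (preScale z⁻¹ y) :=
  form_adjoint (fun p q => by
    simp only [preScale, lift_tensor, form_smul_left, form_smul_right, form_tensor]
    by_cases h : p.1.length = q.1.length
    · rw [h, Circle.coe_inv_eq_conj]; simp
    · rw [kernel_eq_zero _ _ _ h, smul_zero, smul_zero]) x y

theorem preScale_mul (z w : Circle) (x : PreFock φ) :
    preScale (z * w) x = preScale z (preScale w x) := by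
  refine PreFock.induction (P := fun x => preScale (z * w) x = preScale z (preScale w x)) x
    (fun p => ?_) ?_ ?_
  · simp only [preScale, lift_tensor, map_smul, smul_smul, Circle.coe_mul, mul_pow, mul_comm]
  · intro x y hx hy; simp only [map_add, hx, hy]
  · intro c x hx; simp only [map_smul, hx]

theorem preScale_one (x : PreFock φ) : preScale 1 x = x := by
  refine PreFock.induction (P := fun x => preScale 1 x = x) x (fun p => ?_) ?_ ?_
  · simp only [preScale, lift_tensor, Circle.coe_one, one_pow, one_smul]
  · intro x y hx hy; simp only [map_add, hx, hy]
  · intro c x hx; simp only [map_smul, hx]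

variable (φ) in
/-- The operator acting as `zⁿ` on the summand `E^{⊗ n}` of the Fock space. -/
def scale (z : Circle) : Adjointable A (Fock φ) :=
  operator (preScale z) (preScale z⁻¹) (form_preScale z)
    (bounded_of_form_le (C := 1) zero_le_one fun x => by
      rw [form_preScale, ← preScale_mul, inv_mul_cancel, preScale_one, one_smul])

theorem scale_mul (z w : Circle) : scale φ (z * w) = scale φ z * scale φ w :=
  operator_ext fun p => by
    rw [map_mul, mul_apply_eq_comp, scale, scale, scale, operator_coe, operator_coe,
      operator_coe, preScale_mul]

theorem scale_one : scale φ 1 = 1 :=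
  operator_ext fun p => by
    rw [scale, operator_coe, preScale_one, map_one, one_apply_eq_self]

theorem star_scale (z : Circle) : star (scale φ z) = scale φ z⁻¹ :=
  Adjointable.star_eq_of fun x y => by
    refine Completion.induction_on₂ x y (isClosed_eq
      (continuous_inner.comp ((ContinuousLinearMap.continuous _).prodMap continuous_id))
      (continuous_inner.comp (continuous_id.prodMap (ContinuousLinearMap.continuous _))))
      fun x y => ?_
    rw [scale, scale, operator_coe, operator_coe, inner_coe, inner_coe, form_preScale]

theorem star_left (a : A) : star (left φ a) = left φ (star a) :=
  Adjointable.star_eq_of fun x y => by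
    refine Completion.induction_on₂ x y (isClosed_eq
      (continuous_inner.comp ((ContinuousLinearMap.continuous _).prodMap continuous_id))
      (continuous_inner.comp (continuous_id.prodMap (ContinuousLinearMap.continuous _))))
      fun x y => ?_
    rw [left, left, operator_coe, operator_coe, inner_coe, inner_coe, form_preLeft]

variable (φ) in
/-- The unitary representation of the circle on the Fock space, `z ↦ ⊕ₙ zⁿ`. -/
def gaugeUnitary : Circle →* unitary (Adjointable A (Fock φ)) where
  toFun z := ⟨scale φ z, by
    rw [Unitary.mem_iff, star_scale, ← scale_mul, ← scale_mul]
    simp [scale_one]⟩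
  map_one' := Subtype.ext scale_one
  map_mul' z w := Subtype.ext (scale_mul z w)

theorem conj_left (z : Circle) (a : A) :
    Unitary.conjStarAlgAut ℂ _ (gaugeUnitary φ z) (left φ a) = left φ a := by
  rw [Unitary.conjStarAlgAut_apply]
  change scale φ z * left φ a * star (scale φ z) = _
  rw [star_scale]
  refine operator_ext fun p => ?_
  simp only [map_mul, mul_apply_eq_comp]
  rw [scale, scale, left, operator_coe, operator_coe, operator_coe, operator_coe]
  congr 1
  simp only [preScale, preLeft, lift_tensor, map_smul, length_act, smul_smul]
  rw [← mul_pow]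
  simp

theorem conj_create (z : Circle) (e : E) :
    Unitary.conjStarAlgAut ℂ _ (gaugeUnitary φ z) (create φ e) = (z : ℂ) • create φ e := by
  rw [Unitary.conjStarAlgAut_apply]
  change scale φ z * create φ e * star (scale φ z) = _
  rw [star_scale]
  refine operator_ext fun p => ?_
  simp only [map_mul, mul_apply_eq_comp, map_smul, smul_apply]
  rw [scale, scale, create, operator_coe, operator_coe, operator_coe, operator_coe,
    ← Completion.coe_smul]
  congr 1
  simp only [preScale, preCreate, lift_tensor, map_smul, smul_smul, List.length_cons, pow_succ]
  rw [← mul_assoc, ← mul_pow]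
  simp

end Fock
end Fock

/-! ### Quotients by closed self-adjoint two-sided ideals -/

section Quotient

variable {R : Type*} [CStarAlgebra R] (S : Set R)

/-- The closed two-sided ideal generated by a set. -/
def closedIdeal : Ideal R :=
  sInf {J : Ideal R | J.IsTwoSided ∧ IsClosed (J : Set R) ∧ S ⊆ J}

variable {S} in
theorem mem_closedIdeal {x : R} : x ∈ closedIdeal S ↔
    ∀ J : Ideal R, J.IsTwoSided → IsClosed (J : Set R) → S ⊆ J → x ∈ J := by
  simp [closedIdeal, Submodule.mem_sInf]

theorem subset_closedIdeal : S ⊆ closedIdeal S :=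
  fun _ hx => mem_closedIdeal.2 fun _ _ _ h => h hx

instance instTwoSidedClosedIdeal : (closedIdeal S).IsTwoSided where
  mul_mem_of_left b ha := mem_closedIdeal.2 fun J hJ hc hS =>
    hJ.mul_mem_of_left b (mem_closedIdeal.1 ha J hJ hc hS)

instance instIsClosedClosedIdeal : IsClosed (closedIdeal S : Set R) := by
  have : (closedIdeal S : Set R) = ⋂ J : {J : Ideal R // J.IsTwoSided ∧ IsClosed (J : Set R) ∧
      S ⊆ J}, (J.1 : Set R) := by
    ext x
    simp [mem_closedIdeal]
  rw [this]
  exact isClosed_iInter fun J => J.2.2.1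

variable {S} in
theorem map_mem_closedIdeal (f : R →⋆ₐ[ℂ] R) (hf : Continuous f) (hS : ∀ x ∈ S, f x ∈ S) {x : R}
    (hx : x ∈ closedIdeal S) : f x ∈ closedIdeal S := by
  refine mem_closedIdeal.2 fun J hJ hc hSJ => ?_
  refine mem_closedIdeal.1 hx (J.comap (f : R →+* R)) ⟨fun {a} b ha => ?_⟩ (hc.preimage hf)
    fun y hy => hSJ (hS y hy)
  change f (a * b) ∈ J
  rw [map_mul]
  exact hJ.mul_mem_of_left _ ha

variable {S} in
theorem star_mem_closedIdeal (hS : ∀ x ∈ S, star x ∈ S) {x : R} (hx : x ∈ closedIdeal S) :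
    star x ∈ closedIdeal S := by
  refine mem_closedIdeal.2 fun J hJ hc hSJ => ?_
  let J' : Ideal R :=
    { carrier := {y | star y ∈ J}
      add_mem' := fun {a b} ha hb => by
        change star (a + b) ∈ J
        rw [star_add]
        exact J.add_mem ha hb
      zero_mem' := by
        change star (0 : R) ∈ J
        rw [star_zero]
        exact J.zero_mem
      smul_mem' := fun c a ha => by
        change star (c * a) ∈ J
        rw [star_mul]
        exact hJ.mul_mem_of_left _ ha }
  refine mem_closedIdeal.1 hx J' ⟨fun {a} b ha => ?_⟩ (hc.preimage continuous_star)
    fun y hy => hSJ (hS y hy)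
  change star (a * b) ∈ J
  rw [star_mul]
  exact J.mul_mem_left _ ha

variable (R) in
/-- A self-adjoint set, used as generators of a closed two-sided ideal. -/
structure Generators where
  /-- the generating set -/
  carrier : Set R
  star_mem : ∀ x ∈ carrier, star x ∈ carrier

variable (G : Generators R)

/-- The quotient of a C⋆-algebra by the closed two-sided ideal generated by a set, with the
quotient norm and the induced involution. -/
def IdealQuotient : Type _ := R ⧸ closedIdeal G.carrier

namespace IdealQuotient

instance instRing : Ring (IdealQuotient G) := inferInstanceAs (Ring (R ⧸ closedIdeal G.carrier))

instance instAlgebra : Algebra ℂ (IdealQuotient G) :=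
  inferInstanceAs (Algebra ℂ (R ⧸ closedIdeal G.carrier))

/-- The quotient map. -/
def mk : R →ₐ[ℂ] IdealQuotient G := Ideal.Quotient.mkₐ ℂ (closedIdeal G.carrier)

theorem mk_surjective : Function.Surjective (mk G) := Ideal.Quotient.mk_surjective

variable {G} in
theorem mk_eq_zero_iff {x : R} : mk G x = 0 ↔ x ∈ closedIdeal G.carrier :=
  Ideal.Quotient.eq_zero_iff_mem

/-- The quotient norm. -/
instance instNormedAddCommGroup : NormedAddCommGroup (IdealQuotient G) :=
  inferInstanceAs (NormedAddCommGroup (R ⧸ closedIdeal G.carrier))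

theorem norm_mk_lt (x : IdealQuotient G) {ε : ℝ} (hε : 0 < ε) : ∃ r : R, mk G r = x ∧ ‖r‖ < ‖x‖ + ε :=
  Submodule.Quotient.norm_mk_lt (S := closedIdeal G.carrier) x hε

theorem norm_mk_le (r : R) : ‖mk G r‖ ≤ ‖r‖ :=
  Submodule.Quotient.norm_mk_le (closedIdeal G.carrier) r

instance instCompleteSpace : CompleteSpace (IdealQuotient G) :=
  inferInstanceAs (CompleteSpace (R ⧸ closedIdeal G.carrier))

instance instNormedRing : NormedRing (IdealQuotient G) where
  __ := instNormedAddCommGroup G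
  __ := instRing G
  norm_mul_le x y := by
    have key : ∀ ε : ℝ, 0 < ε → ‖x * y‖ ≤ (‖x‖ + ε) * (‖y‖ + ε) := by
      intro ε hε
      obtain ⟨a, rfl, ha⟩ := norm_mk_lt G x hε
      obtain ⟨b, rfl, hb⟩ := norm_mk_lt G y hε
      rw [← map_mul]
      exact (norm_mk_le G _).trans ((norm_mul_le a b).trans
        (mul_le_mul ha.le hb.le (norm_nonneg _) ((norm_nonneg _).trans ha.le)))
    have hc : Continuous fun ε : ℝ => (‖x‖ + ε) * (‖y‖ + ε) := by fun_prop
    have hlim := (hc.tendsto 0).mono_left (nhdsWithin_le_nhds (s := Set.Ioi 0))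
    simp only [add_zero] at hlim
    exact ge_of_tendsto hlim (Filter.eventually_of_mem self_mem_nhdsWithin key)

instance instNormedAlgebra : NormedAlgebra ℂ (IdealQuotient G) where
  norm_smul_le c x := (Submodule.Quotient.normedSpace (closedIdeal G.carrier) ℂ).norm_smul_le c x

instance instStar : Star (IdealQuotient G) where
  star := Quotient.lift (fun x : R => mk G (star x)) fun x y h => by
    have h1 := star_mem_closedIdeal G.star_mem ((Submodule.quotientRel_def _).1 h)
    rw [star_sub] at h1
    rw [← sub_eq_zero, ← map_sub]
    exact mk_eq_zero_iff.2 h1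

theorem star_mk (x : R) : star (mk G x) = mk G (star x) := rfl

instance instStarRing : StarRing (IdealQuotient G) where
  star_involutive x := by
    obtain ⟨x, rfl⟩ := mk_surjective G x
    simp [star_mk]
  star_mul x y := by
    obtain ⟨x, rfl⟩ := mk_surjective G x
    obtain ⟨y, rfl⟩ := mk_surjective G y
    simp only [star_mk, ← map_mul, star_mul]
  star_add x y := by
    obtain ⟨x, rfl⟩ := mk_surjective G x
    obtain ⟨y, rfl⟩ := mk_surjective G y
    simp only [star_mk, ← map_add, star_add]

instance instStarModule : StarModule ℂ (IdealQuotient G) where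
  star_smul c x := by
    obtain ⟨x, rfl⟩ := mk_surjective G x
    simp only [star_mk, ← map_smul, star_smul]

/-- The endomorphism of the quotient induced by an endomorphism that preserves the generators. -/
def map (f : R →⋆ₐ[ℂ] R) (hf : Continuous f) (hG : ∀ x ∈ G.carrier, f x ∈ G.carrier) :
    IdealQuotient G →⋆ₐ[ℂ] IdealQuotient G where
  __ := Ideal.Quotient.liftₐ (closedIdeal G.carrier) ((mk G).comp (f : R →ₐ[ℂ] R)) fun x hx => by
    exact mk_eq_zero_iff.2 (map_mem_closedIdeal f hf hG hx)
  map_star' x := by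
    obtain ⟨x, rfl⟩ := mk_surjective G x
    change mk G (f (star x)) = star (mk G (f x))
    rw [map_star, star_mk]

theorem map_mk (f : R →⋆ₐ[ℂ] R) (hf : Continuous f) (hG : ∀ x ∈ G.carrier, f x ∈ G.carrier)
    (x : R) : map G f hf hG (mk G x) = mk G (f x) := rfl

end IdealQuotient

end Quotient

/-! ### The Pimsner–Toeplitz algebra, the Cuntz–Pimsner algebra and the gauge action -/

section CuntzPimsnerAlgebra

variable {A E : Type*} [CStarAlgebra A] [PartialOrder A] [StarOrderedRing A]
  [NormedAddCommGroup E] [NormedSpace ℂ E] [SMul Aᵐᵒᵖ E] [CStarModule Aᵐᵒᵖ E]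
  (φ : A →⋆ₐ[ℂ] Adjointable A E)

/-- The C⋆-algebra of operators on the Fock space generated by `A` and the creation operators. -/
def toeplitzSubalgebra : StarSubalgebra ℂ (Adjointable A (Fock φ)) :=
  (StarAlgebra.adjoin ℂ (Set.range (Fock.left φ) ∪ Set.range (Fock.create φ))).topologicalClosure

/-- The Pimsner–Toeplitz algebra `T_E`. -/
def Toeplitz : Type _ := toeplitzSubalgebra φ

namespace Toeplitz

instance instCStarAlgebra : CStarAlgebra (Toeplitz φ) :=
  StarSubalgebra.cstarAlgebra (toeplitzSubalgebra φ)
    (h_closed := StarSubalgebra.isClosed_topologicalClosure _)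

/-- The inclusion of `T_E` in the operators on the Fock space. -/
def val : Toeplitz φ →⋆ₐ[ℂ] Adjointable A (Fock φ) := (toeplitzSubalgebra φ).subtype

theorem left_mem (a : A) : Fock.left φ a ∈ toeplitzSubalgebra φ :=
  StarSubalgebra.le_topologicalClosure _ (StarAlgebra.subset_adjoin ℂ _ (Or.inl ⟨a, rfl⟩))

theorem create_mem (e : E) : Fock.create φ e ∈ toeplitzSubalgebra φ :=
  StarSubalgebra.le_topologicalClosure _ (StarAlgebra.subset_adjoin ℂ _ (Or.inr ⟨e, rfl⟩))

/-- The element `a ∈ A` of `T_E`. -/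
def left (a : A) : Toeplitz φ := ⟨Fock.left φ a, left_mem φ a⟩

/-- The creation operator `e ∈ E` in `T_E`. -/
def create (e : E) : Toeplitz φ := ⟨Fock.create φ e, create_mem φ e⟩

/-- Conjugation by the unitary `⊕ₙ zⁿ`. -/
def conj (z : Circle) : Adjointable A (Fock φ) →⋆ₐ[ℂ] Adjointable A (Fock φ) :=
  (Unitary.conjStarAlgAut ℂ (Adjointable A (Fock φ)) (Fock.gaugeUnitary φ z) :
    Adjointable A (Fock φ) →⋆ₐ[ℂ] Adjointable A (Fock φ))

theorem continuous_conj (z : Circle) : Continuous (conj φ z) := by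
  have h : Continuous fun x : Adjointable A (Fock φ) =>
      (Fock.gaugeUnitary φ z : Adjointable A (Fock φ)) * x *
        star (Fock.gaugeUnitary φ z : Adjointable A (Fock φ)) := by fun_prop
  exact h

theorem conj_left (z : Circle) (a : A) : conj φ z (Fock.left φ a) = Fock.left φ a :=
  Fock.conj_left z a

theorem conj_create (z : Circle) (e : E) :
    conj φ z (Fock.create φ e) = (z : ℂ) • Fock.create φ e :=
  Fock.conj_create z e

theorem conj_mem_adjoin (z : Circle) (x : Adjointable A (Fock φ))
    (hx : x ∈ StarAlgebra.adjoin ℂ (Set.range (Fock.left φ) ∪ Set.range (Fock.create φ))) :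
    conj φ z x ∈ StarAlgebra.adjoin ℂ (Set.range (Fock.left φ) ∪ Set.range (Fock.create φ)) := by
  induction hx using StarAlgebra.adjoin_induction with
  | mem x hx =>
    rcases hx with ⟨a, rfl⟩ | ⟨e, rfl⟩
    · rw [conj_left]
      exact StarAlgebra.subset_adjoin ℂ _ (Or.inl ⟨a, rfl⟩)
    · rw [conj_create]
      exact SMulMemClass.smul_mem _ (StarAlgebra.subset_adjoin ℂ _ (Or.inr ⟨e, rfl⟩))
  | algebraMap r => rw [AlgHomClass.commutes]; exact algebraMap_mem _ r
  | add x y _ _ hx hy => rw [map_add]; exact add_mem hx hy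
  | mul x y _ _ hx hy => rw [map_mul]; exact mul_mem hx hy
  | star x _ hx => rw [map_star]; exact star_mem hx

theorem conj_mem (z : Circle) (x : Adjointable A (Fock φ)) (hx : x ∈ toeplitzSubalgebra φ) :
    conj φ z x ∈ toeplitzSubalgebra φ :=
  map_mem_closure (continuous_conj φ z) hx (conj_mem_adjoin φ z)

/-- The gauge action on `T_E`: it fixes `A` and scales `e ∈ E` by `z`. -/
def gauge (z : Circle) : Toeplitz φ →⋆ₐ[ℂ] Toeplitz φ :=
  StarAlgHom.codRestrict ((conj φ z).comp (val φ)) (toeplitzSubalgebra φ)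
    fun x => conj_mem φ z x.1 x.2

theorem gauge_left (z : Circle) (a : A) : gauge φ z (left φ a) = left φ a :=
  Subtype.ext (Fock.conj_left z a)

theorem gauge_create (z : Circle) (e : E) : gauge φ z (create φ e) = (z : ℂ) • create φ e :=
  Subtype.ext (Fock.conj_create z e)

theorem continuous_gauge (z : Circle) : Continuous (gauge φ z) :=
  ((continuous_conj φ z).comp continuous_subtype_val).subtype_mk _

theorem star_left (a : A) : star (left φ a) = left φ (star a) :=
  Subtype.ext (Fock.star_left a)

end Toeplitz

/-- The graph of the homomorphism `ψ₁ : K(E) → T_E`, which is determined by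
`ψ₁(|e⟩⟨f|) = e f⋆` and continuity: the closed linear span of the pairs `(|e⟩⟨f|, e f⋆)`. -/
def psiGraph : Submodule ℂ (Adjointable A E × Toeplitz φ) :=
  (Submodule.span ℂ {p | ∃ e f : E,
    p = (rankOne A e f, Toeplitz.create φ e * star (Toeplitz.create φ f))}).topologicalClosure

/-- The ideal `J_E = φ⁻¹(K(E)) ∩ ker(φ)^⊥` of `A`. -/
def katsuraIdeal : Set A :=
  {a | (∀ b, φ b = 0 → a * b = 0 ∧ b * a = 0) ∧ φ a ∈ compactOperators A E}

/-- The elements `a - ψ₁(φ(a))` of `T_E`, for `a ∈ J_E`. -/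
def covarianceSet : Set (Toeplitz φ) :=
  {x | ∃ a ∈ katsuraIdeal φ, ∃ t, (φ a, t) ∈ psiGraph φ ∧ x = Toeplitz.left φ a - t}

theorem star_mem_psiGraph {p : Adjointable A E × Toeplitz φ} (hp : p ∈ psiGraph φ) :
    star p ∈ psiGraph φ := by
  refine map_mem_closure continuous_star hp fun q hq => ?_
  induction hq using Submodule.span_induction with
  | mem q hq =>
    obtain ⟨e, f, rfl⟩ := hq
    refine Submodule.subset_span ⟨f, e, Prod.ext (star_rankOne e f) ?_⟩
    simp
  | zero => rw [star_zero]; exact Submodule.zero_mem _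
  | add x y _ _ hx hy => rw [star_add]; exact Submodule.add_mem _ hx hy
  | smul c x _ hx => rw [star_smul]; exact Submodule.smul_mem _ _ hx

theorem star_mem_compactOperators {k : Adjointable A E} (hk : k ∈ compactOperators A E) :
    star k ∈ compactOperators A E := by
  refine map_mem_closure continuous_star hk fun q hq => ?_
  induction hq using Submodule.span_induction with
  | mem q hq =>
    obtain ⟨e, f, rfl⟩ := hq
    exact Submodule.subset_span ⟨f, e, star_rankOne e f⟩
  | zero => rw [star_zero]; exact Submodule.zero_mem _
  | add x y _ _ hx hy => rw [star_add]; exact Submodule.add_mem _ hx hy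
  | smul c x _ hx => rw [star_smul]; exact Submodule.smul_mem _ _ hx

theorem gauge_eq_of_mem_psiGraph (z : Circle) {p : Adjointable A E × Toeplitz φ}
    (hp : p ∈ psiGraph φ) : Toeplitz.gauge φ z p.2 = p.2 := by
  have hcl : IsClosed {p : Adjointable A E × Toeplitz φ | Toeplitz.gauge φ z p.2 = p.2} :=
    isClosed_eq ((Toeplitz.continuous_gauge φ z).comp continuous_snd) continuous_snd
  refine closure_minimal (fun q hq => ?_) hcl hp
  change Toeplitz.gauge φ z q.2 = q.2
  induction hq using Submodule.span_induction with
  | mem q hq =>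
    obtain ⟨e, f, rfl⟩ := hq
    have hz : (z : ℂ) * star (z : ℂ) = 1 := by
      rw [Complex.star_def, ← Circle.coe_inv_eq_conj, ← Circle.coe_mul, mul_inv_cancel,
        Circle.coe_one]
    simp only [map_mul, map_star, Toeplitz.gauge_create, star_smul, smul_mul_smul_comm, hz,
      one_smul]
  | zero => simp
  | add x y _ _ hx hy => rw [Prod.snd_add, map_add, hx, hy]
  | smul c x _ hx => rw [Prod.smul_snd, map_smul, hx]

theorem star_mem_katsuraIdeal {a : A} (ha : a ∈ katsuraIdeal φ) : star a ∈ katsuraIdeal φ := by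
  refine ⟨fun b hb => ?_, ?_⟩
  · have h := ha.1 (star b) (by rw [map_star, hb, star_zero])
    constructor
    · rw [← star_star b, ← star_mul, h.2, star_zero]
    · rw [← star_star b, ← star_mul, h.1, star_zero]
  · rw [map_star]
    exact star_mem_compactOperators ha.2

/-- The generators `a - ψ₁(φ(a))`, `a ∈ J_E`, of the kernel of `T_E → O_E`. -/
def covariance : Generators (Toeplitz φ) where
  carrier := covarianceSet φ
  star_mem := by
    rintro _ ⟨a, ha, t, ht, rfl⟩
    refine ⟨star a, star_mem_katsuraIdeal φ ha, star t, ?_, ?_⟩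
    · rw [map_star]
      exact star_mem_psiGraph φ ht
    · rw [star_sub, Toeplitz.star_left]

/-- The Cuntz–Pimsner algebra `O_E` of the correspondence `(A, E, φ)`: the quotient of `T_E` by the
closed ideal generated by the elements `a - ψ₁(φ(a))` with `a ∈ J_E`. -/
abbrev CPAlgebra : Type _ := IdealQuotient (covariance φ)

/-- The gauge action of the circle on `O_E`, induced by that on `T_E`. -/
def gauge (z : Circle) : CPAlgebra φ →⋆ₐ[ℂ] CPAlgebra φ :=
  IdealQuotient.map (covariance φ) (Toeplitz.gauge φ z) (Toeplitz.continuous_gauge φ z) (by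
    rintro _ ⟨a, ha, t, ht, rfl⟩
    refine ⟨a, ha, t, ht, ?_⟩
    rw [map_sub, Toeplitz.gauge_left, gauge_eq_of_mem_psiGraph φ z ht])

end CuntzPimsnerAlgebra

/-! ### Free and saturated actions -/

section Free

variable {G B : Type*} [TopologicalSpace G] [NormedRing B] [NormedAlgebra ℂ B]

/-- An action `α` of a compact group `G` on `B` is free if the elements `(a ⊗ 1) ρ(b)` span a
norm-dense subspace of `B ⊗ C(G) = C(G, B)`, where `ρ(b) = (g ↦ α g b)`. -/
def IsFreeAction [CompactSpace G] (α : G → B → B) : Prop :=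
  Dense (Submodule.span ℂ {F : C(G, B) | ∃ a b : B, ∀ g, F g = a * α g b} : Set C(G, B))

/-- The spectral subspace of a character `τ` of the group. -/
def spectralSubspace [Monoid G] (α : G → B → B) (τ : PontryaginDual G) : Set B :=
  {b | ∀ g, α g b = (τ g : ℂ) • b}

/-- An action `α` of a compact abelian group is saturated if `B_τ⋆ B_τ` spans a dense subspace of
the fixed-point algebra, for all characters `τ` (the inclusion `B_τ⋆ B_τ ⊆ B^G` is automatic for
an action by `⋆`-automorphisms). -/
def IsSaturatedAction [Monoid G] [StarRing B] (α : G → B → B) : Prop :=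
  ∀ τ : PontryaginDual G, {b | ∀ g, α g b = b} ⊆
    closure (Submodule.span ℂ {x | ∃ a ∈ spectralSubspace α τ, ∃ b ∈ spectralSubspace α τ,
      x = star a * b} : Set B)

end Free

/-! ### Properties of correspondences -/

section Properties

variable {A E : Type*} [CStarAlgebra A] [PartialOrder A] [StarOrderedRing A]
  [NormedAddCommGroup E] [NormedSpace ℂ E] [SMul Aᵐᵒᵖ E] [CStarModule Aᵐᵒᵖ E]
  (φ : A →⋆ₐ[ℂ] Adjointable A E)

/-- The descending chain `I₀ = A`, `I_{n+1}` the closed span of the `⟨e|φ(x)f⟩` with `x ∈ I_n`. -/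
def idealChain : ℕ → Submodule ℂ A
  | 0 => ⊤
  | n + 1 => (Submodule.span ℂ
      {y | ∃ e f : E, ∃ x ∈ idealChain n, y = braket A e (φ x f)}).topologicalClosure

/-- The correspondence is artinian: the chain of ideals eventually stabilizes. -/
def IsArtinianCorrespondence : Prop := ∃ N, ∀ n, N ≤ n → idealChain φ n = idealChain φ N

end Properties

end CuntzPimsner

end

/-! The proof runs in a cycle: the three conditions imply freeness, freeness implies saturation, and
saturation implies the three conditions.

Freeness implies saturation for every compact abelian group (`ContinuousAction.saturated_of_free`).
The bounded map that sends F to the fixed-point projection of ∫ τ(g)⁻¹ F(g) dg takes g ↦ a α_g(b) to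
the product of the τ⁻¹-part of a and the τ-part of b, and takes g ↦ τ(g) 1 to 1. So 1 lies in the
closed span of the products of the τ⁻¹- and τ-subspaces, and multiplying by a fixed element gives
saturation.

For saturation implies the conditions, everything is lifted to T_E, where 1 is approximated by the
span of T_τ⋆ T_τ plus an element j of the kernel of T_E → O_E. Two characters suffice. For τ = z⁻¹,
operators of degree -1 kill the summand A of the Fock space, so there 1 is approximated by matrix
coefficients of j alone. These lie in the closed ideal J_E (`braket_mem_katsuraIdeal`), so 1 ∈ J_E.
This says that φ is injective and that the identity of E is compact; a combination of rank-one
operators close to the identity is then invertible, and E is finitely generated. For τ = z, the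
element j is asymptotically zero on E^{⊗ n} as n grows (`val_mem_vanishing`), so for a large n the
identity of E^{⊗ n} is at distance at most 1/2 from an operator with matrix coefficients in I_{n+1}.
A Neumann iteration (`braket_mem_of_contraction`) puts all inner products of E^{⊗ n} into I_{n+1}.
Since they generate I_n, the chain stops at n.

For the conditions imply freeness, density of trigonometric polynomials reduces freeness of a circle
action to having 1 in the closed span of B Bₙ for every integer n
(`ContinuousAction.free_of_one_mem_closure`). Finite generation makes a frame operator of E
invertible, so 1 = ∑ |eᵢ⟩⟨fᵢ| (`exists_one_eq_sum_rankOne`); with φ injective this becomes 1 = ∑ eᵢ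
fᵢ⋆ in O_E. Iterating, 1 is a combination of u v⋆ with u, v words of any prescribed length, which
settles n ≤ 0. For n ≥ 0, write 1 = 1 · 1 as a combination of u (v⋆ s) t⋆ with words of length m,
where the chain is stationary from m on. Then v⋆ s lies in I_m = I_{m+n}, so it is a limit of
combinations of p⋆ r b with p, r of length m + n and b ∈ A, and the right factor of (u p⋆)(r b t⋆)
has degree n. -/

noncomputable section

namespace CuntzPimsner

open scoped InnerProductSpace CStarAlgebra
open MulOpposite

set_option linter.unusedSectionVars false

/-! ### Means over compact groups and spectral subspaces -/

section Mean

variable {G : Type*} [TopologicalSpace G] [CommGroup G] [IsTopologicalGroup G] [CompactSpace G]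
  {B C : Type*} [NormedAddCommGroup B] [NormedSpace ℂ B] [CompleteSpace B]
  [NormedAddCommGroup C] [NormedSpace ℂ C] [CompleteSpace C]

open MeasureTheory

/-- The normalized Haar integral of a continuous function on a compact group. -/
def mean (F : C(G, B)) : B :=
  letI : MeasurableSpace G := borel G
  haveI : BorelSpace G := ⟨rfl⟩
  ∫ g, F g ∂Measure.haarMeasure (⊤ : TopologicalSpace.PositiveCompacts G)

theorem integrable_haarMeasure_top [MeasurableSpace G] [BorelSpace G] (F : C(G, B)) :
    Integrable F (Measure.haarMeasure (⊤ : TopologicalSpace.PositiveCompacts G)) := by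
  have h := F.continuous.integrable_of_hasCompactSupport
    (μ := Measure.haarMeasure (⊤ : TopologicalSpace.PositiveCompacts G))
    (HasCompactSupport.of_compactSpace _)
  exact h

theorem haarMeasure_top_univ [MeasurableSpace G] [BorelSpace G] :
    (Measure.haarMeasure (⊤ : TopologicalSpace.PositiveCompacts G)) Set.univ = 1 := by
  have := Measure.haarMeasure_self (K₀ := (⊤ : TopologicalSpace.PositiveCompacts G))
  simpa using this

theorem mean_const (b : B) : mean (ContinuousMap.const G b) = b := by
  let _ : MeasurableSpace G := borel G
  have _ : BorelSpace G := ⟨rfl⟩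
  change ∫ g : G, b ∂Measure.haarMeasure (⊤ : TopologicalSpace.PositiveCompacts G) = b
  rw [integral_const, measureReal_def, haarMeasure_top_univ]
  simp

theorem mean_add (F F' : C(G, B)) : mean (F + F') = mean F + mean F' := by
  let _ : MeasurableSpace G := borel G
  have _ : BorelSpace G := ⟨rfl⟩
  exact integral_add (integrable_haarMeasure_top F) (integrable_haarMeasure_top F')

theorem mean_smul (c : ℂ) (F : C(G, B)) : mean (c • F) = c • mean F := by
  let _ : MeasurableSpace G := borel G
  have _ : BorelSpace G := ⟨rfl⟩
  exact integral_smul c _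

theorem norm_mean_le (F : C(G, B)) : ‖mean F‖ ≤ ‖F‖ := by
  let _ : MeasurableSpace G := borel G
  have _ : BorelSpace G := ⟨rfl⟩
  have h := norm_integral_le_of_norm_le_const
    (μ := Measure.haarMeasure (⊤ : TopologicalSpace.PositiveCompacts G)) (f := F) (C := ‖F‖)
    (Filter.Eventually.of_forall F.norm_coe_le_norm)
  rwa [measureReal_def, haarMeasure_top_univ, ENNReal.toReal_one, mul_one] at h

theorem mean_translate {F F' : C(G, B)} (h : G) (hF : ∀ g, F' g = F (h * g)) :
    mean F' = mean F := by
  let _ : MeasurableSpace G := borel G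
  have _ : BorelSpace G := ⟨rfl⟩
  have := integral_mul_left_eq_self
    (μ := Measure.haarMeasure (⊤ : TopologicalSpace.PositiveCompacts G)) F h
  simp only [← hF] at this
  exact this

/-- The image function is a separate argument, tied to F only pointwise, so that any bundled
function with the right values can be used. -/
theorem map_mean (T : B →L[ℂ] C) {F : C(G, B)} {F' : C(G, C)} (hF : ∀ g, F' g = T (F g)) :
    T (mean F) = mean F' := by
  let _ : MeasurableSpace G := borel G
  have _ : BorelSpace G := ⟨rfl⟩
  have := T.integral_comp_comm (integrable_haarMeasure_top F)
  simp only [← hF] at this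
  exact this.symm

variable (G B) in
/-- The normalized Haar integral as a continuous linear map. -/
def meanCLM : C(G, B) →L[ℂ] B :=
  LinearMap.mkContinuous ⟨⟨mean, mean_add⟩, mean_smul⟩ 1 fun F => by
    simpa using norm_mean_le F

end Mean

/-! ### Spectral projections of actions of compact abelian groups. -/

section Spectral

variable {G : Type*} [TopologicalSpace G] [CommGroup G] [IsTopologicalGroup G] [CompactSpace G]
  {B : Type*} [NormedRing B] [NormedAlgebra ℂ B] [StarRing B]

variable (G B) in
/-- A strongly continuous action of a topological group by contractive `⋆`-endomorphisms. -/
structure ContinuousAction where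
  /-- the endomorphism given by a group element -/
  act : G → B →⋆ₐ[ℂ] B
  act_mul : ∀ g h b, act (g * h) b = act g (act h b)
  norm_act_le : ∀ g b, ‖act g b‖ ≤ ‖b‖
  continuous_act : ∀ b, Continuous fun g => act g b

namespace ContinuousAction

variable (α : ContinuousAction G B)

/-- The function underlying an action. -/
abbrev toFun : G → B → B := fun g => α.act g

/-- A group element as a continuous linear map. -/
def actCLM (g : G) : B →L[ℂ] B :=
  LinearMap.mkContinuous ⟨⟨α.act g, map_add _⟩, map_smul _⟩ 1 fun b => by
    simpa using α.norm_act_le g b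

theorem mul_mem_spectralSubspace {σ τ : PontryaginDual G} {a b : B}
    (ha : a ∈ spectralSubspace α.toFun σ) (hb : b ∈ spectralSubspace α.toFun τ) :
    a * b ∈ spectralSubspace α.toFun (σ * τ) := fun g => by
  change α.act g (a * b) = _
  rw [map_mul, show α.act g a = _ from ha g, show α.act g b = _ from hb g, smul_mul_smul_comm]
  rfl

theorem star_mem_spectralSubspace [StarModule ℂ B] {τ : PontryaginDual G} {b : B}
    (hb : b ∈ spectralSubspace α.toFun τ) : star b ∈ spectralSubspace α.toFun τ⁻¹ := fun g => by
  change α.act g (star b) = _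
  rw [map_star, show α.act g b = _ from hb g, star_smul]
  congr 1
  exact (Circle.coe_inv_eq_conj (τ g)).symm

theorem mem_spectralSubspace_one {b : B} :
    b ∈ spectralSubspace α.toFun (1 : PontryaginDual G) ↔ ∀ g, α.act g b = b := by
  refine forall_congr' fun g => ?_
  rw [show ((1 : PontryaginDual G) g : ℂ) = 1 from rfl, one_smul]

/-- The function `g ↦ τ(g)⁻¹ α_g(b)`. -/
def twist (τ : PontryaginDual G) (b : B) : C(G, B) where
  toFun g := ((τ g)⁻¹ : Circle) • α.act g b
  continuous_toFun := by
    have h1 : Continuous fun g => τ g := map_continuous τ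
    exact h1.inv.smul (α.continuous_act b)

variable [CompleteSpace B]

/-- The projection onto a spectral subspace. -/
def proj (τ : PontryaginDual G) (b : B) : B := mean (α.twist τ b)

/-- Apply α_h under the integral and substitute g ↦ hg: invariance of Haar measure leaves the factor
τ(h). -/
theorem proj_mem (τ : PontryaginDual G) (b : B) :
    α.proj τ b ∈ spectralSubspace α.toFun τ := fun h => by
  let F' : C(G, B) := ⟨fun g => α.actCLM h (α.twist τ b g), by fun_prop⟩
  have h1 : α.actCLM h (α.proj τ b) = mean F' := map_mean _ fun g => rfl
  have h2 : mean ((τ h : ℂ)⁻¹ • F') = mean (α.twist τ b) := by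
    refine mean_translate h fun g => ?_
    change (τ h : ℂ)⁻¹ • α.act h (((τ g)⁻¹ : Circle) • α.act g b) =
      ((τ (h * g))⁻¹ : Circle) • α.act (h * g) b
    rw [Circle.smul_def, Circle.smul_def, map_smul, smul_smul, α.act_mul, map_mul, mul_inv,
      Circle.coe_mul, Circle.coe_inv, Circle.coe_inv]
  rw [mean_smul, inv_smul_eq_iff₀ (Circle.coe_ne_zero _)] at h2
  exact h1.trans h2

theorem proj_of_mem {τ : PontryaginDual G} {b : B} (hb : b ∈ spectralSubspace α.toFun τ) :
    α.proj τ b = b := by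
  have : α.twist τ b = ContinuousMap.const G b := ContinuousMap.ext fun g => by
    change ((τ g)⁻¹ : Circle) • α.act g b = b
    rw [show α.act g b = _ from hb g, ← Circle.smul_def, inv_smul_smul]
  rw [proj, this, mean_const]

/-- Since α_g(b) = τ(g) b, the averaging of α_g(ab) leaves b untouched and integrates τ(g) α_g(a),
which picks the τ⁻¹-part of a. -/
theorem proj_one_mul {τ : PontryaginDual G} (a : B) {b : B}
    (hb : b ∈ spectralSubspace α.toFun τ) : α.proj 1 (a * b) = α.proj τ⁻¹ a * b := by
  refine (map_mean ((ContinuousLinearMap.mul ℂ B).flip b) fun g => ?_).symm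
  change ((1 : Circle)⁻¹ : Circle) • α.act g (a * b) = ((τ g)⁻¹⁻¹ : Circle) • α.act g a * b
  rw [inv_one, one_smul, inv_inv, map_mul, show α.act g b = _ from hb g, mul_smul_comm,
    smul_mul_assoc, Circle.smul_def]

/-- Averaging commutes with an equivariant map, so the spectral projection of an arbitrary preimage
is still a preimage. -/
theorem exists_lift {R : Type*} [NormedRing R] [NormedAlgebra ℂ R] [StarRing R] [CompleteSpace R]
    (β : ContinuousAction G R) (π : R →L[ℂ] B) (hπ : Function.Surjective π)
    (heq : ∀ g r, π (β.act g r) = α.act g (π r)) {τ : PontryaginDual G} {b : B}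
    (hb : b ∈ spectralSubspace α.toFun τ) : ∃ r ∈ spectralSubspace β.toFun τ, π r = b := by
  obtain ⟨r, rfl⟩ := hπ b
  refine ⟨β.proj τ r, β.proj_mem τ r, ?_⟩
  rw [proj, map_mean π (F' := α.twist τ (π r)) fun g => ?_]
  · exact α.proj_of_mem hb
  · change _ = π (((τ g)⁻¹ : Circle) • β.act g r)
    rw [Circle.smul_def, map_smul, heq]
    rfl

/-- The projection onto the fixed-point algebra as a continuous linear map. -/
def projOneCLM : B →L[ℂ] B :=
  LinearMap.mkContinuous
    { toFun := α.proj 1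
      map_add' := fun a b => by
        rw [proj, proj, proj, ← mean_add]
        congr 1
        ext g
        change ((1 : Circle)⁻¹ : Circle) • α.act g (a + b) =
          ((1 : Circle)⁻¹ : Circle) • α.act g a + ((1 : Circle)⁻¹ : Circle) • α.act g b
        rw [map_add, smul_add]
      map_smul' := fun c b => by
        rw [proj, proj, RingHom.id_apply, ← mean_smul]
        congr 1
        ext g
        change ((1 : Circle)⁻¹ : Circle) • α.act g (c • b) =
          c • (((1 : Circle)⁻¹ : Circle) • α.act g b)
        rw [map_smul, smul_comm] } 1 fun b => by
    rw [one_mul]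
    refine (norm_mean_le _).trans ((ContinuousMap.norm_le _ (norm_nonneg b)).2 fun g => ?_)
    change ‖((1 : Circle)⁻¹ : Circle) • α.act g b‖ ≤ _
    rw [inv_one, one_smul]
    exact α.norm_act_le g b

/-- Freeness approximates g ↦ τ(g) 1 by combinations of g ↦ a α_g(b). A bounded linear map that
sends the former to 1 and the latter to products of spectral elements carries the approximation over
to B. -/
theorem one_mem_closure_of_free (hfree : IsFreeAction α.toFun) (τ : PontryaginDual G) :
    (1 : B) ∈ (Submodule.span ℂ {x | ∃ a ∈ spectralSubspace α.toFun τ⁻¹,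
      ∃ b ∈ spectralSubspace α.toFun τ, x = a * b}).topologicalClosure := by
  let m : C(G, B) →L[ℂ] C(G, B) := LinearMap.mkContinuous
    { toFun := fun F => ⟨fun g => ((τ g)⁻¹ : Circle) • F g,
        (map_continuous τ).inv.smul F.continuous⟩
      map_add' := fun F F' => by ext g; exact smul_add _ _ _
      map_smul' := fun c F => by ext g; exact smul_comm _ _ _ } 1 fun F => by
    rw [one_mul]
    refine (ContinuousMap.norm_le _ (norm_nonneg F)).2 fun g => ?_
    change ‖((τ g)⁻¹ : Circle) • F g‖ ≤ ‖F‖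
    rw [Circle.smul_def, norm_smul, Circle.norm_coe, one_mul]
    exact F.norm_coe_le_norm g
  -- Integrating F against τ⁻¹ projects b onto degree τ; the outer projection onto fixed points then
  -- forces a into degree τ⁻¹.
  let Λ : C(G, B) →L[ℂ] B := α.projOneCLM.comp ((meanCLM G B).comp m)
  let F₀ : C(G, B) := ⟨fun g => (τ g : Circle) • (1 : B), (map_continuous τ).smul continuous_const⟩
  have h0 : Λ F₀ = 1 := by
    have h1 : m F₀ = ContinuousMap.const G 1 := by
      ext g
      exact inv_smul_smul (τ g) (1 : B)
    change α.proj 1 (mean (m F₀)) = 1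
    rw [h1, mean_const]
    exact α.proj_of_mem (α.mem_spectralSubspace_one.2 fun g => map_one _)
  rw [← h0]
  refine map_mem_closure Λ.continuous (hfree F₀) fun F hF => ?_
  change Λ F ∈ Submodule.span ℂ _
  induction hF using Submodule.span_induction with
  | mem F hF =>
    obtain ⟨a, b, hF⟩ := hF
    have h1 : mean (m F) = a * α.proj τ b := by
      refine (map_mean (ContinuousLinearMap.mul ℂ B a) fun g => ?_).symm
      change ((τ g)⁻¹ : Circle) • F g = a * ((τ g)⁻¹ : Circle) • α.act g b
      rw [hF g, mul_smul_comm]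
    refine Submodule.subset_span ⟨α.proj τ⁻¹ a, α.proj_mem _ _, α.proj τ b, α.proj_mem _ _, ?_⟩
    change α.proj 1 (mean (m F)) = _
    rw [h1, α.proj_one_mul a (α.proj_mem τ b)]
  | zero => rw [map_zero]; exact Submodule.zero_mem _
  | add x y _ _ hx hy => rw [map_add]; exact Submodule.add_mem _ hx hy
  | smul c x _ hx => rw [map_smul]; exact Submodule.smul_mem _ _ hx

/-- Free actions of compact abelian groups are saturated. -/
theorem saturated_of_free [StarModule ℂ B] (hfree : IsFreeAction α.toFun) :
    IsSaturatedAction α.toFun := fun τ b hb => by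
  have h1 := α.one_mem_closure_of_free hfree τ
  rw [← mul_one b]
  refine map_mem_closure (ContinuousLinearMap.mul ℂ B b).continuous h1 fun x hx => ?_
  change b * x ∈ Submodule.span ℂ _
  induction hx using Submodule.span_induction with
  | mem x hx =>
    obtain ⟨a, ha, c, hc, rfl⟩ := hx
    -- As b is fixed, ba has degree τ⁻¹, so its adjoint has degree τ and can serve as the left entry
    -- of B_τ⋆ B_τ.
    refine Submodule.subset_span ⟨star (b * a), ?_, c, hc, by rw [star_star, mul_assoc]⟩
    have h2 := α.star_mem_spectralSubspace
      (α.mul_mem_spectralSubspace (α.mem_spectralSubspace_one.2 hb) ha)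
    rwa [one_mul, inv_inv] at h2
  | zero => rw [mul_zero]; exact Submodule.zero_mem _
  | add x y _ _ hx hy => rw [mul_add]; exact Submodule.add_mem _ hx hy
  | smul c x _ hx => rw [mul_smul_comm]; exact Submodule.smul_mem _ _ hx

end ContinuousAction

end Spectral

/-! ### Freeness of circle actions -/

section Density

variable {X : Type*} [TopologicalSpace X] [CompactSpace X] [T2Space X]
  {B : Type*} [NormedAddCommGroup B] [NormedSpace ℂ B]

/-- Functions of the form `x ↦ f(x) b` span a dense subspace of `C(X, B)`. -/
theorem mem_topologicalClosure_of_elementary (M : Submodule ℂ C(X, B))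
    (hM : ∀ (f : C(X, ℂ)) (b : B), ∃ F ∈ M.topologicalClosure, ∀ x, F x = f x • b) (F : C(X, B)) :
    F ∈ M.topologicalClosure := by
  suffices h : F ∈ closure (M.topologicalClosure : Set C(X, B)) by
    rwa [M.isClosed_topologicalClosure.closure_eq] at h
  rw [Metric.mem_closure_iff]
  intro ε hε
  -- A partition of unity subordinate to sets on which F varies by less than ε/2 approximates F by ∑
  -- fᵢ F(xᵢ). The spare half of ε makes up for the supremum bound, which is not strict.
  let U : X → Set X := fun x => {y | ‖F y - F x‖ < ε / 2}
  have hU : ∀ x, IsOpen (U x) := fun x => isOpen_lt (by fun_prop) continuous_const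
  obtain ⟨t, ht⟩ := isCompact_univ.elim_finite_subcover U hU fun x _ =>
    Set.mem_iUnion.2 ⟨x, by simpa [U] using hε⟩
  obtain ⟨f, hf⟩ := PartitionOfUnity.exists_isSubordinate isClosed_univ (fun i : t => U i)
    (fun i => hU i) fun x hx => by simpa using ht hx
  let g : t → C(X, ℂ) := fun i => ⟨fun x => (f i x : ℂ), by fun_prop⟩
  choose H hHM hH using fun i : t => hM (g i) (F i)
  refine ⟨∑ i, H i, Submodule.sum_mem _ fun i _ => hHM i, ?_⟩
  rw [dist_eq_norm]
  refine lt_of_le_of_lt ((ContinuousMap.norm_le _ (half_pos hε).le).2 fun x => ?_) (half_lt_self hε)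
  have h1 : ∑ i, f i x = 1 := by
    rw [← finsum_eq_sum_of_fintype]
    exact f.sum_eq_one (Set.mem_univ x)
  have h2 : (F - ∑ i, H i) x = ∑ i, (f i x) • (F x - F i) := by
    simp only [smul_sub, Finset.sum_sub_distrib, ← Finset.sum_smul, h1, one_smul]
    simp [hH, g]
  rw [h2]
  refine (norm_sum_le _ _).trans ?_
  calc ∑ i, ‖(f i x) • (F x - F i)‖ ≤ ∑ i, f i x * (ε / 2) := by
        refine Finset.sum_le_sum fun i _ => ?_
        rw [norm_smul, Real.norm_of_nonneg (f.nonneg i x)]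
        by_cases h0 : f i x = 0
        · simp [h0]
        · refine mul_le_mul_of_nonneg_left ?_ (f.nonneg i x)
          have h3 : x ∈ U i := hf i (subset_closure h0)
          exact le_of_lt h3
    _ = ε / 2 := by rw [← Finset.sum_mul, h1, one_mul]

end Density

/-! ### Trigonometric polynomials on the circle. -/

/-- The character `z ↦ zⁿ` of the circle. -/
def circleChar (n : ℤ) : PontryaginDual Circle :=
  (⟨⟨⟨fun z => z ^ n, one_zpow n⟩, fun z w => mul_zpow z w n⟩, continuous_zpow n⟩ :
    Circle →ₜ* Circle)

theorem circleChar_apply (n : ℤ) (z : Circle) : circleChar n z = z ^ n := rfl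

/-- The trigonometric polynomials are dense in `C(Circle, ℂ)`. -/
theorem span_circleChar_dense (f : C(Circle, ℂ)) :
    f ∈ (Submodule.span ℂ
      {f : C(Circle, ℂ) | ∃ n : ℤ, ∀ z, f z = (circleChar n z : ℂ)}).topologicalClosure := by
  have _ : Fact (0 < 2 * Real.pi) := ⟨Real.two_pi_pos⟩
  -- Density of the Fourier monomials is known on the additive circle and is transported along this
  -- homeomorphism.
  let e : AddCircle (2 * Real.pi) ≃ₜ Circle := AddCircle.homeomorphCircle Real.two_pi_pos.ne'
  let Φ : C(AddCircle (2 * Real.pi), ℂ) →L[ℂ] C(Circle, ℂ) :=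
    LinearMap.mkContinuous
      { toFun := fun g => g.comp ⟨e.symm, e.symm.continuous⟩
        map_add' := fun _ _ => rfl
        map_smul' := fun _ _ => rfl } 1 fun g => by
      rw [one_mul]
      exact (ContinuousMap.norm_le _ (norm_nonneg g)).2 fun z => g.norm_coe_le_norm _
  have h0 : f = Φ (f.comp ⟨e, e.continuous⟩) := by
    ext z
    exact (congrArg f (e.apply_symm_apply z)).symm
  have h1 : f.comp ⟨e, e.continuous⟩ ∈
      (Submodule.span ℂ (Set.range (@fourier (2 * Real.pi)))).topologicalClosure := by
    rw [span_fourier_closure_eq_top]; trivial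
  rw [h0]
  refine map_mem_closure Φ.continuous h1 fun g hg => ?_
  change Φ g ∈ Submodule.span ℂ _
  induction hg using Submodule.span_induction with
  | mem g hg =>
    obtain ⟨n, rfl⟩ := hg
    refine Submodule.subset_span ⟨n, fun z => ?_⟩
    obtain ⟨x, rfl⟩ := e.surjective z
    change fourier n (e.symm (e x)) = _
    rw [e.symm_apply_apply, fourier_apply, AddCircle.toCircle_zsmul, circleChar_apply,
      AddCircle.homeomorphCircle_apply]
  | zero => rw [map_zero]; exact Submodule.zero_mem _
  | add x y _ _ hx hy => rw [map_add]; exact Submodule.add_mem _ hx hy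
  | smul c x _ hx => rw [map_smul]; exact Submodule.smul_mem _ _ hx

/-! ### A criterion for freeness of circle actions. -/

namespace ContinuousAction

variable {B : Type*} [NormedRing B] [NormedAlgebra ℂ B] [StarRing B]

/-- A circle action is free if `B Bₙ` spans a subspace with `1` in its closure, for all `n`. -/
theorem free_of_one_mem_closure (α : ContinuousAction Circle B)
    (h : ∀ n : ℤ, (1 : B) ∈ (Submodule.span ℂ {x | ∃ a,
      ∃ b ∈ spectralSubspace α.toFun (circleChar n), x = a * b}).topologicalClosure) :
    IsFreeAction α.toFun := by
  intro F
  refine mem_topologicalClosure_of_elementary _ (fun f b => ?_) F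
  let Ψ : B → C(Circle, ℂ) →L[ℂ] C(Circle, B) := fun b => LinearMap.mkContinuous
    { toFun := fun f => ⟨fun z => f z • b, by fun_prop⟩
      map_add' := fun f f' => by ext z; exact add_smul _ _ _
      map_smul' := fun c f => by ext z; exact mul_smul _ _ _ } ‖b‖ fun f => by
    refine (ContinuousMap.norm_le _ (by positivity)).2 fun z => ?_
    change ‖f z • b‖ ≤ _
    rw [norm_smul, mul_comm]
    gcongr
    exact f.norm_coe_le_norm z
  refine ⟨Ψ b f, ?_, fun z => rfl⟩
  set M := Submodule.span ℂ {F : C(Circle, B) | ∃ a b : B, ∀ g, F g = a * α.toFun g b}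
  -- The target is closed twice: f is a limit of trigonometric polynomials, and each z ↦ zⁿ b is in
  -- turn only a limit of elements of M.
  rw [← SetLike.mem_coe, Submodule.topologicalClosure_coe, ← closure_closure,
    ← Submodule.topologicalClosure_coe]
  refine map_mem_closure (Ψ b).continuous (span_circleChar_dense f) fun g hg => ?_
  change Ψ b g ∈ M.topologicalClosure
  induction hg using Submodule.span_induction with
  | mem g hg =>
    obtain ⟨n, hn⟩ := hg
    -- Here Θ(x) is z ↦ zⁿ bx. If c has degree n, then Θ(ac) is z ↦ (ba) α_z(c), an elementary
    -- function; approximating 1 by sums of such ac approximates Θ(1) = zⁿ b.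
    let Θ : B →L[ℂ] C(Circle, B) := LinearMap.mkContinuous
      { toFun := fun x => Ψ (b * x) g
        map_add' := fun x y => by
          ext z
          change g z • (b * (x + y)) = g z • (b * x) + g z • (b * y)
          rw [mul_add, smul_add]
        map_smul' := fun c x => by
          ext z
          change g z • (b * (c • x)) = c • (g z • (b * x))
          rw [mul_smul_comm, smul_comm] } ‖b‖ fun x => by
      refine (ContinuousMap.norm_le _ (by positivity)).2 fun z => ?_
      change ‖g z • (b * x)‖ ≤ _
      rw [norm_smul, hn, Circle.norm_coe, one_mul]
      exact norm_mul_le _ _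
    have h1 : Ψ b g = Θ 1 := by
      change _ = Ψ (b * 1) g
      rw [mul_one]
    rw [h1]
    refine map_mem_closure Θ.continuous (h n) fun x hx => ?_
    change Θ x ∈ M
    induction hx using Submodule.span_induction with
    | mem x hx =>
      obtain ⟨a, c, hc, rfl⟩ := hx
      refine Submodule.subset_span ⟨b * a, c, fun z => ?_⟩
      change g z • (b * (a * c)) = b * a * α.toFun z c
      rw [hc z, hn, mul_smul_comm, mul_assoc]
    | zero => rw [map_zero]; exact Submodule.zero_mem _
    | add x y _ _ hx hy => rw [map_add]; exact Submodule.add_mem _ hx hy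
    | smul c x _ hx => rw [map_smul]; exact Submodule.smul_mem _ _ hx
  | zero => rw [map_zero]; exact Submodule.zero_mem _
  | add x y _ _ hx hy => rw [map_add]; exact Submodule.add_mem _ hx hy
  | smul c x _ hx => rw [map_smul]; exact Submodule.smul_mem _ _ hx

end ContinuousAction

/-! ### Compact operators and finite generation -/

section Compact

variable {A E : Type*} [CStarAlgebra A] [PartialOrder A] [StarOrderedRing A]
  [NormedAddCommGroup E] [NormedSpace ℂ E] [SMul Aᵐᵒᵖ E] [CStarModule Aᵐᵒᵖ E]

/-- Module linearity is automatic: move the operator to the other side of the inner product, pull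
out a, and move it back. -/
theorem Adjointable.map_op_smul (T : Adjointable A E) (a : Aᵐᵒᵖ) (x : E) : T (a • x) = a • T x :=
  ext_inner (A := A) fun z => by
    rw [← star_star T, ← Adjointable.inner_left, CStarModule.inner_op_smul_right,
      CStarModule.inner_op_smul_right, Adjointable.inner_left]

theorem Adjointable.mul_apply (S T : Adjointable A E) (x : E) : (S * T) x = S (T x) := by
  rw [map_mul]
  rfl

theorem Adjointable.norm_apply_le (T : Adjointable A E) (x : E) : ‖T x‖ ≤ ‖T‖ * ‖x‖ :=
  (Adjointable.toCLM T).le_opNorm x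

theorem rankOne_apply (e f x : E) : rankOne A e f x = op (braket A f x) • e := rfl

theorem mul_rankOne (T : Adjointable A E) (e f : E) : T * rankOne A e f = rankOne A (T e) f :=
  Adjointable.ext fun x => by
    rw [Adjointable.mul_apply, rankOne_apply, rankOne_apply, Adjointable.map_op_smul]

theorem mul_mem_compactOperators (T : Adjointable A E) {k : Adjointable A E}
    (hk : k ∈ compactOperators A E) : T * k ∈ compactOperators A E := by
  refine map_mem_closure (continuous_const_mul T) hk fun q hq => ?_
  change T * q ∈ Submodule.span ℂ _
  induction hq using Submodule.span_induction with
  | mem q hq =>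
    obtain ⟨e, f, rfl⟩ := hq
    exact Submodule.subset_span ⟨T e, f, mul_rankOne T e f⟩
  | zero => rw [mul_zero]; exact Submodule.zero_mem _
  | add x y _ _ hx hy => rw [mul_add]; exact Submodule.add_mem _ hx hy
  | smul c x _ hx => rw [mul_smul_comm]; exact Submodule.smul_mem _ _ hx

/-! ### The ideal J_E. -/

section Katsura

variable [CompleteSpace E] (φ : A →⋆ₐ[ℂ] Adjointable A E)

/-- The ideal `J_E` as a subspace of `A`. -/
def katsuraSubmodule : Submodule ℂ A where
  carrier := katsuraIdeal φ
  add_mem' {a b} ha hb := by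
    refine ⟨fun c hc => ?_, ?_⟩
    · rw [add_mul, mul_add, (ha.1 c hc).1, (ha.1 c hc).2, (hb.1 c hc).1, (hb.1 c hc).2]
      simp
    · rw [map_add]
      exact Submodule.add_mem _ ha.2 hb.2
  zero_mem' := ⟨fun c _ => by simp, by rw [map_zero]; exact Submodule.zero_mem _⟩
  smul_mem' z a ha := by
    refine ⟨fun c hc => ?_, ?_⟩
    · rw [smul_mul_assoc, mul_smul_comm, (ha.1 c hc).1, (ha.1 c hc).2]
      simp
    · rw [map_smul]
      exact Submodule.smul_mem _ _ ha.2

theorem isClosed_katsuraIdeal : IsClosed (katsuraIdeal φ) := by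
  have hφ : Continuous φ := map_continuous φ
  have h : katsuraIdeal φ = (⋂ b : {b // φ b = 0}, {a | a * b.1 = 0 ∧ b.1 * a = 0}) ∩
      φ ⁻¹' compactOperators A E := by
    ext a
    simp [katsuraIdeal]
  rw [h]
  refine (isClosed_iInter fun b => ?_).inter
    ((Submodule.isClosed_topologicalClosure _).preimage hφ)
  exact (isClosed_eq (continuous_mul_const b.1) continuous_const).inter
    (isClosed_eq (continuous_const_mul b.1) continuous_const)

theorem mul_mem_katsuraIdeal (c : A) {a : A} (ha : a ∈ katsuraIdeal φ) :
    c * a ∈ katsuraIdeal φ := by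
  refine ⟨fun b hb => ⟨?_, ?_⟩, ?_⟩
  · rw [mul_assoc, (ha.1 b hb).1, mul_zero]
  · rw [← mul_assoc]
    -- The kernel of φ is an ideal, so the factor c is absorbed into b.
    exact (ha.1 (b * c) (by rw [map_mul, hb, zero_mul])).2
  · rw [map_mul]
    exact mul_mem_compactOperators _ ha.2

theorem mem_katsuraIdeal_mul (c : A) {a : A} (ha : a ∈ katsuraIdeal φ) :
    a * c ∈ katsuraIdeal φ := by
  rw [← star_star (a * c), star_mul]
  exact star_mem_katsuraIdeal φ (mul_mem_katsuraIdeal φ _ (star_mem_katsuraIdeal φ ha))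

theorem injective_of_one_mem_katsuraIdeal (h : (1 : A) ∈ katsuraIdeal φ) : Function.Injective φ :=
  (injective_iff_map_eq_zero φ).2 fun b hb => by rw [← one_mul b, (h.1 b hb).1]

theorem one_mem_compactOperators (h : (1 : A) ∈ katsuraIdeal φ) :
    (1 : Adjointable A E) ∈ compactOperators A E := by
  rw [← map_one φ]
  exact h.2

end Katsura

end Compact

/-! ### Finite generation and compactness of the identity. -/

section FiniteGeneration

variable {A E : Type*} [CStarAlgebra A] [PartialOrder A] [StarOrderedRing A]
  [NormedAddCommGroup E] [NormedSpace ℂ E] [Module Aᵐᵒᵖ E] [CStarModule Aᵐᵒᵖ E] [CompleteSpace E]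

theorem isUnit_of_one_sub_norm_lt {R : Type*} [NormedRing R] [CompleteSpace R] {u : R}
    (h : ‖1 - u‖ < 1) : IsUnit u := by
  have := isUnit_one_sub_of_norm_lt_one h
  rwa [sub_sub_cancel] at this

/-- The range of a combination of rank-one operators lies in a finitely generated submodule. -/
theorem exists_finset_forall_mem_span {u : Adjointable A E}
    (hu : u ∈ Submodule.span ℂ {T : Adjointable A E | ∃ e f : E, T = rankOne A e f}) :
    ∃ s : Finset E, ∀ x, u x ∈ Submodule.span Aᵐᵒᵖ (s : Set E) := by
  classical
  induction hu using Submodule.span_induction with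
  | mem u hu =>
    obtain ⟨e, f, rfl⟩ := hu
    exact ⟨{e}, fun x => Submodule.smul_mem _ _ (Submodule.subset_span (by simp))⟩
  | zero => exact ⟨∅, fun x => by rw [map_zero]; exact Submodule.zero_mem _⟩
  | add u v _ _ hu hv =>
    obtain ⟨s, hs⟩ := hu
    obtain ⟨t, ht⟩ := hv
    refine ⟨s ∪ t, fun x => ?_⟩
    rw [map_add]
    exact Submodule.add_mem _ (Submodule.span_mono (by simp) (hs x))
      (Submodule.span_mono (by simp) (ht x))
  | smul c u _ hu =>
    obtain ⟨s, hs⟩ := hu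
    refine ⟨s, fun x => ?_⟩
    -- The span is taken over `Aᵐᵒᵖ`, so the complex scalar is moved into the argument of u instead
    -- of being taken out of the span.
    have h1 : Adjointable.toCLM (c • u) x = Adjointable.toCLM u (c • x) := by
      rw [map_smul, map_smul]
      rfl
    rw [h1]
    exact hs _

/-- A combination of rank-one operators at distance less than 1 from the identity is invertible. It
is therefore surjective, while its range lies in a finitely generated submodule. -/
theorem finite_of_one_mem_compactOperators (h : (1 : Adjointable A E) ∈ compactOperators A E) :
    Module.Finite Aᵐᵒᵖ E := by
  obtain ⟨u, hu, hd⟩ := Metric.mem_closure_iff.1 h 1 one_pos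
  rw [dist_eq_norm] at hd
  obtain ⟨v, hv⟩ := (isUnit_of_one_sub_norm_lt hd).exists_right_inv
  obtain ⟨s, hs⟩ := exists_finset_forall_mem_span hu
  refine ⟨⟨s, eq_top_iff.2 fun x _ => ?_⟩⟩
  have h1 : x = u (v x) := by
    rw [← Adjointable.mul_apply, hv, map_one]
    rfl
  rw [h1]
  exact hs _

/-- A self-adjoint operator that is bounded below is invertible. -/
theorem isUnit_of_boundedBelow {S : Adjointable A E} (hS : IsSelfAdjoint S) {c : ℝ} (hc : 0 < c)
    (h : ∀ x, ‖x‖ ≤ c * ‖S x‖) : IsUnit S := by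
  -- A nonzero imaginary number is off the spectrum of S, so w - S has an inverse R. The modulus
  -- 1/(2c) is small enough for S to be recovered as a perturbation of S - w.
  set w : ℂ := ((2 * c)⁻¹ : ℝ) * Complex.I with hw
  have hwn : ‖w‖ = (2 * c)⁻¹ := by simp [hw, abs_of_pos hc]
  have hu : IsUnit (algebraMap ℂ (Adjointable A E) w - S) := by
    by_contra hn
    have h1 := hS.im_eq_zero_of_mem_spectrum (show w ∈ spectrum ℂ S from hn)
    simp [hw, hc.ne'] at h1
  obtain ⟨R, hR, hR'⟩ : ∃ R, (algebraMap ℂ (Adjointable A E) w - S) * R = 1 ∧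
      R * (algebraMap ℂ (Adjointable A E) w - S) = 1 :=
    ⟨(hu.unit⁻¹ : (Adjointable A E)ˣ), hu.mul_val_inv, hu.val_inv_mul⟩
  -- The cross terms of (w - S)⋆(w - S) cancel, leaving S² + |w|². This bounds R by c, uniformly in
  -- the choice of w.
  have hlow : ∀ x, ‖S x‖ ≤ ‖(algebraMap ℂ (Adjointable A E) w - S) x‖ := fun x => by
    have hww : star w = -w := by simp [hw]
    have h1 : star (algebraMap ℂ (Adjointable A E) w - S) * (algebraMap ℂ (Adjointable A E) w - S) =
        S * S + algebraMap ℂ (Adjointable A E) (star w * w) := by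
      rw [star_sub, hS.star_eq, ← algebraMap_star_comm, hww, map_neg, neg_mul, map_neg,
        map_mul _ w w, sub_mul, mul_sub, mul_sub, neg_mul, neg_mul, Algebra.commutes w S]
      abel
    have h2 : braket A ((algebraMap ℂ (Adjointable A E) w - S) x)
        ((algebraMap ℂ (Adjointable A E) w - S) x) = braket A (S x) (S x) +
          braket A (w • x) (w • x) := by
      rw [braket_apply_left, ← Adjointable.mul_apply, h1, braket_apply_left S, hS.star_eq,
        ← Adjointable.mul_apply, map_add, AlgHomClass.commutes]
      simp [braket, smul_smul, mul_comm, Algebra.algebraMap_eq_smul_one]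
    have h3 := CStarAlgebra.norm_le_norm_of_nonneg_of_le (braket_self_nonneg (A := A) (S x))
      (le_add_of_nonneg_right (a := braket A (S x) (S x)) (braket_self_nonneg (A := A) (w • x)))
    rw [← h2] at h3
    refine le_of_sq_le_sq ?_ (norm_nonneg _)
    rw [CStarModule.norm_sq_eq Aᵐᵒᵖ, CStarModule.norm_sq_eq Aᵐᵒᵖ]
    exact h3
  have hRn : ‖R‖ ≤ c := by
    refine (Adjointable.toCLM R).opNorm_le_bound hc.le fun x => (h _).trans ?_
    refine mul_le_mul_of_nonneg_left ((hlow _).trans ?_) hc.le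
    rw [← Adjointable.mul_apply, hR, map_one]
    exact le_rfl
  -- Since ‖wR‖ ≤ 1/2, the product SR is invertible, and S = (SR)(w - S) is a product of units.
  have h2 : -(S * R) = 1 - w • R := by
    rw [← hR, sub_mul, Algebra.algebraMap_eq_smul_one, smul_mul_assoc, one_mul]
    abel
  have h3 : IsUnit (1 - w • R) := by
    refine isUnit_one_sub_of_norm_lt_one ?_
    rw [norm_smul, hwn]
    calc (2 * c)⁻¹ * ‖R‖ ≤ (2 * c)⁻¹ * c := by gcongr
      _ < 1 := by field_simp; norm_num
  have h4 : S = -(-(S * R)) * (algebraMap ℂ (Adjointable A E) w - S) := by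
    rw [neg_neg, mul_assoc, hR', mul_one]
  rw [h4, h2]
  exact h3.neg.mul hu

/-- For generators eᵢ, the frame operator S = ∑ |eᵢ⟩⟨eᵢ| is invertible, because the open mapping
theorem for the surjection Aⁿ → E bounds it below. Then 1 = S⁻¹S = ∑ |S⁻¹eᵢ⟩⟨eᵢ|. -/
theorem exists_one_eq_sum_rankOne [Module.Finite Aᵐᵒᵖ E] :
    ∃ (n : ℕ) (e f : Fin n → E), (1 : Adjointable A E) = ∑ i, rankOne A (e i) (f i) := by
  obtain ⟨n, e, he⟩ := Module.Finite.exists_fin (R := Aᵐᵒᵖ) (M := E)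
  let T : (Fin n → A) →L[ℂ] E := LinearMap.mkContinuous
    { toFun := fun a => ∑ i, op (a i) • e i
      map_add' := fun a b => by simp [add_smul, Finset.sum_add_distrib]
      map_smul' := fun c a => ext_inner (A := A) fun z => by
        simp [CStarModule.inner_sum_right, Finset.smul_sum] } (∑ i, ‖e i‖) fun a => by
    rw [Finset.sum_mul]
    change ‖∑ i, op (a i) • e i‖ ≤ _
    refine norm_sum_le_of_le _ fun i _ =>
      (op_smul_norm_le _ _).trans ?_
    rw [mul_comm]
    exact mul_le_mul_of_nonneg_left (norm_le_pi_norm a i) (norm_nonneg _)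
  have hT : Function.Surjective T := fun x => by
    have hx : x ∈ Submodule.span Aᵐᵒᵖ (Set.range e) := he ▸ Submodule.mem_top
    obtain ⟨a, ha⟩ := (Submodule.mem_span_range_iff_exists_fun _).1 hx
    exact ⟨fun i => unop (a i), ha⟩
  obtain ⟨C, hC, hpre⟩ := T.exists_preimage_norm_le hT
  set S : Adjointable A E := ∑ i, rankOne A (e i) (e i) with hS
  have hSs : IsSelfAdjoint S := by
    rw [IsSelfAdjoint, hS, star_sum]
    simp only [star_rankOne]
  have hSx : ∀ x, braket A x (S x) = ∑ i, star (braket A (e i) x) * braket A (e i) x := fun x => by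
    have : Adjointable.toCLM S x = ∑ i, op (braket A (e i) x) • e i := by
      rw [hS, map_sum, sum_apply]
      rfl
    rw [this]
    simp only [star_braket]
    simp [braket, CStarModule.inner_sum_right]
  -- Write x = ∑ eᵢ aᵢ with ‖a‖ ≤ C‖x‖. Each ‖⟨x|eᵢ⟩‖² is at most ‖⟨x|Sx⟩‖ ≤ ‖x‖‖Sx‖, so expanding
  -- ⟨x|x⟩ gives ‖x‖ ≤ (nC)²‖Sx‖. The added 1 keeps the constant positive when n = 0.
  have hbelow : ∀ x, ‖x‖ ≤ ((n * C) ^ 2 + 1) * ‖S x‖ := fun x => by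
    obtain ⟨a, hax, han⟩ := hpre x
    have h1 : ∀ i, ‖braket A x (e i)‖ ≤ √(‖x‖ * ‖S x‖) := fun i => by
      refine Real.le_sqrt_of_sq_le ?_
      have h2 : star (braket A (e i) x) * braket A (e i) x ≤ braket A x (S x) := by
        rw [hSx]
        exact Finset.single_le_sum (f := fun i => star (braket A (e i) x) * braket A (e i) x)
          (fun i _ => star_mul_self_nonneg _) (Finset.mem_univ i)
      have h3 := CStarAlgebra.norm_le_norm_of_nonneg_of_le (star_mul_self_nonneg _) h2
      rw [CStarRing.norm_star_mul_self, ← norm_star, star_braket, ← sq] at h3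
      exact h3.trans (CStarModule.norm_inner_le (A := Aᵐᵒᵖ) E)
    have h2 : braket A x x = ∑ i, braket A x (e i) * a i := by
      nth_rw 2 [← hax]
      simp [T, braket, CStarModule.inner_sum_right]
    have h3 : ‖x‖ * ‖x‖ ≤ ‖x‖ * (n * C * √(‖x‖ * ‖S x‖)) := by
      calc ‖x‖ * ‖x‖ = ‖braket A x x‖ := by rw [← sq]; exact CStarModule.norm_sq_eq Aᵐᵒᵖ
        _ ≤ ∑ _i : Fin n, √(‖x‖ * ‖S x‖) * (C * ‖x‖) := by
          rw [h2]
          refine norm_sum_le_of_le _ fun i _ => (norm_mul_le _ _).trans ?_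
          gcongr
          · exact h1 i
          · exact (norm_le_pi_norm a i).trans han
        _ = _ := by
          rw [Finset.sum_const, Finset.card_univ, Fintype.card_fin, nsmul_eq_mul]
          ring
    rcases (norm_nonneg x).eq_or_lt' with h0 | h0
    · rw [h0]
      positivity
    have h4 := le_of_mul_le_mul_left h3 h0
    have h5 : ‖x‖ * ‖x‖ ≤ ‖x‖ * ((n * C) ^ 2 * ‖S x‖) := by
      calc ‖x‖ * ‖x‖ ≤ (n * C * √(‖x‖ * ‖S x‖)) * (n * C * √(‖x‖ * ‖S x‖)) := by gcongr
        _ = (n * C) ^ 2 * (√(‖x‖ * ‖S x‖) * √(‖x‖ * ‖S x‖)) := by ring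
        _ = _ := by rw [Real.mul_self_sqrt (by positivity)]; ring
    refine (le_of_mul_le_mul_left h5 h0).trans ?_
    gcongr
    linarith
  obtain ⟨R, hR⟩ := (isUnit_of_boundedBelow hSs (by positivity) hbelow).exists_left_inv
  refine ⟨n, fun i => R (e i), e, ?_⟩
  rw [← hR, hS, Finset.mul_sum]
  simp only [mul_rankOne]

end FiniteGeneration

/-! ### Relations between operators on the Fock space -/

theorem braket_sub_right {A E : Type*} [CStarAlgebra A] [PartialOrder A] [StarOrderedRing A]
    [NormedAddCommGroup E] [NormedSpace ℂ E] [SMul Aᵐᵒᵖ E] [CStarModule Aᵐᵒᵖ E] (x y z : E) :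
    braket A x (y - z) = braket A x y - braket A x z := by
  simp [braket]

theorem eq_zero_of_braket_self {A E : Type*} [CStarAlgebra A] [PartialOrder A] [StarOrderedRing A]
    [NormedAddCommGroup E] [NormedSpace ℂ E] [SMul Aᵐᵒᵖ E] [CStarModule Aᵐᵒᵖ E] {x : E}
    (h : braket A x x = 0) : x = 0 :=
  CStarModule.inner_self.1 (unop_injective h)

theorem braket_star_apply {A E : Type*} [CStarAlgebra A] [PartialOrder A] [StarOrderedRing A]
    [NormedAddCommGroup E] [NormedSpace ℂ E] [SMul Aᵐᵒᵖ E] [CStarModule Aᵐᵒᵖ E]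
    (T : Adjointable A E) (x y : E) : braket A x (star T y) = braket A (T x) y :=
  (braket_apply_left T x y).symm

namespace Fock

open UniformSpace PreFock

section Relations

variable {A E : Type*} [CStarAlgebra A] [PartialOrder A] [StarOrderedRing A]
  [NormedAddCommGroup E] [NormedSpace ℂ E] [SMul Aᵐᵒᵖ E] [CStarModule Aᵐᵒᵖ E]
  {φ : A →⋆ₐ[ℂ] Adjointable A E}

variable (φ) in
/-- An elementary tensor as an element of the Fock space. -/
def ket (p : Word A E) : Fock φ := ((tensor p : PreFock φ) : Fock φ)

theorem braket_ket (p q : Word A E) : braket A (ket φ p) (ket φ q) = Word.kernel φ p.1 p.2 q := by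
  rw [ket, ket, braket_coe, form_tensor]

/-- A closed subspace that contains the elementary tensors is everything. -/
theorem mem_of_ket_mem (M : Submodule ℂ (Fock φ)) (hM : IsClosed (M : Set (Fock φ)))
    (h : ∀ p, ket φ p ∈ M) (x : Fock φ) : x ∈ M := by
  refine Completion.induction_on x hM fun x => ?_
  refine PreFock.induction (P := fun x => (x : Fock φ) ∈ M) x h ?_ ?_
  · intro x y hx hy
    rw [Completion.coe_add]
    exact M.add_mem hx hy
  · intro c x hx
    rw [Completion.coe_smul]
    exact M.smul_mem c hx

/-- The subspace of vectors whose inner product with `y` lies in a given subspace. -/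
def braketComap (N : Submodule ℂ A) (y : Fock φ) : Submodule ℂ (Fock φ) where
  carrier := {x | braket A y x ∈ N}
  add_mem' {x x'} hx hx' := by
    change braket A y (x + x') ∈ N
    rw [braket_add_right]
    exact N.add_mem hx hx'
  zero_mem' := by
    change braket A y (0 : Fock φ) ∈ N
    rw [braket_zero_right]
    exact N.zero_mem
  smul_mem' c x hx := by
    change braket A y (c • x) ∈ N
    rw [braket_smul_right]
    exact N.smul_mem c hx

theorem mem_braketComap {N : Submodule ℂ A} {x y : Fock φ} :
    x ∈ braketComap N y ↔ braket A y x ∈ N := Iff.rfl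

theorem isClosed_braketComap {N : Submodule ℂ A} (hN : IsClosed (N : Set A)) (y : Fock φ) :
    IsClosed (braketComap N y : Set (Fock φ)) :=
  hN.preimage (continuous_braket (f := fun _ => y) continuous_const continuous_id)

/-- Elementary tensors are multilinear only modulo null vectors. Relations in the Fock space are
therefore tested against elementary tensors, where they become identities for `Word.kernel`;
definiteness of the inner product and density finish. -/
theorem ext_ket {x y : Fock φ} (h : ∀ w, braket A (ket φ w) x = braket A (ket φ w) y) : x = y := by
  have h1 : ∀ z : Fock φ, z ∈ braketComap (⊥ : Submodule ℂ A) (x - y) :=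
    mem_of_ket_mem _ (isClosed_braketComap isClosed_singleton _) fun w => by
      rw [mem_braketComap, Submodule.mem_bot, ← star_braket]
      have h2 : braket A (ket φ w) (x - y) = 0 := by
        rw [braket_sub_right, h, sub_self]
      rw [h2, star_zero]
  exact sub_eq_zero.1 (eq_zero_of_braket_self (h1 (x - y)))

theorem left_ket (a : A) (p : Word A E) : left φ a (ket φ p) = ket φ (Word.act φ a p) := by
  rw [left, ket, operator_coe, preLeft, lift_tensor]
  rfl

theorem create_ket (e : E) (p : Word A E) :
    create φ e (ket φ p) = ket φ (e :: p.1, p.2) := by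
  rw [create, ket, operator_coe, preCreate, lift_tensor]
  rfl

theorem scale_ket (z : Circle) (p : Word A E) :
    scale φ z (ket φ p) = ((z : ℂ) ^ p.1.length) • ket φ p := by
  rw [scale, ket, operator_coe, preScale, lift_tensor, Completion.coe_smul]

theorem star_create_ket_nil (e : E) (a : A) : star (create φ e) (ket φ ([], a)) = 0 :=
  ext_ket fun w => by
    rw [braket_star_apply, create_ket, braket_ket, kernel_cons_nil, braket_zero_right]

theorem star_create_ket_cons (e f : E) (u : List E) (a : A) :
    star (create φ e) (ket φ (f :: u, a)) = ket φ (Word.act φ (braket A e f) (u, a)) :=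
  ext_ket fun w => by
    rw [braket_star_apply, create_ket, braket_ket, braket_ket, kernel_cons_cons]

theorem act_one (p : Word A E) : Word.act φ 1 p = p := by
  rcases p with ⟨_ | ⟨f, v⟩, b⟩ <;> simp

variable (φ) in
/-- The left action of `A` on the Fock space as a homomorphism. -/
def leftHom : A →⋆ₐ[ℂ] Adjointable A (Fock φ) where
  toFun := left φ
  map_one' := operator_ext fun p => by
    change left φ 1 (ket φ p) = _
    rw [left_ket, act_one, map_one]
    rfl
  map_mul' a b := operator_ext fun p => by
    change left φ (a * b) (ket φ p) = (left φ a * left φ b) (ket φ p)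
    rw [Adjointable.mul_apply, left_ket, left_ket, left_ket, act_mul]
  map_zero' := operator_ext fun p => ext_ket fun w => by
    change braket A (ket φ w) (left φ 0 (ket φ p)) = _
    rw [left_ket, braket_ket, kernel_act_zero, map_zero]
    exact (braket_zero_right _).symm
  map_add' a b := operator_ext fun p => ext_ket fun w => by
    change braket A (ket φ w) (left φ (a + b) (ket φ p)) = braket A (ket φ w)
      (Adjointable.toCLM (left φ a + left φ b) (ket φ p))
    rw [map_add, add_apply, braket_add_right, left_ket, left_ket, left_ket, braket_ket, braket_ket,
      braket_ket, kernel_act_add]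
  commutes' c := operator_ext fun p => ext_ket fun w => by
    change braket A (ket φ w) (left φ (algebraMap ℂ A c) (ket φ p)) = braket A (ket φ w)
      (Adjointable.toCLM (algebraMap ℂ (Adjointable A (Fock φ)) c) (ket φ p))
    rw [left_ket, braket_ket, Algebra.algebraMap_eq_smul_one, kernel_act_smul, act_one,
      Algebra.algebraMap_eq_smul_one, map_smul, map_one, smul_apply, braket_smul_right]
    rw [one_apply_eq_self, braket_ket]
  map_star' a := (star_left a).symm

theorem leftHom_apply (a : A) : leftHom φ a = left φ a := rfl

theorem kernel_cons_add (w : Word A E) (e f : E) (u : List E) (a : A) :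
    Word.kernel φ w.1 w.2 ((e + f) :: u, a) =
      Word.kernel φ w.1 w.2 (e :: u, a) + Word.kernel φ w.1 w.2 (f :: u, a) := by
  rcases w with ⟨_ | ⟨g, v⟩, b⟩
  · simp
  · simp only [kernel_cons_cons, braket_add_right, kernel_act_add]

theorem kernel_cons_smul (w : Word A E) (c : ℂ) (e : E) (u : List E) (a : A) :
    Word.kernel φ w.1 w.2 ((c • e) :: u, a) = c • Word.kernel φ w.1 w.2 (e :: u, a) := by
  rcases w with ⟨_ | ⟨g, v⟩, b⟩
  · simp
  · simp only [kernel_cons_cons, braket_smul_right, kernel_act_smul]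

theorem create_add (e f : E) : create φ (e + f) = create φ e + create φ f :=
  operator_ext fun p => ext_ket fun w => by
    change braket A (ket φ w) (create φ (e + f) (ket φ p)) = braket A (ket φ w)
      (Adjointable.toCLM (create φ e + create φ f) (ket φ p))
    rw [map_add, add_apply, braket_add_right, create_ket, create_ket, create_ket, braket_ket,
      braket_ket, braket_ket, kernel_cons_add]

theorem create_smul (c : ℂ) (e : E) : create φ (c • e) = c • create φ e :=
  operator_ext fun p => ext_ket fun w => by
    change braket A (ket φ w) (create φ (c • e) (ket φ p)) = braket A (ket φ w)
      (Adjointable.toCLM (c • create φ e) (ket φ p))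
    rw [map_smul, smul_apply, braket_smul_right, create_ket, create_ket, braket_ket, braket_ket,
      kernel_cons_smul]

theorem star_create_mul_create (e f : E) :
    star (create φ e) * create φ f = left φ (braket A e f) :=
  operator_ext fun p => by
    change (star (create φ e) * create φ f) (ket φ p) = left φ (braket A e f) (ket φ p)
    rw [Adjointable.mul_apply, create_ket, star_create_ket_cons, left_ket]

/-- By T_e⋆ T_e = ⟨e|e⟩ the bound reduces to contractivity of the homomorphism from A. -/
theorem norm_create_le (e : E) : ‖create φ e‖ ≤ ‖e‖ := by
  refine le_of_sq_le_sq ?_ (norm_nonneg _)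
  rw [sq, ← CStarRing.norm_star_mul_self, star_create_mul_create, CStarModule.norm_sq_eq Aᵐᵒᵖ]
  exact NonUnitalStarAlgHom.norm_apply_le (leftHom φ) (braket A e e)

variable (φ) in
/-- The creation operators as a continuous linear map. -/
def createCLM : E →L[ℂ] Adjointable A (Fock φ) :=
  LinearMap.mkContinuous ⟨⟨create φ, create_add⟩, create_smul⟩ 1 fun e => by
    simpa using norm_create_le e

theorem createCLM_apply (e : E) : createCLM φ e = create φ e := rfl

end Relations

/-! ### Homogeneous vectors -/

section Homogeneous

variable {A E : Type*} [CStarAlgebra A] [PartialOrder A] [StarOrderedRing A]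
  [NormedAddCommGroup E] [NormedSpace ℂ E] [SMul Aᵐᵒᵖ E] [CStarModule Aᵐᵒᵖ E]
  {φ : A →⋆ₐ[ℂ] Adjointable A E}

variable (φ) in
/-- The vectors of degree `k` in the Fock space. -/
def homogeneous (k : ℤ) : Set (Fock φ) := {x | ∀ z : Circle, scale φ z x = ((z : ℂ) ^ k) • x}

theorem ket_mem_homogeneous (p : Word A E) : ket φ p ∈ homogeneous φ p.1.length := fun z => by
  rw [scale_ket, zpow_natCast]

/-- An operator of degree k commutes with the gauge unitary of z up to the factor z^k. -/
theorem apply_mem_homogeneous {t : Adjointable A (Fock φ)} {k : ℤ}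
    (ht : ∀ z : Circle, Toeplitz.conj φ z t = ((z : ℂ) ^ k) • t) {l : ℤ} {x : Fock φ}
    (hx : x ∈ homogeneous φ l) : t x ∈ homogeneous φ (k + l) := fun z => by
  have h1 : scale φ z * t = (((z : ℂ) ^ k) • t) * scale φ z := by
    rw [← ht z]
    change _ = scale φ z * t * star (scale φ z) * scale φ z
    rw [mul_assoc, star_scale, ← scale_mul, inv_mul_cancel, scale_one, mul_one]
  rw [← Adjointable.mul_apply, h1, Adjointable.mul_apply, hx z, map_smul, map_smul, smul_apply,
    smul_smul, zpow_add₀ (Circle.coe_ne_zero z), mul_comm]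

/-- Unitarity of the gauge operators gives ⟨x|y⟩ = z^(l-k) ⟨x|y⟩ for all z. A z with z^(l-k) = -1
then makes the inner product vanish. -/
theorem braket_eq_zero_of_homogeneous {k l : ℤ} (hkl : k ≠ l) {x y : Fock φ}
    (hx : x ∈ homogeneous φ k) (hy : y ∈ homogeneous φ l) : braket A x y = 0 := by
  have h1 : ∀ z : Circle, braket A x y = ((z : ℂ) ^ (l - k)) • braket A x y := fun z => by
    have h2 : braket A (scale φ z x) (scale φ z y) = braket A x y := by
      rw [braket_apply_left, star_scale, ← Adjointable.mul_apply, ← scale_mul, inv_mul_cancel,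
        scale_one, map_one]
      rfl
    rw [hx z, hy z, braket_smul_right, ← star_braket, braket_smul_right, star_smul, star_braket,
      smul_smul] at h2
    nth_rw 1 [← h2]
    congr 1
    rw [zpow_sub₀ (Circle.coe_ne_zero z), div_eq_mul_inv, star_zpow₀, Complex.star_def,
      ← Circle.coe_inv_eq_conj, Circle.coe_inv, inv_zpow]
  have h3 := h1 (Circle.exp (Real.pi / (l - k : ℤ)))
  have h4 : ((Circle.exp (Real.pi / (l - k : ℤ)) : Circle) : ℂ) ^ (l - k) = -1 := by
    have h5 : ((l - k : ℤ) : ℂ) ≠ 0 := Int.cast_ne_zero.2 (sub_ne_zero.2 hkl.symm)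
    rw [Circle.coe_exp, ← Complex.exp_int_mul, ← Complex.exp_pi_mul_I]
    congr 1
    push_cast at h5 ⊢
    field_simp
  rw [h4, neg_one_smul] at h3
  have h5 : (2 : ℂ) • braket A x y = 0 := by
    rw [two_smul]
    nth_rw 1 [h3]
    exact neg_add_cancel _
  exact (smul_eq_zero.1 h5).resolve_left two_ne_zero

theorem eq_zero_of_homogeneous_neg {k : ℤ} (hk : k < 0) {x : Fock φ}
    (hx : x ∈ homogeneous φ k) : x = 0 :=
  ext_ket fun w => by
    rw [braket_eq_zero_of_homogeneous (by omega) (ket_mem_homogeneous w) hx, braket_zero_right]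

/-! ### The projection onto the summand of a given degree. -/

/-- The projection onto tensors of length `n`. -/
def preGrade (n : ℕ) : PreFock φ →ₗ[ℂ] PreFock φ :=
  lift fun p => if p.1.length = n then tensor p else 0

theorem form_zero_right (x : PreFock φ) : form x 0 = 0 := by
  simpa using form_smul_right x 0 0

theorem form_preGrade (n : ℕ) (x y : PreFock φ) : form (preGrade n x) y = form x (preGrade n y) :=
  form_adjoint (fun p q => by
    have h0 : form (0 : PreFock φ) (tensor q) = 0 := by
      rw [← star_form, form_zero_right, star_zero]
    simp only [preGrade, lift_tensor]
    split_ifs with h1 h2 h2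
    · rfl
    · rw [form_zero_right, form_tensor, kernel_eq_zero]
      omega
    · rw [h0, form_tensor, kernel_eq_zero]
      omega
    · rw [h0, form_zero_right]) x y

theorem preGrade_preGrade (n : ℕ) (x : PreFock φ) : preGrade n (preGrade n x) = preGrade n x := by
  refine PreFock.induction (P := fun x => preGrade n (preGrade n x) = preGrade n x) x
    (fun p => ?_) ?_ ?_
  · simp only [preGrade, lift_tensor]
    split_ifs with h
    · rw [lift_tensor, if_pos h]
    · rw [map_zero]
  · intro x y hx hy; simp only [map_add, hx, hy]
  · intro c x hx; simp only [map_smul, hx]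

variable (φ) in
/-- The projection of the Fock space onto its summand `E^{⊗ n}`. -/
def grade (n : ℕ) : Adjointable A (Fock φ) :=
  operator (preGrade n) (preGrade n) (form_preGrade n)
    (bounded_of_form_le (C := 1) zero_le_one fun x => by
      -- Pythagoras: positivity of ⟨x - Px|x - Px⟩ = ⟨x|x⟩ - ⟨Px|Px⟩ shows that P is a contraction.
      have h1 := form_nonneg (x - preGrade n x)
      have h2 : form x (preGrade n x) = form (preGrade n x) (preGrade n x) := by
        rw [form_preGrade, preGrade_preGrade]
      rw [form_sub_self, form_preGrade, h2, sub_add_cancel, sub_nonneg] at h1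
      rwa [one_smul])

theorem grade_ket (n : ℕ) (p : Word A E) :
    grade φ n (ket φ p) = if p.1.length = n then ket φ p else 0 := by
  rw [grade, ket, operator_coe, preGrade, lift_tensor]
  split_ifs
  · rfl
  · exact Completion.coe_zero

theorem star_grade (n : ℕ) : star (grade φ n) = grade φ n :=
  operator_ext fun p => ext_ket fun w => by
    change braket A (ket φ w) (star (grade φ n) (ket φ p)) =
      braket A (ket φ w) (grade φ n (ket φ p))
    rw [braket_star_apply, grade_ket, grade_ket]
    split_ifs with h1 h2 h2
    · rfl
    · rw [braket_ket, kernel_eq_zero, braket_zero_right]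
      omega
    · rw [braket_ket, kernel_eq_zero, braket_zero_left]
      omega
    · rw [braket_zero_left, braket_zero_right]

/-- This identifies degree as a gauge eigenvalue with tensor length. Against a tensor of length n
both sides agree trivially; against any other, both vanish by orthogonality. -/
theorem grade_of_homogeneous {n : ℕ} {x : Fock φ} (hx : x ∈ homogeneous φ n) :
    grade φ n x = x :=
  ext_ket fun w => by
    rw [← star_grade, braket_star_apply, grade_ket]
    split_ifs with h
    · rfl
    · rw [braket_zero_left, braket_eq_zero_of_homogeneous (by omega) (ket_mem_homogeneous w) hx]

/-- A closed subspace that contains the elementary tensors of length `n` contains the vectors of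
degree `n`. -/
theorem mem_of_homogeneous {n : ℕ} (M : Submodule ℂ (Fock φ)) (hM : IsClosed (M : Set (Fock φ)))
    (h : ∀ p : Word A E, p.1.length = n → ket φ p ∈ M) {x : Fock φ} (hx : x ∈ homogeneous φ n) :
    x ∈ M := by
  rw [← grade_of_homogeneous hx]
  refine mem_of_ket_mem (M.comap (Adjointable.toCLM (grade φ n)).toLinearMap)
    (hM.preimage (Adjointable.toCLM (grade φ n)).continuous) (fun p => ?_) x
  change grade φ n (ket φ p) ∈ M
  rw [grade_ket]
  split_ifs with h1
  · exact h p h1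
  · exact M.zero_mem

end Homogeneous

end Fock

/-! ### The chain of ideals -/

section Chain

variable {A E : Type*} [CStarAlgebra A] [PartialOrder A] [StarOrderedRing A]
  [NormedAddCommGroup E] [NormedSpace ℂ E] [SMul Aᵐᵒᵖ E] [CStarModule Aᵐᵒᵖ E]
  (φ : A →⋆ₐ[ℂ] Adjointable A E)

theorem isClosed_idealChain (n : ℕ) : IsClosed (idealChain φ n : Set A) := by
  cases n with
  | zero => exact isClosed_univ
  | succ n => exact Submodule.isClosed_topologicalClosure _

theorem braket_mem_idealChain {n : ℕ} {x : A} (hx : x ∈ idealChain φ n) (e f : E) :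
    braket A e (φ x f) ∈ idealChain φ (n + 1) :=
  Submodule.le_topologicalClosure _ (Submodule.subset_span ⟨e, f, x, hx, rfl⟩)

/-- A closed subspace contains an ideal of the chain if it contains its generators. -/
theorem idealChain_succ_le {n : ℕ} {M : Submodule ℂ A} (hM : IsClosed (M : Set A))
    (h : ∀ e f : E, ∀ x ∈ idealChain φ n, braket A e (φ x f) ∈ M) : idealChain φ (n + 1) ≤ M := by
  refine Submodule.topologicalClosure_minimal _ (Submodule.span_le.2 ?_) hM
  rintro _ ⟨e, f, x, hx, rfl⟩
  exact h e f x hx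

theorem idealChain_succ_mono {m n : ℕ} (h : idealChain φ m ≤ idealChain φ n) :
    idealChain φ (m + 1) ≤ idealChain φ (n + 1) :=
  idealChain_succ_le φ (isClosed_idealChain φ _) fun e f _ hx =>
    braket_mem_idealChain φ (h hx) e f

theorem idealChain_succ_le_self (n : ℕ) : idealChain φ (n + 1) ≤ idealChain φ n := by
  induction n with
  | zero => exact le_top
  | succ n ih => exact idealChain_succ_mono φ ih

/-- Each ideal is a monotone function of its predecessor, so one stationary step forces all later
ones. -/
theorem isArtinian_of_le {N : ℕ} (h : idealChain φ N ≤ idealChain φ (N + 1)) :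
    IsArtinianCorrespondence φ := by
  refine ⟨N, fun n hn => ?_⟩
  induction n, hn using Nat.le_induction with
  | base => rfl
  | succ n _ ih =>
    refine le_antisymm ((idealChain_succ_le_self φ n).trans ih.le) (h.trans ?_)
    exact idealChain_succ_mono φ ih.ge

theorem mul_mem_idealChain {n : ℕ} {x : A} (hx : x ∈ idealChain φ n) (a b : A) :
    a * x * b ∈ idealChain φ n := by
  cases n with
  | zero => trivial
  | succ n =>
    let L : A →ₗ[ℂ] A := (LinearMap.mulRight ℂ b).comp (LinearMap.mulLeft ℂ a)
    have hL : Continuous L := (continuous_const_mul a).mul continuous_const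
    refine idealChain_succ_le φ (M := (idealChain φ (n + 1)).comap L)
      ((isClosed_idealChain φ (n + 1)).preimage hL) (fun e f x hx => ?_) hx
    change a * braket A e (φ x f) * b ∈ idealChain φ (n + 1)
    -- Multiplication is absorbed into the vectors, because operators in φ(A) commute with the right
    -- action.
    have h1 : a * braket A e (φ x f) * b = braket A (op (star a) • e) (φ x (op b • f)) := by
      rw [Adjointable.map_op_smul, braket_op_smul_right, ← star_braket _ (op (star a) • e),
        braket_op_smul_right, star_mul, star_star, star_braket]
    rw [h1]
    exact braket_mem_idealChain φ hx _ _

theorem star_mem_idealChain {n : ℕ} {x : A} (hx : x ∈ idealChain φ n) :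
    star x ∈ idealChain φ n := by
  induction n generalizing x with
  | zero => trivial
  | succ n ih =>
    refine idealChain_succ_le φ
      (M := (idealChain φ (n + 1)).comap (starLinearEquiv ℂ : A ≃ₗ⋆[ℂ] A).toLinearMap)
      ((isClosed_idealChain φ (n + 1)).preimage continuous_star) (fun e f x hx => ?_) hx
    change star (braket A e (φ x f)) ∈ idealChain φ (n + 1)
    rw [star_braket, braket_apply_left, ← map_star]
    exact braket_mem_idealChain φ (ih hx) f e

/-- Removing one leg from each tensor replaces c by ⟨e|φ(c)f⟩, which lies one step further down the
chain. The statement carries a general c and m so that the induction can proceed. -/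
theorem kernel_act_mem_idealChain (u : List E) (a : A) (q : Word A E) {m : ℕ} {c : A}
    (hc : c ∈ idealChain φ m) :
    Word.kernel φ u a (Word.act φ c q) ∈ idealChain φ (m + u.length) := by
  induction u generalizing q m c with
  | nil =>
    rcases q with ⟨_ | ⟨f, v⟩, b⟩
    · rw [act_nil, kernel_nil_nil, ← mul_assoc]
      exact mul_mem_idealChain φ hc _ _
    · exact Submodule.zero_mem _
  | cons e u ih =>
    rcases q with ⟨_ | ⟨f, v⟩, b⟩
    · exact Submodule.zero_mem _
    · rw [act_cons, kernel_cons_cons, List.length_cons, add_comm u.length, ← add_assoc]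
      exact ih _ (braket_mem_idealChain φ hc e f)

theorem kernel_mem_idealChain (p q : Word A E) :
    Word.kernel φ p.1 p.2 q ∈ idealChain φ p.1.length := by
  have h := kernel_act_mem_idealChain φ p.1 p.2 q (m := 0) (c := 1) Submodule.mem_top
  rwa [Fock.act_one, zero_add] at h

/-- Completeness of E makes B(E) a C⋆-algebra, so that φ is automatically continuous. -/
theorem continuous_kernel_act [CompleteSpace E] (u : List E) (a : A) (q : Word A E) :
    Continuous fun c => Word.kernel φ u a (Word.act φ c q) := by
  induction u generalizing q with
  | nil =>
    rcases q with ⟨_ | ⟨f, v⟩, b⟩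
    · simp only [act_nil, kernel_nil_nil]
      fun_prop
    · exact continuous_const
  | cons e u ih =>
    rcases q with ⟨_ | ⟨f, v⟩, b⟩
    · exact continuous_const
    · have hφ : Continuous φ := map_continuous φ
      have hT : Continuous fun T : Adjointable A E => Adjointable.toCLM T f :=
        (ContinuousLinearMap.apply ℂ E f).continuous.comp continuous_subtype_val
      have h1 : Continuous fun c => braket A e (φ c f) :=
        continuous_unop.comp ((CStarModule.continuous_inner (A := Aᵐᵒᵖ) (E := E)).comp
          (continuous_const.prodMk (hT.comp hφ)))
      exact (ih (v, b)).comp h1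

/-- The reverse unwinding: a generator ⟨e|φ(x)f⟩ of the next ideal acts as x does after e and f are
prepended to the two words. So n drops while the words grow, until only inner products of tensors
are left. -/
theorem kernel_act_mem_of_kernel_mem [CompleteSpace E] {M : Submodule ℂ A}
    (hM : IsClosed (M : Set A)) {n : ℕ} (u : List E) (q : Word A E)
    (h : ∀ (v : List E) (r : Word A E), v.length = n + u.length → r.1.length = n + q.1.length →
      Word.kernel φ v 1 r ∈ M) {c : A} (hc : c ∈ idealChain φ n) :
    Word.kernel φ u 1 (Word.act φ c q) ∈ M := by
  induction n generalizing u q c with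
  | zero => exact h u _ (by simp) (by rw [Fock.length_act, zero_add])
  | succ n ih =>
    let L : A →ₗ[ℂ] A := ⟨⟨fun c => Word.kernel φ u 1 (Word.act φ c q),
      fun c d => kernel_act_add φ u 1 c d q⟩, fun z c => kernel_act_smul φ u 1 z c q⟩
    refine idealChain_succ_le φ (M := M.comap L)
      (hM.preimage (continuous_kernel_act φ u 1 q)) (fun e f x hx => ?_) hc
    change Word.kernel φ u 1 (Word.act φ (braket A e (φ x f)) q) ∈ M
    refine ih (e :: u) (f :: q.1, q.2) (fun v r hv hr => h v r ?_ ?_) hx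
    · rw [hv, List.length_cons]; ring
    · rw [hr, List.length_cons]; ring

/-- A closed subspace that contains all inner products of elementary tensors of length `n`
contains the `n`-th ideal of the chain. -/
theorem idealChain_le_of_kernel_mem [CompleteSpace E] {M : Submodule ℂ A}
    (hM : IsClosed (M : Set A)) {n : ℕ}
    (h : ∀ (v : List E) (r : Word A E), v.length = n → r.1.length = n → Word.kernel φ v 1 r ∈ M) :
    idealChain φ n ≤ M := fun c hc => by
  -- Between two empty words with entry 1 the kernel returns c itself.
  have h1 := kernel_act_mem_of_kernel_mem φ hM [] ([], 1) (fun v r hv hr => h v r hv hr) hc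
  rwa [act_nil, kernel_nil_nil, star_one, one_mul, mul_one] at h1

/-- Density of tensors is used in each variable in turn; self-adjointness of the ideals exchanges
the variables. -/
theorem Fock.braket_mem_idealChain_of_homogeneous {n : ℕ} {x y : Fock φ}
    (hx : x ∈ Fock.homogeneous φ n) (hy : y ∈ Fock.homogeneous φ n) :
    braket A x y ∈ idealChain φ n := by
  refine Fock.mem_of_homogeneous (Fock.braketComap (idealChain φ n) x)
    (Fock.isClosed_braketComap (isClosed_idealChain φ n) x) (fun q hq => ?_) hy
  rw [Fock.mem_braketComap, ← star_braket]
  refine star_mem_idealChain φ (Fock.mem_of_homogeneous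
    (Fock.braketComap (idealChain φ n) (Fock.ket φ q))
    (Fock.isClosed_braketComap (isClosed_idealChain φ n) _) (fun p hp => ?_) hx)
  rw [Fock.mem_braketComap, Fock.braket_ket, ← hq]
  exact kernel_mem_idealChain φ q p

end Chain

/-! ### The gauge actions on the Toeplitz and Cuntz–Pimsner algebras -/

section Gauge

variable {A E : Type*} [CStarAlgebra A] [PartialOrder A] [StarOrderedRing A]
  [NormedAddCommGroup E] [NormedSpace ℂ E] [SMul Aᵐᵒᵖ E] [CStarModule Aᵐᵒᵖ E]
  (φ : A →⋆ₐ[ℂ] Adjointable A E)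

namespace Toeplitz

theorem norm_conj_le (z : Circle) (x : Adjointable A (Fock φ)) : ‖conj φ z x‖ ≤ ‖x‖ :=
  NonUnitalStarAlgHom.norm_apply_le (conj φ z) x

theorem conj_mul (z w : Circle) (x : Adjointable A (Fock φ)) :
    conj φ (z * w) x = conj φ z (conj φ w x) := by
  change Unitary.conjStarAlgAut ℂ _ (Fock.gaugeUnitary φ (z * w)) x =
    Unitary.conjStarAlgAut ℂ _ (Fock.gaugeUnitary φ z)
      (Unitary.conjStarAlgAut ℂ _ (Fock.gaugeUnitary φ w) x)
  rw [map_mul, map_mul]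
  rfl

/-- On the generators the orbit is constant or a multiple of z, so it is continuous on the ⋆-algebra
they generate. Contractivity of the conjugations passes this to uniform limits. -/
theorem continuous_conj_apply {x : Adjointable A (Fock φ)} (hx : x ∈ toeplitzSubalgebra φ) :
    Continuous fun z => conj φ z x := by
  refine continuous_of_uniform_approx_of_continuous fun V hV => ?_
  obtain ⟨ε, hε, hV⟩ := Metric.mem_uniformity_dist.1 hV
  obtain ⟨y, hy, hxy⟩ := Metric.mem_closure_iff.1
    (show x ∈ closure (StarAlgebra.adjoin ℂ (Set.range (Fock.left φ) ∪
      Set.range (Fock.create φ)) : Set (Adjointable A (Fock φ))) from hx) ε hε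
  refine ⟨fun z => conj φ z y, ?_, fun z => hV ?_⟩
  · clear hxy
    induction hy using StarAlgebra.adjoin_induction with
    | mem y hy =>
      rcases hy with ⟨a, rfl⟩ | ⟨e, rfl⟩
      · simp only [conj_left]
        exact continuous_const
      · simp only [conj_create]
        exact continuous_subtype_val.smul continuous_const
    | algebraMap r =>
      simp only [AlgHomClass.commutes]
      exact continuous_const
    | add x y _ _ hx hy => simp only [map_add]; exact hx.add hy
    | mul x y _ _ hx hy => simp only [map_mul]; exact hx.mul hy
    | star x _ hx => simp only [map_star]; exact hx.star
  · rw [dist_eq_norm, ← map_sub]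
    rw [dist_eq_norm] at hxy
    exact (norm_conj_le φ z _).trans_lt hxy

/-- The gauge action on `T_E`. -/
def gaugeAction : ContinuousAction Circle (Toeplitz φ) where
  act := gauge φ
  act_mul z w x := Subtype.ext (conj_mul φ z w x.1)
  norm_act_le z x := norm_conj_le φ z x.1
  continuous_act x := (continuous_conj_apply φ x.2).subtype_mk _

theorem conj_val_of_mem {k : ℤ} {t : Toeplitz φ}
    (ht : t ∈ spectralSubspace (gaugeAction φ).toFun (circleChar k)) (z : Circle) :
    conj φ z (val φ t) = ((z : ℂ) ^ k) • val φ t := by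
  have h := congrArg (val φ) (ht z)
  rw [map_smul, circleChar_apply, Circle.coe_zpow] at h
  exact h

end Toeplitz

/-- The quotient map `T_E → O_E` as a continuous linear map. -/
def quotientCLM : Toeplitz φ →L[ℂ] CPAlgebra φ :=
  LinearMap.mkContinuous (IdealQuotient.mk (covariance φ)).toLinearMap 1 fun x => by
    rw [one_mul]
    exact IdealQuotient.norm_mk_le _ x

theorem gauge_mk (z : Circle) (x : Toeplitz φ) :
    gauge φ z (IdealQuotient.mk (covariance φ) x) =
      IdealQuotient.mk (covariance φ) (Toeplitz.gauge φ z x) := rfl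

/-- The gauge action on `O_E`. -/
def gaugeAction : ContinuousAction Circle (CPAlgebra φ) where
  act := gauge φ
  act_mul z w x := by
    obtain ⟨x, rfl⟩ := IdealQuotient.mk_surjective _ x
    rw [gauge_mk, gauge_mk, gauge_mk]
    exact congrArg _ ((Toeplitz.gaugeAction φ).act_mul z w x)
  norm_act_le z x := by
    refine le_of_forall_pos_le_add fun ε hε => ?_
    obtain ⟨r, rfl, hr⟩ := IdealQuotient.norm_mk_lt _ x hε
    rw [gauge_mk]
    exact ((IdealQuotient.norm_mk_le _ _).trans ((Toeplitz.gaugeAction φ).norm_act_le z r)).trans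
      hr.le
  continuous_act x := by
    obtain ⟨x, rfl⟩ := IdealQuotient.mk_surjective _ x
    exact (quotientCLM φ).continuous.comp ((Toeplitz.gaugeAction φ).continuous_act x)

/-- If the gauge action is saturated, then `1` is approximated by elements of the span of
`T_τ⋆ T_τ` modulo the kernel of `T_E → O_E`. -/
theorem exists_approx_one_of_saturated (h : IsSaturatedAction (gaugeAction φ).toFun)
    (τ : PontryaginDual Circle) {ε : ℝ} (hε : 0 < ε) :
    ∃ x ∈ Submodule.span ℂ {x : Toeplitz φ |
      ∃ s ∈ spectralSubspace (Toeplitz.gaugeAction φ).toFun τ,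
      ∃ t ∈ spectralSubspace (Toeplitz.gaugeAction φ).toFun τ, x = star s * t},
    ∃ j ∈ closedIdeal (covariance φ).carrier, ‖1 - x - j‖ < ε := by
  have h1 := h τ (show ∀ z, (gaugeAction φ).act z 1 = 1 from fun z => map_one _)
  obtain ⟨y, hy, hd⟩ := Metric.mem_closure_iff.1 h1 ε hε
  obtain ⟨x, hx, rfl⟩ : ∃ x ∈ Submodule.span ℂ {x : Toeplitz φ |
      ∃ s ∈ spectralSubspace (Toeplitz.gaugeAction φ).toFun τ,
      ∃ t ∈ spectralSubspace (Toeplitz.gaugeAction φ).toFun τ, x = star s * t},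
      IdealQuotient.mk (covariance φ) x = y := by
    clear hd
    induction hy using Submodule.span_induction with
    | mem y hy =>
      obtain ⟨a, ha, b, hb, rfl⟩ := hy
      have hsurj : Function.Surjective (quotientCLM φ) := IdealQuotient.mk_surjective _
      obtain ⟨s, hs, rfl⟩ := (gaugeAction φ).exists_lift (Toeplitz.gaugeAction φ) (quotientCLM φ)
        hsurj (fun _ _ => rfl) ha
      obtain ⟨t, ht, rfl⟩ := (gaugeAction φ).exists_lift (Toeplitz.gaugeAction φ) (quotientCLM φ)
        hsurj (fun _ _ => rfl) hb
      refine ⟨star s * t, Submodule.subset_span ⟨s, hs, t, ht, rfl⟩, ?_⟩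
      rw [map_mul, ← IdealQuotient.star_mk]
      rfl
    | zero => exact ⟨0, Submodule.zero_mem _, map_zero _⟩
    | add x y _ _ hx hy =>
      obtain ⟨x, hx, rfl⟩ := hx
      obtain ⟨y, hy, rfl⟩ := hy
      exact ⟨x + y, Submodule.add_mem _ hx hy, map_add _ _ _⟩
    | smul c x _ hx =>
      obtain ⟨x, hx, rfl⟩ := hx
      exact ⟨c • x, Submodule.smul_mem _ _ hx, map_smul _ _ _⟩
  rw [dist_eq_norm, ← map_one (IdealQuotient.mk (covariance φ)), ← map_sub] at hd
  -- The class of 1 - x has norm less than ε, hence a representative r of norm less than ε; the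
  -- difference of the two representatives is j.
  obtain ⟨r, hr, hrn⟩ := IdealQuotient.norm_mk_lt (covariance φ)
    (IdealQuotient.mk (covariance φ) (1 - x)) (sub_pos.2 hd)
  refine ⟨x, hx, 1 - x - r, ?_, ?_⟩
  · rw [← IdealQuotient.mk_eq_zero_iff, map_sub _ (1 - x), hr, sub_self]
  · rw [sub_sub_cancel]
    linarith

end Gauge

/-! ### The kernel of `T_E → O_E` -/

section Kernel

variable {A E : Type*} [CStarAlgebra A] [PartialOrder A] [StarOrderedRing A]
  [NormedAddCommGroup E] [NormedSpace ℂ E] [SMul Aᵐᵒᵖ E] [CStarModule Aᵐᵒᵖ E]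
  (φ : A →⋆ₐ[ℂ] Adjointable A E)

open Fock

/-- The balancing relation ec ⊗ x = e ⊗ cx of the tensor product over A. -/
theorem create_op_smul (e : E) (c : A) : create φ (op c • e) = create φ e * left φ c :=
  operator_ext fun p => ext_ket fun w => by
    change braket A (ket φ w) (create φ (op c • e) (ket φ p)) =
      braket A (ket φ w) ((create φ e * left φ c) (ket φ p))
    rw [Adjointable.mul_apply, left_ket, create_ket, create_ket, braket_ket, braket_ket]
    rcases w with ⟨_ | ⟨g, v⟩, b⟩
    · rfl
    · rw [kernel_cons_cons, kernel_cons_cons, braket_op_smul_right, act_mul]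

theorem continuous_val_apply (x : Fock φ) : Continuous fun t : Toeplitz φ => Toeplitz.val φ t x :=
  (ContinuousLinearMap.apply ℂ (Fock φ) x).continuous.comp
    (continuous_subtype_val.comp continuous_subtype_val)

/-- ψ₁(k) acts as k ⊗ 1 on tensors of positive length and as 0 on A. This is a direct computation
for |e⟩⟨f|, and it survives limits in the pair (k, ψ₁(k)). -/
theorem apply_ket_of_mem_psiGraph {p : Adjointable A E × Toeplitz φ} (hp : p ∈ psiGraph φ) :
    (∀ a, Toeplitz.val φ p.2 (ket φ ([], a)) = 0) ∧
      ∀ e u a, Toeplitz.val φ p.2 (ket φ (e :: u, a)) = ket φ (p.1 e :: u, a) := by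
  -- Written with `createCLM`, the right side is visibly continuous and linear in the operator, so
  -- the condition is closed.
  suffices h : (∀ a, Toeplitz.val φ p.2 (ket φ ([], a)) = 0) ∧
      ∀ e u a, Toeplitz.val φ p.2 (ket φ (e :: u, a)) = createCLM φ (p.1 e) (ket φ (u, a)) by
    refine ⟨h.1, fun e u a => ?_⟩
    rw [h.2, createCLM_apply, create_ket]
  have hcl : IsClosed {p : Adjointable A E × Toeplitz φ |
      (∀ a, Toeplitz.val φ p.2 (ket φ ([], a)) = 0) ∧ ∀ e u a,
        Toeplitz.val φ p.2 (ket φ (e :: u, a)) = createCLM φ (p.1 e) (ket φ (u, a))} := by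
    have h1 : ∀ x : Fock φ, Continuous fun p : Adjointable A E × Toeplitz φ =>
        Toeplitz.val φ p.2 x := fun x => (continuous_val_apply φ x).comp continuous_snd
    have h2 : ∀ e, Continuous fun p : Adjointable A E × Toeplitz φ => Adjointable.toCLM p.1 e :=
      fun e => (ContinuousLinearMap.apply ℂ E e).continuous.comp
        (continuous_subtype_val.comp continuous_fst)
    have h3 : ∀ x : Fock φ, Continuous fun T : Adjointable A (Fock φ) => Adjointable.toCLM T x :=
      fun x => (ContinuousLinearMap.apply ℂ (Fock φ) x).continuous.comp continuous_subtype_val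
    simp only [Set.ofPred_and, Set.ofPred_forall]
    refine (isClosed_iInter fun a => isClosed_eq (h1 _) continuous_const).inter
      (isClosed_iInter fun e => isClosed_iInter fun u => isClosed_iInter fun a =>
        isClosed_eq (h1 _) ((h3 _).comp ((createCLM φ).continuous.comp (h2 e))))
  refine closure_minimal (fun q hq => ?_) hcl hp
  change (∀ a, Toeplitz.val φ q.2 (ket φ ([], a)) = 0) ∧
    ∀ e u a, Toeplitz.val φ q.2 (ket φ (e :: u, a)) = createCLM φ (q.1 e) (ket φ (u, a))
  induction hq using Submodule.span_induction with
  | mem q hq =>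
    obtain ⟨e, f, rfl⟩ := hq
    have h1 : Toeplitz.val φ (Toeplitz.create φ e * star (Toeplitz.create φ f)) =
      create φ e * star (create φ f) := rfl
    refine ⟨fun a => ?_, fun g u a => ?_⟩
    · rw [h1, Adjointable.mul_apply, star_create_ket_nil, map_zero]
    · rw [h1, Adjointable.mul_apply, star_create_ket_cons, createCLM_apply, rankOne_apply,
        create_op_smul, Adjointable.mul_apply, left_ket]
  | zero =>
    refine ⟨fun a => ?_, fun e u a => ?_⟩
    · rw [Prod.snd_zero, map_zero, map_zero]; rfl
    · rw [Prod.snd_zero, Prod.fst_zero, map_zero, map_zero, map_zero]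
      simp
  | add x y _ _ hx hy =>
    refine ⟨fun a => ?_, fun e u a => ?_⟩
    · rw [Prod.snd_add, map_add, map_add, add_apply, hx.1, hy.1, add_zero]
    · rw [Prod.snd_add, Prod.fst_add, map_add, map_add, map_add, add_apply, add_apply, hx.2, hy.2,
        map_add, map_add, add_apply]
  | smul c x _ hx =>
    refine ⟨fun a => ?_, fun e u a => ?_⟩
    · rw [Prod.smul_snd, map_smul, map_smul, smul_apply, hx.1, smul_zero]
    · rw [Prod.smul_snd, Prod.smul_fst, map_smul, map_smul, map_smul, smul_apply, smul_apply, hx.2,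
        map_smul, map_smul, smul_apply]

/-- The generators of the kernel of `T_E → O_E` act on the summand `A` of the Fock space only. -/
theorem apply_ket_of_mem_covarianceSet {x : Toeplitz φ} (hx : x ∈ covarianceSet φ) :
    (∃ a ∈ katsuraIdeal φ, ∀ b, Toeplitz.val φ x (ket φ ([], b)) = ket φ ([], a * b)) ∧
      ∀ e u b, Toeplitz.val φ x (ket φ (e :: u, b)) = 0 := by
  obtain ⟨a, ha, t, ht, rfl⟩ := hx
  have h1 := apply_ket_of_mem_psiGraph φ ht
  have h2 : Toeplitz.val φ (Toeplitz.left φ a) = left φ a := rfl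
  refine ⟨⟨a, ha, fun b => ?_⟩, fun e u b => ?_⟩
  · rw [map_sub, map_sub, sub_apply, h1.1, h2, left_ket, sub_zero, act_nil]
  · rw [map_sub, map_sub, sub_apply, h1.2, h2, left_ket, act_cons, sub_self]

/-- The matrix coefficients of elements of the kernel of `T_E → O_E` lie in `J_E`. -/
theorem braket_mem_katsuraIdeal [CompleteSpace E] {x : Toeplitz φ}
    (hx : x ∈ closedIdeal (covariance φ).carrier) (y y' : Fock φ) :
    braket A y (Toeplitz.val φ x y') ∈ katsuraSubmodule φ := by
  -- Multiplying x on either side only changes the two vectors, so the elements with all matrix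
  -- coefficients in J_E form a closed two-sided ideal. Only the generators remain to be checked.
  let J : Ideal (Toeplitz φ) :=
    { carrier := {x | ∀ y y', braket A y (Toeplitz.val φ x y') ∈ katsuraSubmodule φ}
      add_mem' := fun {a b} ha hb y y' => by
        rw [map_add, map_add, add_apply, braket_add_right]
        exact Submodule.add_mem _ (ha y y') (hb y y')
      zero_mem' := fun y y' => by
        rw [map_zero, map_zero, zero_apply, braket_zero_right]
        exact Submodule.zero_mem _
      smul_mem' := fun c a ha y y' => by
        rw [smul_eq_mul, map_mul, Adjointable.mul_apply, ← star_star (Toeplitz.val φ c),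
          braket_star_apply]
        exact ha _ _ }
  have hJcl : IsClosed (J : Set (Toeplitz φ)) := by
    have h : (J : Set (Toeplitz φ)) = ⋂ y, ⋂ y', {x | braket A y (Toeplitz.val φ x y') ∈
        (katsuraSubmodule φ : Set A)} := by
      ext x
      simp only [Set.mem_iInter]
      rfl
    rw [h]
    exact isClosed_iInter fun y => isClosed_iInter fun y' => (isClosed_katsuraIdeal φ).preimage
      (Fock.continuous_braket continuous_const (continuous_val_apply φ y'))
  refine mem_closedIdeal.1 hx J ⟨fun {a} b ha y y' => ?_⟩ hJcl (fun x hx y y' => ?_) y y'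
  · rw [map_mul, Adjointable.mul_apply]
    exact ha _ _
  · obtain ⟨⟨a, ha, h1⟩, h2⟩ := apply_ket_of_mem_covarianceSet φ hx
    refine mem_of_ket_mem ((braketComap (katsuraSubmodule φ) y).comap
      (Adjointable.toCLM (Toeplitz.val φ x)).toLinearMap)
      ((isClosed_braketComap (N := katsuraSubmodule φ) (isClosed_katsuraIdeal φ) y).preimage
        (Adjointable.toCLM (Toeplitz.val φ x)).continuous) (fun p => ?_) y'
    change braket A y (Toeplitz.val φ x (ket φ p)) ∈ katsuraSubmodule φ
    rcases p with ⟨_ | ⟨e, u⟩, b⟩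
    · rw [h1, ← star_braket]
      refine star_mem_katsuraIdeal φ (mem_of_ket_mem
        (braketComap (katsuraSubmodule φ) (ket φ ([], a * b)))
        (isClosed_braketComap (N := katsuraSubmodule φ) (isClosed_katsuraIdeal φ) _)
        (fun q => ?_) y)
      rw [mem_braketComap, braket_ket]
      rcases q with ⟨_ | ⟨e, u⟩, c⟩
      · rw [kernel_nil_nil, star_mul]
        exact mem_katsuraIdeal_mul φ _ (mul_mem_katsuraIdeal φ _ (star_mem_katsuraIdeal φ ha))
      · exact Submodule.zero_mem _
    · rw [h2, braket_zero_right]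
      exact Submodule.zero_mem _

/-! ### Operators that vanish in the limit of large degree. -/

/-- The operators on the Fock space that are asymptotically zero on vectors of large degree. -/
def vanishing : Submodule ℂ (Adjointable A (Fock φ)) where
  carrier := {j | ∀ ε : ℝ, 0 < ε → ∃ N : ℤ, ∀ n, N ≤ n → ∀ y ∈ homogeneous φ n, ‖j y‖ ≤ ε * ‖y‖}
  add_mem' {i j} hi hj ε hε := by
    obtain ⟨M, hM⟩ := hi (ε / 2) (half_pos hε)
    obtain ⟨N, hN⟩ := hj (ε / 2) (half_pos hε)
    refine ⟨max M N, fun n hn y hy => ?_⟩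
    rw [map_add, add_apply]
    have h1 := hM n ((le_max_left _ _).trans hn) y hy
    have h2 := hN n ((le_max_right _ _).trans hn) y hy
    calc _ ≤ _ := norm_add_le _ _
      _ ≤ ε * ‖y‖ := by linarith
  zero_mem' ε hε := ⟨0, fun n _ y _ => by rw [map_zero, zero_apply, norm_zero]; positivity⟩
  smul_mem' c j hj ε hε := by
    obtain ⟨N, hN⟩ := hj (ε / (‖c‖ + 1)) (by positivity)
    refine ⟨N, fun n hn y hy => ?_⟩
    rw [map_smul, smul_apply, norm_smul]
    calc ‖c‖ * ‖j y‖ ≤ (‖c‖ + 1) * (ε / (‖c‖ + 1) * ‖y‖) := by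
          gcongr
          · linarith
          · exact hN n hn y hy
      _ = ε * ‖y‖ := by field_simp

theorem isClosed_vanishing : IsClosed (vanishing φ : Set (Adjointable A (Fock φ))) := by
  refine isClosed_of_closure_subset fun j hj ε hε => ?_
  obtain ⟨i, hi, hd⟩ := Metric.mem_closure_iff.1 hj (ε / 2) (half_pos hε)
  obtain ⟨N, hN⟩ := hi (ε / 2) (half_pos hε)
  refine ⟨N, fun n hn y hy => ?_⟩
  have h1 := hN n hn y hy
  have h2 : ‖(j - i) y‖ ≤ ε / 2 * ‖y‖ := by
    refine (Adjointable.norm_apply_le _ _).trans ?_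
    rw [dist_eq_norm] at hd
    gcongr
  have h3 : Adjointable.toCLM j y = (j - i) y + i y := by
    rw [map_sub, sub_apply, sub_add_cancel]
  rw [h3]
  calc _ ≤ _ := norm_add_le _ _
    _ ≤ ε * ‖y‖ := by linarith

theorem mul_mem_vanishing (t : Adjointable A (Fock φ)) {j : Adjointable A (Fock φ)}
    (hj : j ∈ vanishing φ) : t * j ∈ vanishing φ := fun ε hε => by
  obtain ⟨N, hN⟩ := hj (ε / (‖t‖ + 1)) (by positivity)
  refine ⟨N, fun n hn y hy => ?_⟩
  rw [Adjointable.mul_apply]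
  calc ‖t (j y)‖ ≤ ‖t‖ * ‖j y‖ := Adjointable.norm_apply_le _ _
    _ ≤ (‖t‖ + 1) * (ε / (‖t‖ + 1) * ‖y‖) := by
      gcongr
      · linarith
      · exact hN n hn y hy
    _ = ε * ‖y‖ := by field_simp

/-- An operator of degree k shifts degrees by k, so the threshold N becomes N - k. -/
theorem mem_vanishing_mul_of_homogeneous {t j : Adjointable A (Fock φ)} (hj : j ∈ vanishing φ)
    {k : ℤ} (ht : ∀ z : Circle, Toeplitz.conj φ z t = ((z : ℂ) ^ k) • t) :
    j * t ∈ vanishing φ := fun ε hε => by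
  obtain ⟨N, hN⟩ := hj (ε / (‖t‖ + 1)) (by positivity)
  refine ⟨N - k, fun n hn y hy => ?_⟩
  rw [Adjointable.mul_apply]
  calc ‖j (t y)‖ ≤ ε / (‖t‖ + 1) * ‖t y‖ :=
        hN (k + n) (by omega) _ (apply_mem_homogeneous ht hy)
    _ ≤ ε / (‖t‖ + 1) * ((‖t‖ + 1) * ‖y‖) := by
      gcongr
      refine (Adjointable.norm_apply_le _ _).trans ?_
      gcongr
      linarith
    _ = ε * ‖y‖ := by field_simp

theorem conj_star_of_homogeneous {t : Adjointable A (Fock φ)} {k : ℤ}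
    (ht : ∀ z : Circle, Toeplitz.conj φ z t = ((z : ℂ) ^ k) • t) (z : Circle) :
    Toeplitz.conj φ z (star t) = ((z : ℂ) ^ (-k)) • star t := by
  rw [map_star, ht, star_smul, star_zpow₀, Complex.star_def, ← Circle.coe_inv_eq_conj,
    Circle.coe_inv, inv_zpow, zpow_neg]

/-- Right multiplication is controlled for the homogeneous generators of T_E and their adjoints, and
then extends to products, sums and limits. -/
theorem mem_vanishing_mul {t : Adjointable A (Fock φ)} (ht : t ∈ toeplitzSubalgebra φ)
    {j : Adjointable A (Fock φ)} (hj : j ∈ vanishing φ) : j * t ∈ vanishing φ := by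
  refine (isClosed_vanishing φ).closure_subset
    (map_mem_closure (continuous_const_mul j) ht fun x hx => ?_)
  -- Quantifying over j lets the induction pass through products; carrying the adjoint along lets it
  -- pass through the involution.
  suffices h : ∀ j ∈ vanishing φ, j * x ∈ vanishing φ ∧ j * star x ∈ vanishing φ from (h j hj).1
  clear hj j
  induction hx using StarAlgebra.adjoin_induction with
  | mem x hx =>
    obtain ⟨k, hk⟩ : ∃ k : ℤ, ∀ z : Circle, Toeplitz.conj φ z x = ((z : ℂ) ^ k) • x := by
      rcases hx with ⟨a, rfl⟩ | ⟨e, rfl⟩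
      · exact ⟨0, fun z => by rw [Toeplitz.conj_left, zpow_zero, one_smul]⟩
      · exact ⟨1, fun z => by rw [Toeplitz.conj_create, zpow_one]⟩
    exact fun j hj => ⟨mem_vanishing_mul_of_homogeneous φ hj hk,
      mem_vanishing_mul_of_homogeneous φ hj (conj_star_of_homogeneous φ hk)⟩
  | algebraMap r =>
    intro j hj
    rw [← algebraMap_star_comm, ← Algebra.commutes, ← Algebra.commutes]
    exact ⟨mul_mem_vanishing φ _ hj, mul_mem_vanishing φ _ hj⟩
  | add x y _ _ hx hy =>
    intro j hj
    rw [star_add, mul_add, mul_add]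
    exact ⟨Submodule.add_mem _ (hx j hj).1 (hy j hj).1, Submodule.add_mem _ (hx j hj).2 (hy j hj).2⟩
  | mul x y _ _ hx hy =>
    intro j hj
    rw [star_mul, ← mul_assoc, ← mul_assoc]
    exact ⟨(hy _ (hx j hj).1).1, (hx _ (hy j hj).2).2⟩
  | star x _ hx =>
    intro j hj
    rw [star_star]
    exact (hx j hj).symm

/-- Elements of the kernel of `T_E → O_E` are asymptotically zero on vectors of large degree. -/
theorem val_mem_vanishing {x : Toeplitz φ} (hx : x ∈ closedIdeal (covariance φ).carrier) :
    Toeplitz.val φ x ∈ vanishing φ := by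
  let J : Ideal (Toeplitz φ) :=
    { carrier := {x | Toeplitz.val φ x ∈ vanishing φ}
      add_mem' := fun {a b} ha hb => by
        change Toeplitz.val φ (a + b) ∈ vanishing φ
        rw [map_add]
        exact Submodule.add_mem _ ha hb
      zero_mem' := by
        change Toeplitz.val φ 0 ∈ vanishing φ
        rw [map_zero]
        exact Submodule.zero_mem _
      smul_mem' := fun c a ha => by
        change Toeplitz.val φ (c * a) ∈ vanishing φ
        rw [map_mul]
        exact mul_mem_vanishing φ _ ha }
  refine mem_closedIdeal.1 hx J ⟨fun {a} b ha => ?_⟩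
    ((isClosed_vanishing φ).preimage continuous_subtype_val) fun x hx ε hε => ?_
  · change Toeplitz.val φ (a * b) ∈ vanishing φ
    rw [map_mul]
    exact mem_vanishing_mul φ b.2 ha
  · obtain ⟨-, h2⟩ := apply_ket_of_mem_covarianceSet φ hx
    -- A generator kills all tensors of positive length exactly, so the threshold is 1 for every ε.
    refine ⟨1, fun n hn y hy => ?_⟩
    lift n to ℕ using by omega
    have h3 : y ∈ LinearMap.ker (Adjointable.toCLM (Toeplitz.val φ x)).toLinearMap := by
      refine mem_of_homogeneous _ (Adjointable.toCLM (Toeplitz.val φ x)).isClosed_ker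
        (fun p hp => ?_) hy
      rcases p with ⟨_ | ⟨e, u⟩, b⟩
      · simp only [List.length_nil] at hp
        omega
      · exact h2 e u b
    have h4 : Toeplitz.val φ x y = 0 := h3
    rw [h4, norm_zero]
    positivity

end Kernel

/-! ### Consequences of saturation -/

section Saturated

variable {A E : Type*} [CStarAlgebra A] [PartialOrder A] [StarOrderedRing A]
  [NormedAddCommGroup E] [NormedSpace ℂ E] [SMul Aᵐᵒᵖ E] [CStarModule Aᵐᵒᵖ E] [CompleteSpace E]
  (φ : A →⋆ₐ[ℂ] Adjointable A E)

open Fock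

/-- If `1` is approximated by the span of `T₋₁⋆ T₋₁` modulo the kernel of `T_E → O_E`, then
`J_E = A`: this is seen on the summand `A` of the Fock space, which is annihilated by `T₋₁`. -/
theorem one_mem_katsuraIdeal_of_saturated (h : IsSaturatedAction (gaugeAction φ).toFun) :
    (1 : A) ∈ katsuraIdeal φ := by
  set v : Fock φ := ket φ ([], 1)
  have hv : braket A v v = 1 := by rw [braket_ket, kernel_nil_nil, star_one, one_mul]
  refine (isClosed_katsuraIdeal φ).closure_subset (Metric.mem_closure_iff.2 fun ε hε => ?_)
  -- The tolerance allows for the factor ‖v‖² in the final estimate; the 1 in the denominator avoids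
  -- division by zero.
  obtain ⟨x, hx, j, hj, hn⟩ := exists_approx_one_of_saturated φ h (circleChar (-1))
    (ε := ε / (‖v‖ * ‖v‖ + 1)) (by positivity)
  have hxv : braket A v (Toeplitz.val φ x v) = 0 := by
    clear hn
    induction hx using Submodule.span_induction with
    | mem x hx =>
      obtain ⟨s, -, t, ht, rfl⟩ := hx
      -- The vector v has degree 0 and t lowers degree by one, but there are no nonzero vectors of
      -- degree -1.
      have h0 : Toeplitz.val φ t v = 0 := eq_zero_of_homogeneous_neg (k := -1 + 0) (by norm_num)
        (apply_mem_homogeneous (Toeplitz.conj_val_of_mem φ ht)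
          (ket_mem_homogeneous (φ := φ) ([], (1 : A))))
      rw [map_mul, Adjointable.mul_apply, h0, map_zero, braket_zero_right]
    | zero => rw [map_zero, map_zero, zero_apply, braket_zero_right]
    | add x y _ _ hx hy => rw [map_add, map_add, add_apply, braket_add_right, hx, hy, add_zero]
    | smul c x _ hx => rw [map_smul, map_smul, smul_apply, braket_smul_right, hx, smul_zero]
  refine ⟨braket A v (Toeplitz.val φ j v), braket_mem_katsuraIdeal φ hj v v, ?_⟩
  have h1 : braket A v (Toeplitz.val φ (1 - x - j) v) = 1 - braket A v (Toeplitz.val φ j v) := by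
    rw [map_sub, map_sub, map_sub, map_sub, map_one, map_one, sub_apply, sub_apply,
      braket_sub_right, braket_sub_right, hxv, sub_zero, one_apply_eq_self, hv]
  rw [dist_eq_norm, ← h1]
  calc ‖braket A v (Toeplitz.val φ (1 - x - j) v)‖
      ≤ ‖v‖ * ‖Toeplitz.val φ (1 - x - j) v‖ := CStarModule.norm_inner_le (A := Aᵐᵒᵖ) (Fock φ)
    _ ≤ ‖v‖ * (‖1 - x - j‖ * ‖v‖) := by
      gcongr
      exact Adjointable.norm_apply_le (Toeplitz.val φ (1 - x - j)) v
    _ = ‖1 - x - j‖ * (‖v‖ * ‖v‖) := by ring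
    _ ≤ ε / (‖v‖ * ‖v‖ + 1) * (‖v‖ * ‖v‖) := by gcongr
    _ < ε / (‖v‖ * ‖v‖ + 1) * (‖v‖ * ‖v‖ + 1) := by
      gcongr
      linarith
    _ = ε := by field_simp

/-- If an operator preserves a degree, is close to the identity there, and has matrix coefficients
in a closed subspace, then so does the identity. -/
theorem braket_mem_of_contraction {n : ℤ} {M : Submodule ℂ A} (hM : IsClosed (M : Set A))
    {x : Adjointable A (Fock φ)} (hx : ∀ y ∈ homogeneous φ n, x y ∈ homogeneous φ n)
    (hxM : ∀ y ∈ homogeneous φ n, ∀ y' ∈ homogeneous φ n, braket A y (x y') ∈ M)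
    (hn : ∀ y ∈ homogeneous φ n, ‖y - x y‖ ≤ 1 / 2 * ‖y‖) {y y' : Fock φ}
    (hy : y ∈ homogeneous φ n) (hy' : y' ∈ homogeneous φ n) : braket A y y' ∈ M := by
  -- A Neumann iteration: replacing w by w - xw halves the norm bound and changes ⟨y|w⟩ by an
  -- element of M. In the limit ⟨y|y'⟩ itself lies in M.
  have key : ∀ k : ℕ, ∃ w ∈ homogeneous φ n, ‖w‖ ≤ (1 / 2) ^ k * ‖y'‖ ∧
      braket A y y' - braket A y w ∈ M := by
    intro k
    induction k with
    | zero => exact ⟨y', hy', by simp, by rw [sub_self]; exact M.zero_mem⟩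
    | succ k ih =>
      obtain ⟨w, hw, hwn, hwM⟩ := ih
      refine ⟨w - x w, fun z => ?_, ?_, ?_⟩
      · rw [map_sub, hw z, hx w hw z, smul_sub]
      · calc ‖w - x w‖ ≤ 1 / 2 * ‖w‖ := hn w hw
          _ ≤ 1 / 2 * ((1 / 2) ^ k * ‖y'‖) := by gcongr
          _ = _ := by ring
      · rw [braket_sub_right, ← sub_add]
        exact M.add_mem hwM (hxM y hy w hw)
  choose w _ hwn hwM using key
  have hlim : Filter.Tendsto w Filter.atTop (nhds 0) := by
    refine squeeze_zero_norm hwn ?_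
    have := (tendsto_pow_atTop_nhds_zero_of_lt_one (r := (1 / 2 : ℝ)) (by norm_num)
      (by norm_num)).mul_const ‖y'‖
    rwa [zero_mul] at this
  have hlim2 : Filter.Tendsto (fun k => braket A y y' - braket A y (w k)) Filter.atTop
      (nhds (braket A y y')) := by
    have h1 : Continuous fun w : Fock φ => braket A y y' - braket A y w :=
      continuous_const.sub (continuous_braket continuous_const continuous_id)
    have h2 := (h1.tendsto 0).comp hlim
    rwa [braket_zero_right, sub_zero] at h2
  exact hM.mem_of_tendsto hlim2 (Filter.Eventually.of_forall hwM)

/-- If `1` is approximated by the span of `T₁⋆ T₁` modulo the kernel of `T_E → O_E`, then the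
chain of ideals stabilizes: this is seen on a summand `E^{⊗ n}` of the Fock space with `n` large. -/
theorem isArtinian_of_saturated (h : IsSaturatedAction (gaugeAction φ).toFun) :
    IsArtinianCorrespondence φ := by
  -- One quarter for this approximation and one quarter for j on large degrees add up to the
  -- contraction factor 1/2.
  obtain ⟨x, hx, j, hj, hn⟩ := exists_approx_one_of_saturated φ h (circleChar 1)
    (ε := 1 / 4) (by norm_num)
  obtain ⟨N, hN⟩ := val_mem_vanishing φ hj (1 / 4) (by norm_num)
  have hdeg : ∀ n : ℕ, ∀ y ∈ homogeneous φ n, Toeplitz.val φ x y ∈ homogeneous φ n ∧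
      ∀ w ∈ homogeneous φ n, braket A w (Toeplitz.val φ x y) ∈ idealChain φ (n + 1) := by
    clear hn
    intro n y hy
    induction hx using Submodule.span_induction with
    | mem x hx =>
      obtain ⟨s, hs, t, ht, rfl⟩ := hx
      have hs' := Toeplitz.conj_val_of_mem φ hs
      have hty := apply_mem_homogeneous (Toeplitz.conj_val_of_mem φ ht) hy
      rw [map_mul, map_star, Adjointable.mul_apply]
      refine ⟨?_, fun w hw => ?_⟩
      · have h1 := apply_mem_homogeneous (conj_star_of_homogeneous φ hs') hty
        rwa [neg_add_cancel_left] at h1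
      · rw [braket_star_apply]
        -- Both s and t raise degree by one, so ⟨w|s⋆t y⟩ = ⟨sw|ty⟩ is an inner product in degree n
        -- + 1.
        have hsw := apply_mem_homogeneous hs' hw
        rw [add_comm (1 : ℤ), ← Nat.cast_succ] at hsw hty
        exact braket_mem_idealChain_of_homogeneous φ hsw hty
    | zero =>
      rw [map_zero, map_zero, zero_apply]
      refine ⟨fun z => by rw [map_zero, smul_zero], fun w _ => ?_⟩
      rw [braket_zero_right]
      exact Submodule.zero_mem _
    | add x x' _ _ hx hx' =>
      rw [map_add, map_add, add_apply]
      refine ⟨fun z => by rw [map_add, hx.1 z, hx'.1 z, smul_add], fun w hw => ?_⟩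
      rw [braket_add_right]
      exact Submodule.add_mem _ (hx.2 w hw) (hx'.2 w hw)
    | smul c x _ hx =>
      rw [map_smul, map_smul, smul_apply]
      refine ⟨fun z => by rw [map_smul, hx.1 z, smul_comm], fun w hw => ?_⟩
      rw [braket_smul_right]
      exact Submodule.smul_mem _ _ (hx.2 w hw)
  have hnear : ∀ n : ℤ, N ≤ n → ∀ y ∈ homogeneous φ n, ‖y - Toeplitz.val φ x y‖ ≤ 1 / 2 * ‖y‖ := by
    intro n hNn y hy
    have h1 : y - Toeplitz.val φ x y =
        Toeplitz.val φ (1 - x - j) y + Toeplitz.val φ j y := by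
      rw [map_sub, map_sub, map_sub, map_sub, map_one, map_one, sub_apply, sub_apply,
        one_apply_eq_self, sub_add_cancel]
    have h2 := hN n hNn y hy
    have h3 : ‖Toeplitz.val φ (1 - x - j) y‖ ≤ 1 / 4 * ‖y‖ :=
      (Adjointable.norm_apply_le (Toeplitz.val φ (1 - x - j)) y).trans (by gcongr; exact hn.le)
    rw [h1]
    calc _ ≤ _ := norm_add_le _ _
      _ ≤ 1 / 2 * ‖y‖ := by linarith
  refine isArtinian_of_le φ (N := N.toNat)
    (idealChain_le_of_kernel_mem φ (isClosed_idealChain φ _) fun u q hu hq => ?_)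
  have hu' := ket_mem_homogeneous (φ := φ) (u, (1 : A))
  have hq' := ket_mem_homogeneous (φ := φ) q
  rw [hq] at hq'
  rw [show ((u, (1 : A)) : Word A E).1.length = N.toNat from hu] at hu'
  have h1 := braket_mem_of_contraction φ (isClosed_idealChain φ (N.toNat + 1))
    (fun y hy => (hdeg _ y hy).1) (fun y hy y' hy' => (hdeg _ y' hy').2 y hy)
    (hnear N.toNat (Int.self_le_toNat N)) hu' hq'
  rwa [braket_ket] at h1

end Saturated

/-! ### Freeness of the gauge action -/

section Free

variable {A E : Type*} [CStarAlgebra A] [PartialOrder A] [StarOrderedRing A]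
  [NormedAddCommGroup E] [NormedSpace ℂ E] [SMul Aᵐᵒᵖ E] [CStarModule Aᵐᵒᵖ E]
  (φ : A →⋆ₐ[ℂ] Adjointable A E)

/-! ### Products of creation operators. -/

namespace Toeplitz

/-- The inclusion of `A` in `T_E` as a homomorphism. -/
def leftHom : A →⋆ₐ[ℂ] Toeplitz φ :=
  StarAlgHom.codRestrict (Fock.leftHom φ) (toeplitzSubalgebra φ) (left_mem φ)

theorem leftHom_apply (a : A) : leftHom φ a = left φ a := rfl

theorem star_create_mul_create (e f : E) :
    star (create φ e) * create φ f = leftHom φ (braket A e f) :=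
  Subtype.ext (Fock.star_create_mul_create e f)

theorem leftHom_mul_create (a : A) (e : E) : leftHom φ a * create φ e = create φ (φ a e) :=
  Subtype.ext (Fock.operator_ext fun p => by
    change (Fock.left φ a * Fock.create φ e) (Fock.ket φ p) = Fock.create φ (φ a e) (Fock.ket φ p)
    rw [Adjointable.mul_apply, Fock.create_ket, Fock.create_ket, Fock.left_ket, act_cons])

/-- The product of creation operators along a list. -/
def word (u : List E) : Toeplitz φ := (u.map (create φ)).prod

theorem word_nil : word φ ([] : List E) = 1 := rfl

theorem word_cons (e : E) (u : List E) : word φ (e :: u) = create φ e * word φ u :=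
  List.prod_cons

/-- The product collapses from the middle by e⋆ a f = ⟨e|φ(a)f⟩, which follows the recursion
defining `Word.kernel`; hence the general a in the induction. -/
theorem star_word_mul_word {u v : List E} (h : u.length = v.length) (a : A) :
    star (word φ u) * leftHom φ a * word φ v =
      leftHom φ (Word.kernel φ u 1 (Word.act φ a (v, 1))) := by
  induction u generalizing v a with
  | nil =>
    obtain rfl : v = [] := List.length_eq_zero_iff.1 h.symm
    simp [word_nil]
  | cons e u ih =>
    rcases v with _ | ⟨f, v⟩
    · simp at h
    · rw [act_cons, kernel_cons_cons, ← ih (by simpa using h), word_cons, word_cons, star_mul,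
        ← star_create_mul_create, ← leftHom_mul_create]
      simp only [mul_assoc]

theorem star_word_mul_word_mul {u v : List E} (h : u.length = v.length) (b : A) :
    star (word φ u) * word φ v * leftHom φ b = leftHom φ (Word.kernel φ u 1 (v, b)) := by
  have h1 := star_word_mul_word φ h 1
  rw [map_one, mul_one, Fock.act_one] at h1
  rw [h1, ← map_mul, ← kernel_mul_right, one_mul]

theorem gauge_word (z : Circle) (u : List E) :
    gauge φ z (word φ u) = ((z : ℂ) ^ u.length) • word φ u := by
  induction u with
  | nil => rw [word_nil, map_one, List.length_nil, pow_zero, one_smul]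
  | cons e u ih =>
    rw [word_cons, map_mul, ih, gauge_create, smul_mul_smul_comm, List.length_cons, pow_succ']

end Toeplitz

open Toeplitz

/-- The quotient map `T_E → O_E`. -/
abbrev toCP : Toeplitz φ →ₐ[ℂ] CPAlgebra φ := IdealQuotient.mk (covariance φ)

theorem toCP_word_mem (u v : List E) (b : A) {n : ℤ} (hn : (u.length : ℤ) - v.length = n) :
    toCP φ (word φ u * leftHom φ b * star (word φ v)) ∈
      spectralSubspace (CuntzPimsner.gaugeAction φ).toFun (circleChar n) := fun z => by
  have h : Toeplitz.gauge φ z (word φ u * leftHom φ b * star (word φ v)) =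
      ((z ^ n : Circle) : ℂ) • (word φ u * leftHom φ b * star (word φ v)) := by
    rw [map_mul, map_mul, map_star, gauge_word, gauge_word, leftHom_apply, gauge_left, ← hn,
      star_smul, smul_mul_assoc, smul_mul_smul_comm, Circle.coe_zpow,
      zpow_sub₀ (Circle.coe_ne_zero z), zpow_natCast, zpow_natCast, star_pow, Complex.star_def,
      ← Circle.coe_inv_eq_conj, Circle.coe_inv, inv_pow, div_eq_mul_inv]
  change toCP φ (Toeplitz.gauge φ z _) = _
  rw [h, map_smul, circleChar_apply]

/-! ### Decompositions of the unit of O_E. -/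

variable {φ}

/-- If `1 = ∑ |eᵢ⟩⟨fᵢ|` on `E` and `φ` is injective, then `1 = ∑ eᵢ fᵢ⋆` in `O_E`. -/
theorem one_eq_sum_of_injective (hφ : Function.Injective φ) {n : ℕ} {e f : Fin n → E}
    (h : (1 : Adjointable A E) = ∑ i, rankOne A (e i) (f i)) :
    (1 : CPAlgebra φ) = ∑ i, toCP φ (create φ (e i)) * toCP φ (star (create φ (f i))) := by
  have h1 : ((1 : Adjointable A E), ∑ i, create φ (e i) * star (create φ (f i))) ∈ psiGraph φ := by
    have h2 : ((1 : Adjointable A E), ∑ i, create φ (e i) * star (create φ (f i))) =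
        ∑ i, (rankOne A (e i) (f i), create φ (e i) * star (create φ (f i))) := by
      refine Prod.ext ?_ ?_
      · rw [Prod.fst_sum, h]
      · rw [Prod.snd_sum]
    rw [h2]
    exact Submodule.sum_mem _ fun i _ =>
      Submodule.le_topologicalClosure _ (Submodule.subset_span ⟨_, _, rfl⟩)
  -- Orthogonality to the kernel is void for injective φ, and φ(1) is a finite sum of rank-one
  -- operators. The covariance relation therefore applies to a = 1.
  have h2 : (1 : A) ∈ katsuraIdeal φ := by
    refine ⟨fun b hb => ?_, ?_⟩
    · rw [(injective_iff_map_eq_zero φ).1 hφ b hb]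
      simp
    · rw [map_one, h]
      exact Submodule.sum_mem _ fun i _ =>
        Submodule.le_topologicalClosure _ (Submodule.subset_span ⟨_, _, rfl⟩)
  have h3 : toCP φ (left φ 1 - ∑ i, create φ (e i) * star (create φ (f i))) = 0 :=
    IdealQuotient.mk_eq_zero_iff.2 (subset_closedIdeal _
      ⟨1, h2, _, by rw [map_one]; exact h1, rfl⟩)
  rw [← leftHom_apply, map_one, map_sub, map_one, sub_eq_zero] at h3
  rw [h3, map_sum]
  simp only [map_mul]

variable (φ) in
/-- The span of the elements `e₁ ⋯ eₘ fₘ⋆ ⋯ f₁⋆` of `O_E`. -/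
def diagonal (m : ℕ) : Submodule ℂ (CPAlgebra φ) :=
  Submodule.span ℂ {x | ∃ u v : List E, u.length = m ∧ v.length = m ∧
    x = toCP φ (word φ u * star (word φ v))}

theorem create_mul_mul_mem_diagonal (e f : E) {m : ℕ} {x : CPAlgebra φ} (hx : x ∈ diagonal φ m) :
    toCP φ (create φ e) * x * toCP φ (star (create φ f)) ∈ diagonal φ (m + 1) := by
  induction hx using Submodule.span_induction with
  | mem x hx =>
    obtain ⟨u, v, hu, hv, rfl⟩ := hx
    refine Submodule.subset_span ⟨e :: u, f :: v, by simp [hu], by simp [hv], ?_⟩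
    rw [word_cons, word_cons, star_mul, ← map_mul, ← map_mul]
    simp only [mul_assoc]
  | zero => rw [mul_zero, zero_mul]; exact Submodule.zero_mem _
  | add x y _ _ hx hy => rw [mul_add, add_mul]; exact Submodule.add_mem _ hx hy
  | smul c x _ hx => rw [mul_smul_comm, smul_mul_assoc]; exact Submodule.smul_mem _ _ hx

/-- Write 1 = ∑ eᵢ · 1 · fᵢ⋆ and insert the decomposition for shorter words in the middle. -/
theorem one_mem_diagonal (hφ : Function.Injective φ) {n : ℕ} {e f : Fin n → E}
    (h : (1 : Adjointable A E) = ∑ i, rankOne A (e i) (f i)) (m : ℕ) :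
    (1 : CPAlgebra φ) ∈ diagonal φ m := by
  induction m with
  | zero => exact Submodule.subset_span ⟨[], [], rfl, rfl, by simp [word_nil]⟩
  | succ m ih =>
    rw [one_eq_sum_of_injective hφ h]
    refine Submodule.sum_mem _ fun i _ => ?_
    rw [← mul_one (toCP φ (create φ (e i)))]
    exact create_mul_mul_mem_diagonal _ _ ih

/-- Nonnegative degrees need the stationary chain; nonpositive ones need only the decomposition of 1
into words. -/
theorem free_of_artinian [CompleteSpace E] (hφ : Function.Injective φ) {k : ℕ} {e f : Fin k → E}
    (h : (1 : Adjointable A E) = ∑ i, rankOne A (e i) (f i)) (hart : IsArtinianCorrespondence φ) :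
    IsFreeAction (CuntzPimsner.gaugeAction φ).toFun := by
  refine (CuntzPimsner.gaugeAction φ).free_of_one_mem_closure fun n => ?_
  obtain ⟨n, rfl | rfl⟩ := n.eq_nat_or_neg
  · obtain ⟨m, hm⟩ := hart
    set D := (Submodule.span ℂ {x : CPAlgebra φ | ∃ a,
      ∃ b ∈ spectralSubspace (CuntzPimsner.gaugeAction φ).toFun (circleChar n),
        x = a * b}).topologicalClosure with hD
    have h1 : ∀ u v : List E, u.length = m → v.length = m → ∀ a ∈ idealChain φ m,
        toCP φ (word φ u * leftHom φ a * star (word φ v)) ∈ D := by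
      intro u v hu hv a ha
      -- The artinian condition enters only here: an element of I_m is also in I_{m+n}, hence is
      -- approximated by inner products of tensors of length m + n.
      rw [← hm (m + n) (Nat.le_add_right m n)] at ha
      let L : A →ₗ[ℂ] CPAlgebra φ := (toCP φ).toLinearMap ∘ₗ
        (LinearMap.mulRight ℂ (star (word φ v))) ∘ₗ (LinearMap.mulLeft ℂ (word φ u)) ∘ₗ
        (leftHom φ).toLinearMap
      have hL : Continuous L := by
        have hl : Continuous (leftHom φ) :=
          (map_continuous (Fock.leftHom φ)).subtype_mk fun a => left_mem φ a
        exact (quotientCLM φ).continuous.comp ((continuous_const.mul hl).mul continuous_const)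
      refine idealChain_le_of_kernel_mem φ (M := D.comap L) (n := m + n)
        ((Submodule.isClosed_topologicalClosure _).preimage hL) (fun s r hs hr => ?_) ha
      change toCP φ (word φ u * leftHom φ (Word.kernel φ s 1 r) * star (word φ v)) ∈ D
      -- Splitting the inner product as s⋆ r b puts u s⋆ on the left and r b v⋆, of degree (m + n) -
      -- m = n, on the right.
      refine Submodule.le_topologicalClosure _ (Submodule.subset_span
        ⟨toCP φ (word φ u * star (word φ s)),
          toCP φ (word φ r.1 * leftHom φ r.2 * star (word φ v)),
          toCP_word_mem φ _ _ _ (by rw [hr, hv]; push_cast; ring), ?_⟩)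
      rw [← star_word_mul_word_mul φ (hs.trans hr.symm), ← map_mul]
      simp only [mul_assoc]
    -- Squaring the decomposition of 1 creates an inner factor v⋆ s in I_m, to which the stationary
    -- chain applies.
    have h2 : (1 : CPAlgebra φ) ∈ diagonal φ m * diagonal φ m := by
      rw [← mul_one (1 : CPAlgebra φ)]
      exact Submodule.mul_mem_mul (one_mem_diagonal hφ h m) (one_mem_diagonal hφ h m)
    rw [diagonal, Submodule.span_mul_span] at h2
    refine Submodule.span_le.2 ?_ h2
    rintro _ ⟨_, ⟨u, v, hu, hv, rfl⟩, _, ⟨s, t, hs, ht, rfl⟩, rfl⟩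
    have h3 := h1 u t hu ht (Word.kernel φ v 1 (s, 1)) (by
      rw [← hv]
      exact kernel_mem_idealChain φ (v, 1) (s, 1))
    rw [← star_word_mul_word_mul φ (hv.trans hs.symm), map_one, mul_one] at h3
    change toCP φ (word φ u * star (word φ v)) * toCP φ (word φ s * star (word φ t)) ∈ D
    rw [← map_mul]
    simpa only [mul_assoc] using h3
  -- In u v⋆ with words of length n the right factor already has degree -n, so no limit is needed.
  · refine Submodule.le_topologicalClosure _ (Submodule.span_mono ?_ (one_mem_diagonal hφ h n))
    rintro _ ⟨u, v, hu, hv, rfl⟩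
    refine ⟨toCP φ (word φ u), toCP φ (star (word φ v)), ?_, map_mul _ _ _⟩
    have h1 := toCP_word_mem φ [] v 1 (n := -n) (by simp [hv])
    rwa [word_nil, map_one, one_mul, one_mul] at h1

end Free

end CuntzPimsner

end

/-! ### The cycle of implications. -/

theorem mainTheorem1 {A E : Type*} [CStarAlgebra A] [PartialOrder A] [StarOrderedRing A]
    [NormedAddCommGroup E] [NormedSpace ℂ E] [Module Aᵐᵒᵖ E] [CStarModule Aᵐᵒᵖ E]
    [CompleteSpace E] (φ : A →⋆ₐ[ℂ] CuntzPimsner.Adjointable A E) :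
    (CuntzPimsner.IsFreeAction (fun z : Circle => CuntzPimsner.gauge φ z) ↔
      Function.Injective φ ∧ Module.Finite Aᵐᵒᵖ E ∧ CuntzPimsner.IsArtinianCorrespondence φ) ∧
    (CuntzPimsner.IsSaturatedAction (fun z : Circle => CuntzPimsner.gauge φ z) ↔
      Function.Injective φ ∧ Module.Finite Aᵐᵒᵖ E ∧ CuntzPimsner.IsArtinianCorrespondence φ) := by
  have h1 : Function.Injective φ ∧ Module.Finite Aᵐᵒᵖ E ∧ CuntzPimsner.IsArtinianCorrespondence φ →
      CuntzPimsner.IsFreeAction (fun z : Circle => CuntzPimsner.gauge φ z) := by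
    rintro ⟨hφ, hfin, hart⟩
    obtain ⟨n, e, f, h⟩ := CuntzPimsner.exists_one_eq_sum_rankOne (A := A) (E := E)
    exact CuntzPimsner.free_of_artinian hφ h hart
  have h2 : CuntzPimsner.IsFreeAction (fun z : Circle => CuntzPimsner.gauge φ z) →
      CuntzPimsner.IsSaturatedAction (fun z : Circle => CuntzPimsner.gauge φ z) :=
    (CuntzPimsner.gaugeAction φ).saturated_of_free
  have h3 : CuntzPimsner.IsSaturatedAction (fun z : Circle => CuntzPimsner.gauge φ z) →
      Function.Injective φ ∧ Module.Finite Aᵐᵒᵖ E ∧ CuntzPimsner.IsArtinianCorrespondence φ := by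
    intro h
    have hone := CuntzPimsner.one_mem_katsuraIdeal_of_saturated φ h
    exact ⟨CuntzPimsner.injective_of_one_mem_katsuraIdeal φ hone,
      CuntzPimsner.finite_of_one_mem_compactOperators (CuntzPimsner.one_mem_compactOperators φ hone),
      CuntzPimsner.isArtinian_of_saturated φ h⟩
  exact ⟨⟨fun h => h3 (h2 h), h1⟩, ⟨h3, fun h => h2 (h1 h)⟩⟩
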